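/- Throughout, an algorithm is a family of circuits indexed by the security parameter $\lambda$; it is polynomial-time if the circuits have size $\mathrm{poly}(\lambda)$. Classical algorithms are Boolean circuits, with uniformly random auxiliary input bits if they are probabilistic. Quantum (QPT) algorithms are generalized circuits over $\{\mathrm{CNOT},H,T\}$, with zero-initialized ancillas and traced-out qubits. All adversaries are QPT, and all lengths are polynomially bounded in $\lambda$. Assume: (1) Post-quantum $\mathsf{iO}$ for $\mathsf{P/poly}$. For all polynomially bounded $n,m,s$ there are a probabilistic polynomial-time $\mathsf{Obf}$ and a deterministic polynomial-time $\mathsf{Eval}$, for the class of all circuits with $n(\lambda)$ inputs, $m(\lambda)$ outputs and $s(\lambda)$ gates, such that $\mathsf{Eval}(\mathsf{Obf}(C),x)=C(x)$ always, and for every QPT $\mathcal A$ there is a negligible $\nu$ such that for all large $\lambda$ and all functionally equivalent $C_0,C_1$ in the class, $|\Pr[\mathcal A(\mathsf{Obf}(C_0),C_0,C_1)=1]-\Pr[\mathcal A(\mathsf{Obf}(C_1),C_0,C_1)=1]|\le\nu(\lambda)$. (2) A post-quantum puncturable PRF from $n(\lambda)$ bits to $n(\lambda)$ bits, with $2^{-n(\lambda)}$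 negligible: the key can be punctured at two points $x_1,x_2$ (possibly equal), the punctured key evaluates the function correctly at all other points, and for $x_1,x_2$ chosen in advance by a QPT adversary, the values at $x_1,x_2$ are indistinguishable from those of a uniformly random function, given the punctured key. (3) Generalized unclonable puncturable obfuscation (UPO) with identical challenges for $\mathsf{P/poly}$. A generalized puncturable keyed circuit class consists of key spaces $\mathcal K_\lambda\subseteq\{0,1\}^{\kappa(\lambda)}$, polynomial-size circuits $C_k:\{0,1\}^{n(\lambda)}\to\{0,1\}^{m(\lambda)}$ ($k\in\mathcal K_\lambda$), all of the same size and computable from $k$ in polynomial time, and a deterministic polynomial-time algorithm $\mathsf{GenPuncture}$ which on input $k$, polynomial-size circuits $\mu_{\mathcal B},\mu_{\mathcal C}$, and points $x^{\mathcal B},x^{\mathcal C}$ outputs a circuit of the same size as $C_k$ that maps $x^{\mathcal B}$ to $\mu_{\mathcal B}(x^{\mathcal B})$, maps $x^{\mathcal C}$ to $\mu_{\mathcal C}(x^{\mathcal C})$ if $x^{\mathcal C}\ne x^{\mathcal B}$, and agrees with $C_k$ elsewhere. For every such class with $2^{-n(\lambda)}$ negligible there are QPT algorithms $\mathsf{Obf}$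 (mapping a circuit to a quantum state) and $\mathsf{Eval}$ (mapping a state and $x$ to a state and a value $y$) such that: for all $k\in\mathcal K_\lambda$ and all $x$, evaluating $\mathsf{Obf}(C_k)$ at $x$ yields $C_k(x)$ with probability at least $1-\mathrm{negl}(\lambda)$; and every QPT $(\mathcal A,\mathcal B,\mathcal C)$ wins the following game with probability at most $\frac12+\mathrm{negl}(\lambda)$. $\mathcal A$ sends $(k,\mu_{\mathcal B},\mu_{\mathcal C})$, with $k\in\mathcal K_\lambda$ and polynomial-size circuits $\mu_{\mathcal B},\mu_{\mathcal C}$; the challenger samples a uniform bit $b$ and a uniform $x\in\{0,1\}^{n(\lambda)}$, and sends to $\mathcal A$ the state $\mathsf{Obf}(C_k)$ if $b=0$ and $\mathsf{Obf}(\mathsf{GenPuncture}(k,\mu_{\mathcal B},\mu_{\mathcal C},x,x))$ if $b=1$; $\mathcal A$ produces a bipartite state, shared between $\mathcal B$ and $\mathcal C$; without communicating, $\mathcal B$ and $\mathcal C$ both receive $x$ and output bits $b_{\mathcal B},b_{\mathcal C}$; they win if $b_{\mathcal B}=b_{\mathcal C}=b$. Then for every polynomially bounded message length $\ell(\lambda)$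 there is (in the plain model) a public-key unclonable encryption scheme for messages in $\{0,1\}^{\ell(\lambda)}$: QPT algorithms $(\mathsf{pk},\mathsf{sk})\leftarrow\mathsf{Gen}$ with classical keys, $\rho\leftarrow\mathsf{Enc}(\mathsf{pk},m)$ with quantum ciphertexts, and $\mathsf{Dec}(\mathsf{sk},\rho)$, such that every message $m$ is decrypted correctly with probability at least $1-\mathrm{negl}(\lambda)$, where $\mathrm{negl}$ does not depend on $m$, and every QPT $(\mathcal A,\mathcal B,\mathcal C)$ wins the following game with probability at most $\frac12+\mathrm{negl}(\lambda)$. $\mathcal A$ receives $\mathsf{pk}$ and sends $m_0,m_1\in\{0,1\}^{\ell(\lambda)}$; the challenger samples a uniform bit $b$ and returns $\mathsf{Enc}(\mathsf{pk},m_b)$; $\mathcal A$ produces a bipartite state, shared between $\mathcal B$ and $\mathcal C$; without communicating, $\mathcal B$ and $\mathcal C$ both receive $\mathsf{sk}$ and output bits $b_{\mathcal B},b_{\mathcal C}$; they win if $b_{\mathcal B}=b_{\mathcal C}=b$. -/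

import Mathlib

open scoped BigOperators

noncomputable section

namespace UnclonableCrypto

/-! ## Asymptotics -/

/-- `f` is bounded by a polynomial in the security parameter. -/
def PolyBdd (f : ℕ → ℕ) : Prop :=
  ∃ p : Polynomial ℕ, ∀ l, f l ≤ p.eval l

/-- `f` tends to zero faster than every inverse polynomial. -/
def Negligible (f : ℕ → ℝ) : Prop :=
  Asymptotics.SuperpolynomialDecay Filter.atTop (fun l : ℕ => (l : ℝ)) f

/-! ## Boolean circuits

Registers (of bits or of qubits) are indexed by finite types; `ι ⊕ κ` is the
concatenation of the registers `ι` and `κ`, and `Sum.elim x y` is the concatenation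
of the strings `x` and `y`. -/

/-- The bit strings indexed by `ι`. -/
abbrev Bits (ι : Type) : Type := ι → Bool

/-- A Boolean circuit with inputs `ι`, outputs `κ` and `s` NAND gates. The gates are evaluated
in the order `0, …, s - 1`; a wire is an input or the result of a gate, and a gate that has not
been evaluated yet holds `false` (so constants are available). -/
structure BCirc (ι κ : Type) (s : ℕ) where
  gate : Fin s → (ι ⊕ Fin s) × (ι ⊕ Fin s)
  out : κ → ι ⊕ Fin s

namespace BCirc

variable {ι κ : Type} {s : ℕ}

instance [Fintype ι] [Fintype κ] [DecidableEq κ] : Fintype (BCirc ι κ s) :=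
  Fintype.ofInjective (fun c => (c.gate, c.out)) (by
    rintro ⟨g, o⟩ ⟨g', o'⟩ h
    simp only [Prod.mk.injEq] at h
    rw [h.1, h.2])

/-- The contents of the gates after the first `t` of them have been evaluated. -/
def state (c : BCirc ι κ s) (x : Bits ι) : ℕ → Fin s → Bool
  | 0 => fun _ => false
  | t + 1 => fun i =>
      if (i : ℕ) = t then
        !(Sum.elim x (c.state x t) (c.gate i).1 && Sum.elim x (c.state x t) (c.gate i).2)
      else c.state x t i

/-- The function computed by a circuit. -/
def eval (c : BCirc ι κ s) (x : Bits ι) : Bits κ :=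
  fun o => Sum.elim x (c.state x s) (c.out o)

end BCirc

/-- The index type of the description of a circuit: one indicator vector over all the wires for
each of the two inputs of each gate and for each output. -/
def Desc (ι κ : Type) (s : ℕ) : Type := ((Fin s × Bool) ⊕ κ) × (ι ⊕ Fin s)

instance {ι κ : Type} {s : ℕ} [Fintype ι] [Fintype κ] : Fintype (Desc ι κ s) :=
  inferInstanceAs (Fintype (((Fin s × Bool) ⊕ κ) × (ι ⊕ Fin s)))

instance {ι κ : Type} {s : ℕ} [DecidableEq ι] [DecidableEq κ] : DecidableEq (Desc ι κ s) :=
  inferInstanceAs (DecidableEq (((Fin s × Bool) ⊕ κ) × (ι ⊕ Fin s)))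

/-- The description of a circuit as a bit string. -/
def BCirc.encode {ι κ : Type} {s : ℕ} [DecidableEq ι] (c : BCirc ι κ s) : Bits (Desc ι κ s) :=
  fun p =>
    match p.1 with
    | Sum.inl (i, false) => decide ((c.gate i).1 = p.2)
    | Sum.inl (i, true) => decide ((c.gate i).2 = p.2)
    | Sum.inr o => decide (c.out o = p.2)

/-- A Boolean circuit of unspecified size. A classical deterministic polynomial-time algorithm is
a family of these of polynomial size. A probabilistic one has an additional input register that
is filled with uniformly random bits. -/
abbrev BAlg (ι κ : Type) : Type := Σ s : ℕ, BCirc ι κ s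

/-- The output of a classical algorithm. -/
def BAlg.eval {ι κ : Type} (A : BAlg ι κ) (x : Bits ι) : Bits κ := A.2.eval x

/-- Number of gates, inputs and outputs. -/
def BAlg.size {ι κ : Type} [Fintype ι] [Fintype κ] (A : BAlg ι κ) : ℕ :=
  A.1 + Fintype.card ι + Fintype.card κ

/-! ## Quantum states and quantum circuits -/

/-- Operators on the qubits indexed by `ι`, in the computational basis. -/
abbrev Op (ι : Type) : Type := Matrix (Bits ι) (Bits ι) ℂ

section Operators

variable {ι κ τ : Type}

/-- The state `|x⟩⟨x|`. -/
def basis [Fintype ι] (x : Bits ι) : Op ι := Matrix.single x x 1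

/-- `ρ ⊗ σ`. -/
def tensor (ρ : Op ι) (σ : Op κ) : Op (ι ⊕ κ) :=
  Matrix.of fun w w' => ρ (w ∘ Sum.inl) (w' ∘ Sum.inl) * σ (w ∘ Sum.inr) (w' ∘ Sum.inr)

/-- The probability of the outcome `x` when all qubits are measured. -/
def prob (ρ : Op ι) (x : Bits ι) : ℝ := (ρ x x).re

/-- The state left on `κ` when the register `ι` is measured with outcome `x`, not normalized:
its trace is the probability of `x`. -/
def measL (x : Bits ι) (ρ : Op (ι ⊕ κ)) : Op κ :=
  Matrix.of fun z z' => ρ (Sum.elim x z) (Sum.elim x z')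

/-- The partial trace over the register `ι`. -/
def traceL [Fintype ι] [DecidableEq ι] (ρ : Op (ι ⊕ κ)) : Op κ := ∑ x : Bits ι, measL x ρ

/-- `Φ ⊗ id`, for a linear map `Φ` on operators. -/
def onLeft (Φ : Op ι → Op κ) (ρ : Op (ι ⊕ τ)) : Op (κ ⊕ τ) :=
  Matrix.of fun w w' =>
    Φ (Matrix.of fun x x' => ρ (Sum.elim x (w ∘ Sum.inr)) (Sum.elim x' (w' ∘ Sum.inr)))
      (w ∘ Sum.inl) (w' ∘ Sum.inl)

/-- `id ⊗ Φ`, for a linear map `Φ` on operators. -/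
def onRight (Φ : Op ι → Op κ) (ρ : Op (τ ⊕ ι)) : Op (τ ⊕ κ) :=
  Matrix.of fun w w' =>
    Φ (Matrix.of fun x x' => ρ (Sum.elim (w ∘ Sum.inl) x) (Sum.elim (w' ∘ Sum.inl) x'))
      (w ∘ Sum.inr) (w' ∘ Sum.inr)

end Operators

/-- The gates of the universal set `{CNOT, H, T}` on the qubits `N`. -/
inductive QGate (N : Type) : Type
  | H (i : N) : QGate N
  | T (i : N) : QGate N
  | CNOT (c t : N) (h : c ≠ t) : QGate N

/-- The unitary matrix of a gate. -/
def QGate.unitary {N : Type} [Fintype N] [DecidableEq N] : QGate N → Op N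
  | .H i => Matrix.of fun w w' =>
      if ∀ j, j ≠ i → w j = w' j then
        (if w i && w' i then -1 else 1) * ((Real.sqrt 2 : ℝ) : ℂ)⁻¹
      else 0
  | .T i => Matrix.diagonal fun w =>
      if w i then Complex.exp (Complex.I * (Real.pi / 4 : ℝ)) else 1
  | .CNOT c t _ => Matrix.of fun w w' =>
      if w = Function.update w' t (xor (w' t) (w' c)) then 1 else 0

/-- A generalized quantum circuit from the qubits `ι` to the qubits `κ`: `anc` further qubits are
initialized to zero, the gates are applied in order, and every qubit that is not an output is
traced out. -/
structure QCirc (ι κ : Type) where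
  anc : ℕ
  gates : List (QGate (ι ⊕ Fin anc))
  out : κ ↪ ι ⊕ Fin anc

/-- The partial trace onto the qubits in the range of `f`. -/
def restrict {N κ : Type} [Fintype N] [DecidableEq N] [Fintype κ]
    (f : κ → N) (M : Op N) : Op κ :=
  Matrix.of fun y y' => ∑ w : Bits N, ∑ w' : Bits N,
    if w ∘ f = y ∧ w' ∘ f = y' ∧ (∀ i, (∀ o, f o ≠ i) → w i = w' i) then M w w' else 0

namespace QCirc

variable {ι κ : Type} [Fintype ι] [DecidableEq ι] [Fintype κ]

/-- The quantum channel of a generalized quantum circuit. -/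
def run (A : QCirc ι κ) (ρ : Op ι) : Op κ :=
  restrict A.out
    (A.gates.foldl (fun M g => g.unitary * M * g.unitary.conjTranspose)
      (tensor ρ (basis fun _ : Fin A.anc => false)))

/-- Number of gates plus number of input qubits (with the ancillas) and of output qubits. -/
def size (A : QCirc ι κ) : ℕ :=
  A.gates.length + (Fintype.card ι + A.anc) + Fintype.card κ

/-- The state produced by a circuit without input qubits. -/
def prepare (A : QCirc Empty κ) : Op κ := A.run 1

end QCirc

/-- A quantum polynomial-time algorithm: a family of generalized quantum circuits, one for each
security parameter, of polynomial size. -/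
def QPT {ι κ : ℕ → Type} [∀ l, Fintype (ι l)] [∀ l, DecidableEq (ι l)] [∀ l, Fintype (κ l)]
    (A : ∀ l, QCirc (ι l) (κ l)) : Prop :=
  PolyBdd fun l => (A l).size

/-- A classical polynomial-time algorithm. -/
def PT {ι κ : ℕ → Type} [∀ l, Fintype (ι l)] [∀ l, Fintype (κ l)]
    (A : ∀ l, BAlg (ι l) (κ l)) : Prop :=
  PolyBdd fun l => (A l).size

/-- The probability that `B(x, ·) ⊗ C(x, ·)`, applied to a bipartite state, yields the two output
bits `(b, b)`. -/
def guessProb {χ β γ : Type} [Fintype χ] [DecidableEq χ] [Fintype β] [DecidableEq β]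
    [Fintype γ] [DecidableEq γ] (B : QCirc (χ ⊕ β) Unit) (C : QCirc (χ ⊕ γ) Unit)
    (x : Bits χ) (σ : Op (β ⊕ γ)) (b : Bool) : ℝ :=
  prob
    (onRight (fun ρ => C.run (tensor (basis x) ρ))
      (onLeft (fun ρ => B.run (tensor (basis x) ρ)) σ))
    (fun _ => b)

/-! ## Indistinguishability obfuscation -/

/-- An obfuscation scheme for the class of all circuits with `n l` inputs, `m l` outputs and
`s l` gates. -/
structure ObfScheme (n m s : ℕ → ℕ) where
  /-- number of random bits of the obfuscator -/
  r : ℕ → ℕ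
  /-- length of an obfuscated circuit -/
  t : ℕ → ℕ
  Obf : ∀ l, BAlg (Desc (Fin (n l)) (Fin (m l)) (s l) ⊕ Fin (r l)) (Fin (t l))
  Eval : ∀ l, BAlg (Fin (t l) ⊕ Fin (n l)) (Fin (m l))
  obf_pt : PT Obf
  eval_pt : PT Eval

namespace ObfScheme

variable {n m s : ℕ → ℕ}

/-- Perfect correctness. -/
def Correct (O : ObfScheme n m s) : Prop :=
  ∀ (l : ℕ) (C : BCirc (Fin (n l)) (Fin (m l)) (s l)) (ω : Bits (Fin (O.r l)))
    (x : Bits (Fin (n l))),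
    (O.Eval l).eval (Sum.elim ((O.Obf l).eval (Sum.elim C.encode ω)) x) = C.eval x

/-- The probability that a distinguisher accepts `(Obf(C), C₀, C₁)`. -/
def acceptProb (O : ObfScheme n m s) (l : ℕ)
    (A : QCirc (Fin (O.t l) ⊕ (Desc (Fin (n l)) (Fin (m l)) (s l) ⊕
      Desc (Fin (n l)) (Fin (m l)) (s l))) Unit)
    (C C₀ C₁ : BCirc (Fin (n l)) (Fin (m l)) (s l)) : ℝ :=
  𝔼 ω : Bits (Fin (O.r l)),
    prob (A.run (basis (Sum.elim ((O.Obf l).eval (Sum.elim C.encode ω))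
      (Sum.elim C₀.encode C₁.encode)))) (fun _ => true)

/-- Post-quantum indistinguishability of obfuscations of equivalent circuits. -/
def Secure (O : ObfScheme n m s) : Prop :=
  ∀ A : (∀ l, QCirc (Fin (O.t l) ⊕ (Desc (Fin (n l)) (Fin (m l)) (s l) ⊕
      Desc (Fin (n l)) (Fin (m l)) (s l))) Unit), QPT A →
    ∃ ν : ℕ → ℝ, Negligible ν ∧ ∀ᶠ l in Filter.atTop,
      ∀ C₀ C₁ : BCirc (Fin (n l)) (Fin (m l)) (s l), (∀ x, C₀.eval x = C₁.eval x) →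
        |O.acceptProb l (A l) C₀ C₀ C₁ - O.acceptProb l (A l) C₁ C₀ C₁| ≤ ν l

end ObfScheme

/-- Post-quantum indistinguishability obfuscation exists for `P/poly`. -/
def ExistsIndObf : Prop :=
  ∀ n m s : ℕ → ℕ, PolyBdd n → PolyBdd m → PolyBdd s →
    ∃ O : ObfScheme n m s, O.Correct ∧ O.Secure

/-! ## Puncturable pseudorandom functions -/

/-- The algorithms of a function family from `n l` bits to `n l` bits with keys that can be
punctured at two points. `EvalPunct` is evaluation with a punctured key. -/
structure PunctPRF where
  n : ℕ → ℕ
  /-- key length -/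
  κ : ℕ → ℕ
  /-- length of punctured keys -/
  κp : ℕ → ℕ
  /-- number of random bits of key generation -/
  rg : ℕ → ℕ
  /-- number of random bits of puncturing -/
  rp : ℕ → ℕ
  Gen : ∀ l, BAlg (Fin (rg l)) (Fin (κ l))
  Eval : ∀ l, BAlg (Fin (κ l) ⊕ Fin (n l)) (Fin (n l))
  Puncture : ∀ l, BAlg ((Fin (κ l) ⊕ (Fin (n l) ⊕ Fin (n l))) ⊕ Fin (rp l)) (Fin (κp l))
  EvalPunct : ∀ l, BAlg (Fin (κp l) ⊕ Fin (n l)) (Fin (n l))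
  gen_pt : PT Gen
  eval_pt : PT Eval
  puncture_pt : PT Puncture
  evalPunct_pt : PT EvalPunct

namespace PunctPRF

/-- The function with key `k`. -/
def fn (F : PunctPRF) (l : ℕ) (k : Bits (Fin (F.κ l))) (x : Bits (Fin (F.n l))) :
    Bits (Fin (F.n l)) :=
  (F.Eval l).eval (Sum.elim k x)

/-- The key `k` punctured at `x₁` and `x₂`, with random bits `ω`. -/
def punctKey (F : PunctPRF) (l : ℕ) (k : Bits (Fin (F.κ l))) (x₁ x₂ : Bits (Fin (F.n l)))
    (ω : Bits (Fin (F.rp l))) : Bits (Fin (F.κp l)) :=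
  (F.Puncture l).eval (Sum.elim (Sum.elim k (Sum.elim x₁ x₂)) ω)

/-- A punctured key computes the function at all other points. -/
def Correct (F : PunctPRF) : Prop :=
  ∀ (l : ℕ) (ωg : Bits (Fin (F.rg l))) (ωp : Bits (Fin (F.rp l)))
    (x₁ x₂ x : Bits (Fin (F.n l))), x ≠ x₁ → x ≠ x₂ →
    (F.EvalPunct l).eval (Sum.elim (F.punctKey l ((F.Gen l).eval ωg) x₁ x₂ ωp) x) =
      F.fn l ((F.Gen l).eval ωg) x

/-- A quantum adversary: `A₁` chooses the two points and keeps a quantum state; `A₂` receives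
this state, the points, the punctured key and two values. -/
structure Adversary (F : PunctPRF) where
  a : ℕ → ℕ
  A₁ : ∀ l, QCirc Empty ((Fin (F.n l) ⊕ Fin (F.n l)) ⊕ Fin (a l))
  A₂ : ∀ l, QCirc (Fin (a l) ⊕ ((Fin (F.n l) ⊕ Fin (F.n l)) ⊕
    (Fin (F.κp l) ⊕ (Fin (F.n l) ⊕ Fin (F.n l))))) Unit
  qpt₁ : QPT A₁
  qpt₂ : QPT A₂

variable {F : PunctPRF}

/-- The probability that the adversary chooses `x₁`, `x₂` and then accepts the punctured key `kp`
and the values `y₁`, `y₂`. -/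
def Adversary.acceptProb (A : F.Adversary) (l : ℕ) (x₁ x₂ : Bits (Fin (F.n l)))
    (kp : Bits (Fin (F.κp l))) (y₁ y₂ : Bits (Fin (F.n l))) : ℝ :=
  prob ((A.A₂ l).run (tensor (measL (Sum.elim x₁ x₂) (A.A₁ l).prepare)
    (basis (Sum.elim (Sum.elim x₁ x₂) (Sum.elim kp (Sum.elim y₁ y₂)))))) (fun _ => true)

/-- Acceptance probability when the values are those of the function. -/
def Adversary.realProb (A : F.Adversary) (l : ℕ) : ℝ :=
  ∑ x₁ : Bits (Fin (F.n l)), ∑ x₂ : Bits (Fin (F.n l)),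
    𝔼 ωg : Bits (Fin (F.rg l)), 𝔼 ωp : Bits (Fin (F.rp l)),
      A.acceptProb l x₁ x₂ (F.punctKey l ((F.Gen l).eval ωg) x₁ x₂ ωp)
        (F.fn l ((F.Gen l).eval ωg) x₁) (F.fn l ((F.Gen l).eval ωg) x₂)

/-- Acceptance probability when the values are those of a uniformly random function. -/
def Adversary.idealProb (A : F.Adversary) (l : ℕ) : ℝ :=
  ∑ x₁ : Bits (Fin (F.n l)), ∑ x₂ : Bits (Fin (F.n l)),
    𝔼 ωg : Bits (Fin (F.rg l)), 𝔼 ωp : Bits (Fin (F.rp l)),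
      𝔼 u₁ : Bits (Fin (F.n l)), 𝔼 u₂ : Bits (Fin (F.n l)),
        A.acceptProb l x₁ x₂ (F.punctKey l ((F.Gen l).eval ωg) x₁ x₂ ωp)
          u₁ (if x₁ = x₂ then u₁ else u₂)

/-- Post-quantum pseudorandomness at the punctured points. -/
def Secure (F : PunctPRF) : Prop :=
  ∀ A : F.Adversary, ∃ ν : ℕ → ℝ, Negligible ν ∧
    ∀ l, |A.realProb l - A.idealProb l| ≤ ν l

end PunctPRF

/-- A post-quantum puncturable pseudorandom function family exists, whose domain is not of
polynomial size. -/
def ExistsPunctPRF : Prop :=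
  ∃ F : PunctPRF, Negligible (fun l => ((2 : ℝ) ^ F.n l)⁻¹) ∧ F.Correct ∧ F.Secure

/-! ## Unclonable puncturable obfuscation -/

/-- A generalized puncturable keyed circuit class in `P/poly`. All circuits at security parameter
`l`, punctured or not, have `n l` inputs, `m l` outputs and `size l` gates. -/
structure GenPunctClass where
  n : ℕ → ℕ
  m : ℕ → ℕ
  size : ℕ → ℕ
  /-- key length -/
  κ : ℕ → ℕ
  n_poly : PolyBdd n
  m_poly : PolyBdd m
  size_poly : PolyBdd size
  κ_poly : PolyBdd κ
  /-- key space -/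
  keys : ∀ l, Finset (Bits (Fin (κ l)))
  /-- the circuit `C_k` -/
  circ : ∀ l, Bits (Fin (κ l)) → BCirc (Fin (n l)) (Fin (m l)) (size l)
  /-- the description of `C_k` is computable from `k` in polynomial time -/
  circ_pt : ∃ P : ∀ l, BAlg (Fin (κ l)) (Desc (Fin (n l)) (Fin (m l)) (size l)), PT P ∧
    ∀ l, ∀ k ∈ keys l, (P l).eval k = (circ l k).encode
  /-- `genPuncture l s k μB μC xB xC`, for circuits `μB` and `μC` with `s` gates -/
  genPuncture : ∀ l s, Bits (Fin (κ l)) →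
    BCirc (Fin (n l)) (Fin (m l)) s → BCirc (Fin (n l)) (Fin (m l)) s →
    Bits (Fin (n l)) → Bits (Fin (n l)) → BCirc (Fin (n l)) (Fin (m l)) (size l)
  genPuncture_eval : ∀ l s, ∀ k ∈ keys l, ∀ μB μC xB xC x,
    (genPuncture l s k μB μC xB xC).eval x =
      if x = xB then μB.eval xB else if x = xC then μC.eval xC else (circ l k).eval x
  /-- puncturing takes polynomial time on circuits of polynomial size -/
  genPuncture_pt : ∀ s : ℕ → ℕ, PolyBdd s →
    ∃ P : ∀ l, BAlg
        (Fin (κ l) ⊕ ((Desc (Fin (n l)) (Fin (m l)) (s l) ⊕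
          Desc (Fin (n l)) (Fin (m l)) (s l)) ⊕ (Fin (n l) ⊕ Fin (n l))))
        (Desc (Fin (n l)) (Fin (m l)) (size l)), PT P ∧
      ∀ l, ∀ k ∈ keys l, ∀ μB μC xB xC,
        (P l).eval (Sum.elim k (Sum.elim (Sum.elim μB.encode μC.encode) (Sum.elim xB xC))) =
          (genPuncture l (s l) k μB μC xB xC).encode

/-- The algorithms of an unclonable puncturable obfuscation scheme. `Eval` returns a state and
the value. -/
structure UPOScheme (𝔠 : GenPunctClass) where
  /-- number of qubits of an obfuscated circuit -/
  q : ℕ → ℕ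
  Obf : ∀ l, QCirc (Desc (Fin (𝔠.n l)) (Fin (𝔠.m l)) (𝔠.size l)) (Fin (q l))
  Eval : ∀ l, QCirc (Fin (q l) ⊕ Fin (𝔠.n l)) (Fin (q l) ⊕ Fin (𝔠.m l))
  obf_qpt : QPT Obf
  eval_qpt : QPT Eval

namespace UPOScheme

variable {𝔠 : GenPunctClass}

/-- Correctness up to a negligible error. -/
def Correct (U : UPOScheme 𝔠) : Prop :=
  ∃ δ : ℕ → ℝ, Negligible δ ∧ ∀ l, ∀ k ∈ 𝔠.keys l, ∀ x : Bits (Fin (𝔠.n l)),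
    1 - δ l ≤ prob (traceL ((U.Eval l).run
      (tensor ((U.Obf l).run (basis (𝔠.circ l k).encode)) (basis x)))) ((𝔠.circ l k).eval x)

/-- A quantum adversary `(A, B, C)`: `A₁` sends the key `k` and the circuits `μB`, `μC` (with
`s l` gates) and keeps a quantum state; `A₂` receives this state and the obfuscation, and outputs
a bipartite state for `B` and `C`. -/
structure Adversary (U : UPOScheme 𝔠) where
  s : ℕ → ℕ
  a : ℕ → ℕ
  β : ℕ → ℕ
  γ : ℕ → ℕ
  A₁ : ∀ l, QCirc Empty ((Fin (𝔠.κ l) ⊕ (Desc (Fin (𝔠.n l)) (Fin (𝔠.m l)) (s l) ⊕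
    Desc (Fin (𝔠.n l)) (Fin (𝔠.m l)) (s l))) ⊕ Fin (a l))
  A₂ : ∀ l, QCirc (Fin (a l) ⊕ Fin (U.q l)) (Fin (β l) ⊕ Fin (γ l))
  B : ∀ l, QCirc (Fin (𝔠.n l) ⊕ Fin (β l)) Unit
  C : ∀ l, QCirc (Fin (𝔠.n l) ⊕ Fin (γ l)) Unit
  s_poly : PolyBdd s
  qptA₁ : QPT A₁
  qptA₂ : QPT A₂
  qptB : QPT B
  qptC : QPT C

variable {U : UPOScheme 𝔠}

/-- The probability that the adversary wins the generalized security experiment with the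
identical challenge distribution: the challenger draws one uniform point `x`, punctures at
`(x, x)`, and hands `x` to both `B` and `C`, who both have to guess `b`. An adversary that does
not send a key in the key space and descriptions of two circuits loses. -/
def Adversary.winProb (A : U.Adversary) (l : ℕ) : ℝ :=
  ∑ k ∈ 𝔠.keys l, ∑ μB : BCirc (Fin (𝔠.n l)) (Fin (𝔠.m l)) (A.s l),
    ∑ μC : BCirc (Fin (𝔠.n l)) (Fin (𝔠.m l)) (A.s l),
      𝔼 x : Bits (Fin (𝔠.n l)), 𝔼 b : Bool,
        guessProb (A.B l) (A.C l) x
          ((A.A₂ l).run (tensor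
            (measL (Sum.elim k (Sum.elim μB.encode μC.encode)) (A.A₁ l).prepare)
            ((U.Obf l).run (basis
              (if b then 𝔠.genPuncture l (A.s l) k μB μC x x else 𝔠.circ l k).encode))))
          b

/-- Generalized UPO security with respect to the identical challenge distribution. -/
def Secure (U : UPOScheme 𝔠) : Prop :=
  ∀ A : U.Adversary, ∃ ν : ℕ → ℝ, Negligible ν ∧ ∀ l, A.winProb l ≤ 1 / 2 + ν l

end UPOScheme

/-- Generalized unclonable puncturable obfuscation with identical challenges exists for every
generalized puncturable keyed circuit class in `P/poly` whose input space is not of polynomial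
size. -/
def ExistsIdenticalGenUPO : Prop :=
  ∀ 𝔠 : GenPunctClass, Negligible (fun l => ((2 : ℝ) ^ 𝔠.n l)⁻¹) →
    ∃ U : UPOScheme 𝔠, U.Correct ∧ U.Secure

/-! ## Public-key unclonable encryption -/

/-- The algorithms of a public-key unclonable encryption scheme for messages of `len l` bits, with
classical keys and quantum ciphertexts. -/
structure PKUE (len : ℕ → ℕ) where
  /-- length of the public key -/
  p : ℕ → ℕ
  /-- length of the secret key -/
  k : ℕ → ℕ
  /-- number of qubits of a ciphertext -/
  c : ℕ → ℕ
  Gen : ∀ l, QCirc Empty (Fin (p l) ⊕ Fin (k l))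
  Enc : ∀ l, QCirc (Fin (p l) ⊕ Fin (len l)) (Fin (c l))
  Dec : ∀ l, QCirc (Fin (k l) ⊕ Fin (c l)) (Fin (len l))
  gen_qpt : QPT Gen
  enc_qpt : QPT Enc
  dec_qpt : QPT Dec

namespace PKUE

variable {len : ℕ → ℕ}

/-- The probability that key generation outputs `(pk, sk)`. -/
def keyProb (E : PKUE len) (l : ℕ) (pk : Bits (Fin (E.p l))) (sk : Bits (Fin (E.k l))) : ℝ :=
  prob (E.Gen l).prepare (Sum.elim pk sk)

/-- The encryption of `msg`. -/
def ct (E : PKUE len) (l : ℕ) (pk : Bits (Fin (E.p l))) (msg : Bits (Fin (len l))) :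
    Op (Fin (E.c l)) :=
  (E.Enc l).run (basis (Sum.elim pk msg))

/-- Correctness up to a negligible error. -/
def Correct (E : PKUE len) : Prop :=
  ∃ δ : ℕ → ℝ, Negligible δ ∧ ∀ (l : ℕ) (msg : Bits (Fin (len l))),
    1 - δ l ≤ ∑ pk : Bits (Fin (E.p l)), ∑ sk : Bits (Fin (E.k l)),
      E.keyProb l pk sk * prob ((E.Dec l).run (tensor (basis sk) (E.ct l pk msg))) msg

/-- A quantum adversary `(A, B, C)`: `A₁` receives the public key, sends two messages and keeps a
quantum state; `A₂` receives this state and the ciphertext, and outputs a bipartite state for `B`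
and `C`, who then both receive the secret key. -/
structure Adversary (E : PKUE len) where
  a : ℕ → ℕ
  β : ℕ → ℕ
  γ : ℕ → ℕ
  A₁ : ∀ l, QCirc (Fin (E.p l)) ((Fin (len l) ⊕ Fin (len l)) ⊕ Fin (a l))
  A₂ : ∀ l, QCirc (Fin (a l) ⊕ Fin (E.c l)) (Fin (β l) ⊕ Fin (γ l))
  B : ∀ l, QCirc (Fin (E.k l) ⊕ Fin (β l)) Unit
  C : ∀ l, QCirc (Fin (E.k l) ⊕ Fin (γ l)) Unit
  qptA₁ : QPT A₁
  qptA₂ : QPT A₂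
  qptB : QPT B
  qptC : QPT C

variable {E : PKUE len}

/-- The probability that `B` and `C` both guess which of the two messages was encrypted. -/
def Adversary.winProb (A : E.Adversary) (l : ℕ) : ℝ :=
  ∑ pk : Bits (Fin (E.p l)), ∑ sk : Bits (Fin (E.k l)),
    E.keyProb l pk sk *
      ∑ m₀ : Bits (Fin (len l)), ∑ m₁ : Bits (Fin (len l)), 𝔼 b : Bool,
        guessProb (A.B l) (A.C l) sk
          ((A.A₂ l).run (tensor
            (measL (Sum.elim m₀ m₁) ((A.A₁ l).run (basis pk)))
            (E.ct l pk (if b then m₁ else m₀))))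
          b

/-- CPA security of unclonable encryption. -/
def Secure (E : PKUE len) : Prop :=
  ∀ A : E.Adversary, ∃ ν : ℕ → ℝ, Negligible ν ∧ ∀ l, A.winProb l ≤ 1 / 2 + ν l

end PKUE

end UnclonableCrypto

end

/-!
The scheme. All building blocks are made from the given primitives: a puncturable pseudorandom
function family with one output bit (`BitPRF`), a length-extending generator `G` obtained from it,
obfuscation of functions with hardwired data (`DataObf`), and unclonable obfuscation of functions
that are given by codes (`CodeUPO`).

* The public key consists of the values `G(s i b)` for all positions `i` and bits `b`; the secret key
  is a random string `v` together with the seeds `s i (v i)`.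
* To encrypt `m`, choose random strings `x`, `c`, `σ` and a key `K` of a pseudorandom function whose
  outputs at a point have two bits for each bit of `m`. The ciphertext contains an obfuscated lock
  that returns `(x, c)` to a holder of a valid secret key, the string `σ`, the masked message
  `e = m ⊕ c ⊕ F_K(x)_σ`, where `F_K(x)_σ` consists of the bits of `F_K(x)` selected by `σ`, and an
  unclonable obfuscation of an obfuscated program for `F_K`.
* To decrypt, open the lock, evaluate the program at `x`, and remove the masks.

Security. The lock can be replaced by one that hides `(x, c) ⊕ v` and adds the `v` of the secret key
that is presented (`BitPRF.lock_secure`): after the unselected parts of the public key have been made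
uniform, almost surely no secret key with another `v` is valid, and the two locks are equivalent. The
string `t = (x, c) ⊕ v` is then independent of `(x, c)`, so that `x` and `c` occur in the secret key
only, through `v = t ⊕ (x, c)`; and since `c` is uniform, so is `e`, whatever the message, and `c` can
be computed from `e`, the message and `F_K(x)_σ` (`expect_lossy`). The ciphertext is now independent
of `x`, and the secret key is a function of `x`: this is the situation in the game for unclonable
obfuscation.

Let `σ = ρ ⊕ m₀ ⊕ m₁`, and let the replaced values be `F_K(x)` with the bit at `(i, β)` changed by
`ρ i ⊕ β`. The bits selected by `σ` are then changed by `m₀ ⊕ m₁`, so that the encryption of `m₀` with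
replaced values is an encryption of `m₁` with the original ones (`expect_view_twist`). As `F_K(x)` is
indistinguishable from a uniform string, the replacement itself cannot be noticed
(`exists_view_prog`). So guessing which message was encrypted is as hard as guessing whether the
program was changed at `x`, which is the game for unclonable obfuscation (`exists_view_upo`).

None of the circuits given to the classical obfuscation depends on the messages, which the adversary
chooses together with a quantum state that cannot be fixed in advance.

Adversaries are families of circuits, hence all data of a reduction except its input can be fixed in
the best possible way at each security parameter (`Negligible.exists_negligible_forall_le`). The
predicates `PC`, `PS`, `PK` and `PP` express polynomial size uniformly in such hardwired data. For
the quantum algorithms, Boolean circuits are translated to circuits of the gates `CNOT`, `H` and `T`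
(`BCirc.toQCirc_run`), and classical control and measurement are built from them (`QK.meas`).
-/

noncomputable section

set_option linter.unusedSectionVars false
set_option synthInstance.maxSize 1000

namespace UnclonableCrypto

/-! ### Polynomial bounds and negligible functions -/

namespace PolyBdd

variable {f g : ℕ → ℕ}

lemma mono (hg : PolyBdd g) (h : ∀ l, f l ≤ g l) : PolyBdd f :=
  let ⟨p, hp⟩ := hg
  ⟨p, fun l => (h l).trans (hp l)⟩

lemma const (c : ℕ) : PolyBdd fun _ => c := ⟨Polynomial.C c, fun l => by simp⟩

lemma id : PolyBdd fun l => l := ⟨Polynomial.X, fun l => by simp⟩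

lemma add (hf : PolyBdd f) (hg : PolyBdd g) : PolyBdd fun l => f l + g l :=
  let ⟨p, hp⟩ := hf
  let ⟨q, hq⟩ := hg
  ⟨p + q, fun l => by rw [Polynomial.eval_add]; exact add_le_add (hp l) (hq l)⟩

lemma mul (hf : PolyBdd f) (hg : PolyBdd g) : PolyBdd fun l => f l * g l :=
  let ⟨p, hp⟩ := hf
  let ⟨q, hq⟩ := hg
  ⟨p * q, fun l => by rw [Polynomial.eval_mul]; exact Nat.mul_le_mul (hp l) (hq l)⟩

end PolyBdd

namespace Negligible

variable {f g : ℕ → ℝ}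

lemma of_eventually_le (hg : Negligible g) (h0 : ∀ᶠ l in Filter.atTop, 0 ≤ f l)
    (h : ∀ᶠ l in Filter.atTop, f l ≤ g l) : Negligible f := by
  refine Asymptotics.SuperpolynomialDecay.trans_eventually_abs_le hg ?_
  filter_upwards [h0, h] with l h0 h
  simp only [Function.comp]
  exact abs_le_abs_of_nonneg h0 h

lemma abs (hf : Negligible f) : Negligible fun l => |f l| :=
  Asymptotics.SuperpolynomialDecay.trans_abs_le hf fun l => by simp

lemma add (hf : Negligible f) (hg : Negligible g) : Negligible fun l => f l + g l :=
  Asymptotics.SuperpolynomialDecay.add hf hg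

lemma const_mul (hf : Negligible f) (c : ℝ) : Negligible fun l => c * f l :=
  Asymptotics.SuperpolynomialDecay.const_mul hf c

lemma poly_mul {p : ℕ → ℕ} (hp : PolyBdd p) (hf : Negligible f) :
    Negligible fun l => (p l : ℝ) * f l := by
  obtain ⟨q, hq⟩ := hp
  have h := Asymptotics.SuperpolynomialDecay.polynomial_mul hf (q.map (Nat.castRingHom ℝ))
  refine Asymptotics.SuperpolynomialDecay.trans_abs_le h fun l => ?_
  rw [abs_mul, abs_mul]
  gcongr
  have hq' : (p l : ℝ) ≤ Polynomial.eval (l : ℝ) (q.map (Nat.castRingHom ℝ)) := by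
    have h1 : Polynomial.eval (l : ℝ) (q.map (Nat.castRingHom ℝ)) = ((q.eval l : ℕ) : ℝ) := by
      simp [Polynomial.eval_natCast_map]
    rw [h1]
    exact_mod_cast hq l
  exact hq'

/-- Finitely many values do not matter. -/
lemma congr_eventually (hf : Negligible f) (h : ∀ᶠ l in Filter.atTop, f l = g l) : Negligible g :=
  Asymptotics.SuperpolynomialDecay.congr' hf h

lemma two_pow_inv : Negligible fun l => ((2 : ℝ) ^ l)⁻¹ := by
  intro k
  have h := tendsto_pow_const_div_const_pow_of_one_lt k (r := (2 : ℝ)) (by norm_num)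
  simpa [div_eq_mul_inv] using h

lemma eventually_lt_one (hf : Negligible f) : ∀ᶠ l in Filter.atTop, f l < 1 := by
  have h : Filter.Tendsto f Filter.atTop (nhds 0) := by simpa using! hf 0
  exact h.eventually_lt_const one_pos

end Negligible

/-- If a quantity depending on the security parameter and on a further choice is eventually
negligible however the choice is made at each security parameter, then it is negligible uniformly
in the choice. This is where the nonuniformity of the adversaries is used. -/
lemma exists_negligible_forall_le {X : ℕ → Type*} [∀ l, Nonempty (X l)] (val : ∀ l, X l → ℝ)
    (hb : ∀ l x, val l x ≤ 1)
    (h : ∀ x : (∀ l, X l), ∃ ν, Negligible ν ∧ ∀ᶠ l in Filter.atTop, val l (x l) ≤ ν l) :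
    ∃ ν, Negligible ν ∧ (∀ l, 0 ≤ ν l) ∧ ∀ l x, val l x ≤ ν l := by
  have hbdd : ∀ l, BddAbove (Set.range (val l)) := fun l => ⟨1, by rintro _ ⟨x, rfl⟩; exact hb l x⟩
  -- a choice that comes within a factor of two of the supremum, when this is positive
  have hx : ∀ l, ∃ x : X l, 0 < (⨆ x, val l x) → (⨆ x, val l x) / 2 ≤ val l x := by
    intro l
    by_cases hp : 0 < ⨆ x, val l x
    · obtain ⟨x, hx⟩ := exists_lt_of_lt_ciSup (half_lt_self hp)
      exact ⟨x, fun _ => hx.le⟩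
    · exact ⟨Classical.arbitrary _, fun h => absurd h hp⟩
  choose x hx using hx
  obtain ⟨ν, hν, hle⟩ := h x
  refine ⟨fun l => max 0 (⨆ x, val l x), ?_, fun l => le_max_left _ _,
    fun l y => (le_ciSup (hbdd l) y).trans (le_max_right _ _)⟩
  refine (hν.abs.const_mul 2).of_eventually_le (.of_forall fun l => le_max_left _ _) ?_
  filter_upwards [hle] with l hl
  refine max_le (by positivity) ?_
  by_cases hp : 0 < ⨆ x, val l x
  · linarith [hx l hp, le_abs_self (ν l)]
  · linarith [abs_nonneg (ν l)]

/-! ### Boolean circuits -/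

namespace BCirc

variable {ι κ τ δ : Type} {s t : ℕ}

/-- The content of the wires when gate `i` is evaluated, if the gates have the values `v`. -/
def wires (x : Bits ι) (v : Fin s → Bool) (i : Fin s) : ι ⊕ Fin s → Bool :=
  Sum.elim x fun j => decide (j < i) && v j

/-- `v` assigns to each gate the value that it gets on input `x`. -/
def IsVal (c : BCirc ι κ s) (x : Bits ι) (v : Fin s → Bool) : Prop :=
  ∀ i, v i = !(wires x v i (c.gate i).1 && wires x v i (c.gate i).2)

lemma state_succ (c : BCirc ι κ s) (x : Bits ι) (n : ℕ) (i : Fin s) :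
    c.state x (n + 1) i = if (i : ℕ) = n then
      !(Sum.elim x (c.state x n) (c.gate i).1 && Sum.elim x (c.state x n) (c.gate i).2)
      else c.state x n i := rfl

lemma state_eq_of_isVal {c : BCirc ι κ s} {x : Bits ι} {v : Fin s → Bool} (hv : c.IsVal x v)
    (n : ℕ) : c.state x n = fun i : Fin s => decide ((i : ℕ) < n) && v i := by
  induction n with
  | zero => funext i; simp [state]
  | succ n ih =>
    funext i
    rw [state_succ]
    by_cases h : (i : ℕ) = n
    · have hw : (Sum.elim x (c.state x n) : ι ⊕ Fin s → Bool) = wires x v i := by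
        rw [ih, wires]
        congr 1
        funext j
        simp [Fin.lt_def, h]
      rw [if_pos h, hw, ← hv i]
      simp [h]
    · rw [if_neg h, ih]
      have : (i : ℕ) < n + 1 ↔ (i : ℕ) < n := by omega
      simp [this]

lemma eval_eq_of_isVal {c : BCirc ι κ s} {x : Bits ι} {v : Fin s → Bool} (hv : c.IsVal x v) :
    c.eval x = fun o => Sum.elim x v (c.out o) := by
  funext o
  rw [eval, state_eq_of_isVal hv]
  congr 2
  simp

lemma exists_isVal (c : BCirc ι κ s) (x : Bits ι) : ∃ v, c.IsVal x v := by
  -- the content of gate `i` right after its evaluation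
  have key : ∀ n, ∀ i : Fin s, c.state x n i = (decide ((i : ℕ) < n) && c.state x (i + 1) i) := by
    intro n
    induction n with
    | zero => intro i; simp [state]
    | succ n ih =>
      intro i
      by_cases h : (i : ℕ) = n
      · simp [h]
      · rw [state_succ c x n, if_neg h, ih]
        have : (i : ℕ) < n + 1 ↔ (i : ℕ) < n := by omega
        simp [this]
  refine ⟨fun i => c.state x (i + 1) i, fun i => ?_⟩
  have hw : (Sum.elim x (c.state x i) : ι ⊕ Fin s → Bool) =
      wires x (fun i => c.state x (i + 1) i) i := by
    rw [wires]
    congr 1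
    funext j
    rw [key]
    rfl
  show c.state x (i + 1) i = _
  rw [← hw]
  simp [state]

/-- First `c`, then `d` on the inputs and the outputs of `c`. -/
def seq (c : BCirc ι κ s) (d : BCirc (ι ⊕ κ) τ t) : BCirc ι (κ ⊕ τ) (s + t) :=
  let f : ι ⊕ Fin s → ι ⊕ Fin (s + t) := Sum.map id (Fin.castAdd t)
  let g : (ι ⊕ κ) ⊕ Fin t → ι ⊕ Fin (s + t) :=
    Sum.elim (Sum.elim Sum.inl fun o => f (c.out o)) fun j => Sum.inr (Fin.natAdd s j)
  { gate := Fin.addCases (fun i => (f (c.gate i).1, f (c.gate i).2))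
      fun j => (g (d.gate j).1, g (d.gate j).2)
    out := Sum.elim (fun o => f (c.out o)) fun o => g (d.out o) }

lemma seq_eval (c : BCirc ι κ s) (d : BCirc (ι ⊕ κ) τ t) (x : Bits ι) :
    (c.seq d).eval x = Sum.elim (c.eval x) (d.eval (Sum.elim x (c.eval x))) := by
  obtain ⟨v, hv⟩ := c.exists_isVal x
  obtain ⟨w, hw⟩ := d.exists_isVal (Sum.elim x (c.eval x))
  have hval : (c.seq d).IsVal x (Fin.addCases v w) := by
    intro i
    refine Fin.addCases (fun i => ?_) (fun j => ?_) i
    · have h : ∀ a : ι ⊕ Fin s,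
          wires x (Fin.addCases v w : Fin (s + t) → Bool) (Fin.castAdd t i)
            (Sum.map id (Fin.castAdd t) a) = wires x v i a := by
        rintro (a | a)
        · simp [wires]
        · have : Fin.castAdd t a < Fin.castAdd t i ↔ a < i := Iff.rfl
          simp [wires, this]
      simp only [seq, Fin.addCases_left, h]
      exact hv i
    · have h : ∀ a : (ι ⊕ κ) ⊕ Fin t,
          wires x (Fin.addCases v w : Fin (s + t) → Bool) (Fin.natAdd s j)
            (Sum.elim (Sum.elim Sum.inl fun o => Sum.map id (Fin.castAdd t) (c.out o))
              (fun j => Sum.inr (Fin.natAdd s j)) a) = wires (Sum.elim x (c.eval x)) w j a := by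
        rintro ((a | a) | a)
        · simp [wires]
        · rw [eval_eq_of_isVal hv]
          rcases h : c.out a with b | b
          · simp [wires, h]
          · have : Fin.castAdd t b < Fin.natAdd s j := by
              simp only [Fin.lt_def, Fin.val_castAdd, Fin.val_natAdd]; omega
            simp [wires, h, this]
        · simp [wires]
      simp only [seq, Fin.addCases_right, h]
      exact hw j
  rw [eval_eq_of_isVal hval]
  funext o
  rcases o with o | o
  · rw [eval_eq_of_isVal hv]
    rcases h : c.out o with b | b <;> simp [seq, h]
  · rw [Sum.elim_inr, eval_eq_of_isVal hw]
    rcases h : d.out o with (b | b) | b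
    · simp [seq, h]
    · rw [eval_eq_of_isVal hv]
      rcases h' : c.out b with a | a <;> simp [seq, h, h']
    · simp [seq, h]

lemma eval_map_out {κ' : Type} (c : BCirc ι κ s) (φ : κ' → κ) (x : Bits ι) :
    (⟨c.gate, fun o => c.out (φ o)⟩ : BCirc ι κ' s).eval x = c.eval x ∘ φ := by
  obtain ⟨v, hv⟩ := c.exists_isVal x
  rw [eval_eq_of_isVal (c := c) hv]
  exact eval_eq_of_isVal (v := v) hv

/-- A circuit producing the constant string `k`; its first gate produces `true`. -/
def constant [Fintype δ] (ι : Type) (k : Bits δ) : BCirc ι δ (Fintype.card δ + 1) where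
  gate := Fin.cases (Sum.inr 0, Sum.inr 0) fun i =>
    if k ((Fintype.equivFin δ).symm i) then (Sum.inr i.succ, Sum.inr i.succ)
    else (Sum.inr 0, Sum.inr 0)
  out i := Sum.inr (Fintype.equivFin δ i).succ

lemma constant_eval [Fintype δ] (k : Bits δ) (x : Bits ι) : (constant ι k).eval x = k := by
  have hval : (constant ι k).IsVal x
      (Fin.cases true fun i => k ((Fintype.equivFin δ).symm i)) := by
    intro i
    refine Fin.cases ?_ (fun i => ?_) i
    · simp [constant, wires]
    · rcases h : k ((Fintype.equivFin δ).symm i) with _ | _ <;> simp [constant, wires, h]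
  rw [eval_eq_of_isVal hval]
  funext i
  simp [constant]

/-- The circuit `c` with the first part `k` of its input hardwired. -/
def hard [Fintype δ] (c : BCirc (δ ⊕ ι) κ s) (k : Bits δ) :
    BCirc ι κ (Fintype.card δ + 1 + s) :=
  let d := (constant ι k).seq
    (⟨fun i => ((c.gate i).map (Sum.map Sum.swap id) (Sum.map Sum.swap id)),
      fun o => Sum.map Sum.swap id (c.out o)⟩ : BCirc (ι ⊕ δ) κ s)
  ⟨d.gate, fun o => d.out (Sum.inr o)⟩

lemma eval_map_in {ι' : Type} (c : BCirc ι κ s) (φ : ι → ι') (x : Bits ι') :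
    (⟨fun i => ((c.gate i).map (Sum.map φ id) (Sum.map φ id)),
      fun o => Sum.map φ id (c.out o)⟩ : BCirc ι' κ s).eval x = c.eval (x ∘ φ) := by
  obtain ⟨v, hv⟩ := c.exists_isVal (x ∘ φ)
  have hw : ∀ i (a : ι ⊕ Fin s), wires x v i (Sum.map φ id a) = wires (x ∘ φ) v i a := by
    rintro i (a | a) <;> simp [wires]
  rw [eval_eq_of_isVal (v := v), eval_eq_of_isVal hv]
  · funext o
    rcases h : c.out o with b | b <;> simp [h]
  · intro i
    rw [hv i]
    simp only [Prod.map_fst, Prod.map_snd, hw]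

lemma hard_eval [Fintype δ] (c : BCirc (δ ⊕ ι) κ s) (k : Bits δ) (x : Bits ι) :
    (c.hard k).eval x = c.eval (Sum.elim k x) := by
  refine (eval_map_out _ Sum.inr x).trans ?_
  rw [seq_eval, Sum.elim_comp_inr, eval_map_in, constant_eval]
  congr 1
  funext a
  rcases a with a | a <;> rfl

/-- Each bit of the description of a circuit with a hardwired string depends on at most one bit of
this string. -/
lemma hard_encode [Fintype δ] [DecidableEq ι] (c : BCirc (δ ⊕ ι) κ s)
    (p : Desc ι κ (Fintype.card δ + 1 + s)) :
    (∃ b, ∀ k, (c.hard k).encode p = b) ∨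
      ∃ (a : δ) (F : Bool → Bool), ∀ k, (c.hard k).encode p = F (k a) := by
  have hg : ∀ i, (∃ g, ∀ k, (c.hard k).gate i = g) ∨
      ∃ (a : δ) (G : Bool → _), ∀ k, (c.hard k).gate i = G (k a) := by
    intro i
    refine Fin.addCases (fun i => ?_) (fun j => ?_) i
    · refine Fin.cases ?_ (fun i => ?_) i
      · left
        exact ⟨_, fun k => by simp only [hard, seq, constant, Fin.addCases_left, Fin.cases_zero]; rfl⟩
      · right
        refine ⟨(Fintype.equivFin δ).symm i, fun b => if b then
          (Sum.inr (Fin.castAdd s i.succ), Sum.inr (Fin.castAdd s i.succ)) else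
          (Sum.inr (Fin.castAdd s 0), Sum.inr (Fin.castAdd s 0)), fun k => ?_⟩
        rcases h : k ((Fintype.equivFin δ).symm i) with _ | _ <;>
          simp [hard, seq, constant, h]
    · left
      exact ⟨_, fun k => by simp only [hard, seq, constant, Fin.addCases_right]; rfl⟩
  obtain ⟨(⟨i, b⟩ | o), w⟩ := p
  · rcases hg i with ⟨g, hg⟩ | ⟨a, G, hG⟩
    · left
      cases b
      · exact ⟨decide (g.1 = w), fun k => by simp only [encode, hg]⟩
      · exact ⟨decide (g.2 = w), fun k => by simp only [encode, hg]⟩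
    · right
      cases b
      · exact ⟨a, fun y => decide ((G y).1 = w), fun k => by simp only [encode, hG]⟩
      · exact ⟨a, fun y => decide ((G y).2 = w), fun k => by simp only [encode, hG]⟩
  · left
    refine ⟨decide ((c.hard fun _ => false).out o = w), fun k => ?_⟩
    rcases h : c.out o with (a | a) | a <;> simp [encode, hard, seq, constant, h]

lemma encode_injective [DecidableEq ι] :
    Function.Injective (encode : BCirc ι κ s → Bits (Desc ι κ s)) := by
  rintro ⟨g, o⟩ ⟨g', o'⟩ h
  have h1 : g = g' := by
    funext i
    have h1 := congrFun h (Sum.inl (i, false), (g i).1)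
    have h2 := congrFun h (Sum.inl (i, true), (g i).2)
    simp only [encode, decide_true] at h1 h2
    exact Prod.ext (of_decide_eq_true h1.symm).symm (of_decide_eq_true h2.symm).symm
  have h2 : o = o' := by
    funext i
    have h1 := congrFun h (Sum.inr i, o i)
    simp only [encode, decide_true] at h1
    exact (of_decide_eq_true h1.symm).symm
  rw [h1, h2]

end BCirc

/-! ### Circuit complexity of functions -/

/-- `f` is computed by a circuit with exactly `s` gates. -/
def Cx {ι κ : Type} (f : Bits ι → Bits κ) (s : ℕ) : Prop :=
  ∃ c : BCirc ι κ s, ∀ x, c.eval x = f x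

namespace Cx

variable {ι ι' κ κ' τ : Type} {s t : ℕ}

lemma seq {f : Bits ι → Bits κ} {g : Bits (ι ⊕ κ) → Bits τ} (hf : Cx f s) (hg : Cx g t) :
    Cx (fun x => Sum.elim (f x) (g (Sum.elim x (f x)))) (s + t) :=
  let ⟨c, hc⟩ := hf
  let ⟨d, hd⟩ := hg
  ⟨c.seq d, fun x => by rw [BCirc.seq_eval, hc, hd]⟩

lemma map_out {f : Bits ι → Bits κ} (hf : Cx f s) (φ : κ' → κ) : Cx (fun x => f x ∘ φ) s :=
  let ⟨c, hc⟩ := hf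
  ⟨⟨c.gate, fun o => c.out (φ o)⟩, fun x => by rw [BCirc.eval_map_out, hc]⟩

lemma map_in {f : Bits ι → Bits κ} (hf : Cx f s) (φ : ι → ι') :
    Cx (fun x : Bits ι' => f (x ∘ φ)) s :=
  let ⟨c, hc⟩ := hf
  ⟨_, fun x => (BCirc.eval_map_in c φ x).trans (hc _)⟩

lemma wires (φ : κ → ι) : Cx (fun x : Bits ι => x ∘ φ) 0 :=
  ⟨⟨Fin.elim0, fun o => Sum.inl (φ o)⟩, fun _ => rfl⟩

lemma comp {f : Bits ι → Bits κ} {g : Bits κ → Bits τ} (hg : Cx g t) (hf : Cx f s) :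
    Cx (fun x => g (f x)) (s + t) :=
  (hf.seq (hg.map_in Sum.inr)).map_out Sum.inr

lemma pair {f : Bits ι → Bits κ} {g : Bits ι → Bits τ} (hf : Cx f s) (hg : Cx g t) :
    Cx (fun x => Sum.elim (f x) (g x)) (s + t) :=
  hf.seq (hg.map_in Sum.inl)

lemma mono {f : Bits ι → Bits κ} (hf : Cx f s) (h : s ≤ t) : Cx f t := by
  obtain ⟨r, rfl⟩ := Nat.exists_eq_add_of_le h
  have hr : Cx (fun _ : Bits (ι ⊕ κ) => (Empty.elim : Bits Empty)) r :=
    ⟨⟨fun i => (Sum.inr i, Sum.inr i), Empty.elim⟩, fun _ => Subsingleton.elim _ _⟩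
  exact (hf.seq hr).map_out Sum.inl

lemma const (k : Bits κ) : Cx (fun _ : Bits ι => k) 3 := by
  refine ((?_ : Cx (fun _ : Bits ι => fun b : Bool => b) 3).map_out k)
  exact ⟨_, BCirc.constant_eval _⟩

lemma nand : Cx (fun (x : Bits Bool) (_ : Unit) => !(x false && x true)) 1 :=
  ⟨⟨fun _ => (Sum.inl false, Sum.inl true), fun _ => Sum.inr 0⟩, fun x => by
    rw [BCirc.eval_eq_of_isVal (v := fun _ => !(x false && x true))]
    · rfl
    · intro i; simp [BCirc.wires]⟩

lemma pi_fin {n : ℕ} {f : Bits ι → Bits (Fin n)}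
    (hf : ∀ i, Cx (fun x (_ : Unit) => f x i) s) : Cx f (n * s) := by
  induction n with
  | zero =>
    rw [Nat.zero_mul]
    exact ⟨⟨Fin.elim0, Fin.elim0⟩, fun _ => Subsingleton.elim _ _⟩
  | succ n ih =>
    have h := (ih (f := fun x i => f x i.castSucc) fun i => hf _).pair (hf (Fin.last n))
    have h' := h.map_out (Fin.lastCases (Sum.inr ()) Sum.inl : Fin (n + 1) → Fin n ⊕ Unit)
    rw [Nat.succ_mul]
    convert h' using 1
    funext x i
    refine Fin.lastCases ?_ (fun i => ?_) i <;> simp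

lemma pi [Fintype κ] {f : Bits ι → Bits κ} (hf : ∀ i, Cx (fun x (_ : Unit) => f x i) s) :
    Cx f (Fintype.card κ * s) := by
  have h := (pi_fin (f := fun x i => f x ((Fintype.equivFin κ).symm i)) fun i => hf _).map_out
    (Fintype.equivFin κ)
  convert h using 1
  funext x i
  simp

lemma not {f : Bits ι → Bool} (hf : Cx (fun x (_ : Unit) => f x) s) :
    Cx (fun x (_ : Unit) => !f x) (s + 1) := by
  have h := (nand.comp (hf.map_out fun _ : Bool => ()))
  simpa using! h

lemma and {f g : Bits ι → Bool} (hf : Cx (fun x (_ : Unit) => f x) s)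
    (hg : Cx (fun x (_ : Unit) => g x) t) : Cx (fun x (_ : Unit) => f x && g x) (s + t + 2) := by
  have h := (nand.comp ((hf.pair hg).map_out
    fun b : Bool => if b then Sum.inr () else Sum.inl ())).not
  simpa using! h

lemma all_fin (n : ℕ) : Cx (fun (x : Bits (Fin n)) (_ : Unit) => decide (∀ i, x i = true))
    (3 + n * 2) := by
  induction n with
  | zero => simpa using! (const fun _ => true : Cx (fun _ : Bits (Fin 0) => fun _ : Unit => true) 3)
  | succ n ih =>
    have h := (ih.map_in Fin.succ).and (wires fun _ : Unit => (0 : Fin (n + 1)))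
    convert h using 1
    · funext x _
      simp [Fin.forall_fin_succ, Bool.and_comm]
    · ring

lemma all [Fintype κ] [DecidablePred fun x : Bits κ => ∀ i, x i = true] :
    Cx (fun (x : Bits κ) (_ : Unit) => decide (∀ i, x i = true)) (3 + Fintype.card κ * 2) := by
  have h := (all_fin (Fintype.card κ)).map_in (Fintype.equivFin κ).symm
  convert h using 1
  funext x _
  exact decide_eq_decide.2 ⟨fun h i => h _, fun h i => by simpa using h (Fintype.equivFin κ i)⟩

end Cx

/-- The functions `f l h` have circuits of size polynomial in `l`, uniformly in the parameter
`h`, which may be hardwired into the circuits. -/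
def PC {H : ℕ → Type*} {ι κ : ℕ → Type} (f : ∀ l, H l → Bits (ι l) → Bits (κ l)) : Prop :=
  ∃ p : ℕ → ℕ, PolyBdd p ∧ ∀ l h, Cx (f l h) (p l)

/-- `PC` for functions with values in `Bool`. -/
def PB {H : ℕ → Type*} {ι : ℕ → Type} (f : ∀ l, H l → Bits (ι l) → Bool) : Prop :=
  PC (κ := fun _ => Unit) fun l h x _ => f l h x

section Closure

variable {H H' : ℕ → Type*} {ι ι' κ κ' τ : ℕ → Type}

namespace PC

lemma reparam {f : ∀ l, H l → Bits (ι l) → Bits (κ l)} (hf : PC f) (φ : ∀ l, H' l → H l) :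
    PC fun l h => f l (φ l h) :=
  let ⟨p, hp, h⟩ := hf
  ⟨p, hp, fun l _ => h l _⟩

lemma comp {f : ∀ l, H l → Bits (ι l) → Bits (κ l)} {g : ∀ l, H l → Bits (κ l) → Bits (τ l)}
    (hg : PC g) (hf : PC f) : PC fun l h x => g l h (f l h x) :=
  let ⟨_, hp, h⟩ := hf
  let ⟨_, hq, h'⟩ := hg
  ⟨_, hp.add hq, fun l a => (h' l a).comp (h l a)⟩

lemma pair {f : ∀ l, H l → Bits (ι l) → Bits (κ l)} {g : ∀ l, H l → Bits (ι l) → Bits (τ l)}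
    (hf : PC f) (hg : PC g) : PC fun l h x => Sum.elim (f l h x) (g l h x) :=
  let ⟨_, hp, h⟩ := hf
  let ⟨_, hq, h'⟩ := hg
  ⟨_, hp.add hq, fun l a => (h l a).pair (h' l a)⟩

lemma wires (φ : ∀ l, H l → κ l → ι l) : PC fun l h (x : Bits (ι l)) => x ∘ φ l h :=
  ⟨_, .const 0, fun _ _ => Cx.wires _⟩

lemma id : PC fun l (_ : H l) (x : Bits (ι l)) => x := wires fun _ _ i => i

lemma const (k : ∀ l, H l → Bits (κ l)) : PC fun l h (_ : Bits (ι l)) => k l h :=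
  ⟨_, .const 3, fun _ _ => Cx.const _⟩

lemma map_out {f : ∀ l, H l → Bits (ι l) → Bits (κ l)} (hf : PC f) (φ : ∀ l, κ' l → κ l) :
    PC fun l h x => f l h x ∘ φ l :=
  let ⟨p, hp, h⟩ := hf
  ⟨p, hp, fun l a => (h l a).map_out _⟩

lemma map_in {f : ∀ l, H l → Bits (ι l) → Bits (κ l)} (hf : PC f) (φ : ∀ l, ι l → ι' l) :
    PC fun l h (x : Bits (ι' l)) => f l h (x ∘ φ l) :=
  let ⟨p, hp, h⟩ := hf
  ⟨p, hp, fun l a => (h l a).map_in _⟩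

/-- A function is easy if its bits are easy, uniformly in the index of the bit. -/
lemma pi [∀ l, Fintype (κ l)] (hκ : PolyBdd fun l => Fintype.card (κ l))
    {f : ∀ l, H l → Bits (ι l) → Bits (κ l)}
    (hf : PB (H := fun l => H l × κ l) fun l h x => f l h.1 x h.2) : PC f :=
  let ⟨_, hp, h⟩ := hf
  ⟨_, hκ.mul hp, fun l a => Cx.pi fun i => h l (a, i)⟩

lemma of_pt [∀ l, Fintype (ι l)] [∀ l, Fintype (κ l)] {A : ∀ l, BAlg (ι l) (κ l)} (hA : PT A) :
    PC fun l (_ : H l) => (A l).eval := by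
  refine ⟨_, hA, fun l _ => Cx.mono (s := (A l).1) ⟨(A l).2, fun x => rfl⟩ ?_⟩
  simp only [BAlg.size]
  omega

/-- An easy function is computed by a polynomial-time algorithm. -/
lemma exists_pt [∀ l, Fintype (ι l)] [∀ l, Fintype (κ l)]
    (hι : PolyBdd fun l => Fintype.card (ι l)) (hκ : PolyBdd fun l => Fintype.card (κ l))
    {f : ∀ l, Unit → Bits (ι l) → Bits (κ l)} (hf : PC f) :
    ∃ A : ∀ l, BAlg (ι l) (κ l), PT A ∧ ∀ l x, (A l).eval x = f l () x := by
  obtain ⟨p, hp, h⟩ := hf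
  choose c hc using fun l => h l ()
  exact ⟨fun l => ⟨p l, c l⟩, (hp.add hι).add hκ, hc⟩

end PC

namespace PB

lemma congr {f g : ∀ l, H l → Bits (ι l) → Bool} (hf : PB f)
    (h : ∀ l a x, f l a x = g l a x) : PB g := by
  have : f = g := by funext l a x; exact h l a x
  exact this ▸ hf

lemma reparam {f : ∀ l, H l → Bits (ι l) → Bool} (hf : PB f) (φ : ∀ l, H' l → H l) :
    PB fun l h => f l (φ l h) :=
  PC.reparam hf φ

lemma comp {f : ∀ l, H l → Bits (ι l) → Bits (κ l)} {g : ∀ l, H l → Bits (κ l) → Bool}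
    (hg : PB g) (hf : PC f) : PB fun l h x => g l h (f l h x) :=
  PC.comp hg hf

lemma apply {f : ∀ l, H l → Bits (ι l) → Bits (κ l)} (hf : PC f) (i : ∀ l, H l → κ l) :
    PB fun l h x => f l h x (i l h) :=
  let ⟨p, hp, h⟩ := hf
  ⟨p, hp, fun l a => (h l a).map_out fun _ : Unit => i l a⟩

lemma var (i : ∀ l, H l → ι l) : PB fun l h (x : Bits (ι l)) => x (i l h) := apply .id i

lemma const (b : ∀ l, H l → Bool) : PB fun l h (_ : Bits (ι l)) => b l h :=
  PC.const fun l h (_ : Unit) => b l h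

lemma not {f : ∀ l, H l → Bits (ι l) → Bool} (hf : PB f) : PB fun l h x => !f l h x :=
  let ⟨_, hp, h⟩ := hf
  ⟨_, hp.add (.const 1), fun l a => (h l a).not⟩

variable {f g : ∀ l, H l → Bits (ι l) → Bool}

lemma and (hf : PB f) (hg : PB g) : PB fun l h x => f l h x && g l h x :=
  let ⟨_, hp, h⟩ := hf
  let ⟨_, hq, h'⟩ := hg
  ⟨_, (hp.add hq).add (.const 2), fun l a => (h l a).and (h' l a)⟩

lemma or (hf : PB f) (hg : PB g) : PB fun l h x => f l h x || g l h x :=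
  (hf.not.and hg.not).not.congr fun l a x => by simp

lemma xor (hf : PB f) (hg : PB g) : PB fun l h x => Bool.xor (f l h x) (g l h x) :=
  ((hf.and hg.not).or (hf.not.and hg)).congr fun l a x => by
    cases f l a x <;> cases g l a x <;> rfl

lemma beq (hf : PB f) (hg : PB g) : PB fun l h x => f l h x == g l h x :=
  (hf.xor hg).not.congr fun l a x => by cases f l a x <;> cases g l a x <;> rfl

lemma cond {c : ∀ l, H l → Bits (ι l) → Bool} (hc : PB c) (hf : PB f) (hg : PB g) :
    PB fun l h x => bif c l h x then f l h x else g l h x :=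
  ((hc.and hf).or (hc.not.and hg)).congr fun l a x => by cases c l a x <;> simp

lemma all [∀ l, Fintype (κ l)] (hκ : PolyBdd fun l => Fintype.card (κ l))
    {f : ∀ l, H l → κ l → Bits (ι l) → Bool}
    (hf : PB (H := fun l => H l × κ l) fun l h x => f l h.1 h.2 x)
    [∀ l h x, Decidable (∀ i, f l h i x = true)] :
    PB fun l h x => decide (∀ i, f l h i x = true) := by
  classical
  have h1 : PC fun l h x i => f l h i x := PC.pi hκ hf
  have h2 : PB fun l (_ : H l) (x : Bits (κ l)) => decide (∀ i, x i = true) :=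
    ⟨_, (PolyBdd.const 3).add (hκ.mul (.const 2)), fun l _ => Cx.all⟩
  exact (h2.comp h1).congr fun l a x => decide_eq_decide.2 Iff.rfl

lemma any [∀ l, Fintype (κ l)] (hκ : PolyBdd fun l => Fintype.card (κ l))
    {f : ∀ l, H l → κ l → Bits (ι l) → Bool}
    (hf : PB (H := fun l => H l × κ l) fun l h x => f l h.1 h.2 x)
    [∀ l h x, Decidable (∃ i, f l h i x = true)] :
    PB fun l h x => decide (∃ i, f l h i x = true) := by
  classical
  refine (all hκ (f := fun l h i x => !f l h i x) hf.not).not.congr fun l a x => ?_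
  rw [Bool.eq_iff_iff]
  simp

end PB

end Closure

/-! ### Descriptions of circuits -/

/-- The position in a description that tells whether the wire `q` is connected to the wire `w`. -/
def Desc.mk {ι κ : Type} {s : ℕ} (q : (Fin s × Bool) ⊕ κ) (w : ι ⊕ Fin s) : Desc ι κ s := (q, w)

lemma card_desc (ι κ : Type) (s : ℕ) [Fintype ι] [Fintype κ] :
    Fintype.card (Desc ι κ s) = (s * 2 + Fintype.card κ) * (Fintype.card ι + s) := by
  have h : Fintype.card (Desc ι κ s) = Fintype.card (((Fin s × Bool) ⊕ κ) × (ι ⊕ Fin s)) := rfl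
  rw [h]
  simp

lemma polyBdd_card_desc {ι κ : ℕ → Type} [∀ l, Fintype (ι l)] [∀ l, Fintype (κ l)] {s : ℕ → ℕ}
    (hι : PolyBdd fun l => Fintype.card (ι l)) (hκ : PolyBdd fun l => Fintype.card (κ l))
    (hs : PolyBdd s) : PolyBdd fun l => Fintype.card (Desc (ι l) (κ l) (s l)) := by
  simp only [card_desc]
  exact ((hs.mul (.const 2)).add hκ).mul (hι.add hs)

lemma PC.hard_encode {H ι κ δ : ℕ → Type} [∀ l, Fintype (ι l)] [∀ l, Fintype (κ l)]
    [∀ l, Fintype (δ l)] [∀ l, DecidableEq (ι l)] {s : ℕ → ℕ}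
    (hι : PolyBdd fun l => Fintype.card (ι l)) (hκ : PolyBdd fun l => Fintype.card (κ l))
    (hδ : PolyBdd fun l => Fintype.card (δ l)) (hs : PolyBdd s)
    (c : ∀ l, BCirc (δ l ⊕ ι l) (κ l) (s l)) :
    PC fun l (_ : H l) (k : Bits (δ l)) => ((c l).hard k).encode := by
  refine PC.pi (polyBdd_card_desc hι hκ ((hδ.add (.const 1)).add hs)) ⟨_, .const 3, fun l h => ?_⟩
  rcases (c l).hard_encode h.2 with ⟨b, hb⟩ | ⟨a, F, hF⟩
  · simp only [hb]
    exact Cx.const _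
  · simp only [hF]
    have h0 : Cx (fun (k : Bits (δ l)) (_ : Unit) => k a) 0 := Cx.wires fun _ => a
    have hF : F = (fun _ => true) ∨ F = (fun _ => false) ∨ F = (fun b => b) ∨
        F = (fun b => !b) := by
      clear hF; revert F; decide
    rcases hF with rfl | rfl | rfl | rfl
    · exact Cx.const _
    · exact Cx.const _
    · exact h0.mono (by omega)
    · exact h0.not.mono (by omega)

/-- The state after `t` gates of the circuit with description `d`, as a function of `d`. -/
def univState {ι κ : Type} {s : ℕ} [Fintype ι] (d : Bits (Desc ι κ s)) (x : Bits ι) :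
    ℕ → Fin s → Bool
  | 0 => fun _ => false
  | t + 1 => fun i =>
      bif decide ((i : ℕ) = t) then
        !(decide (∃ w : ι ⊕ Fin s, (d (Desc.mk (Sum.inl (i, false)) w) &&
            Sum.elim x (univState d x t) w) = true) &&
          decide (∃ w : ι ⊕ Fin s, (d (Desc.mk (Sum.inl (i, true)) w) &&
            Sum.elim x (univState d x t) w) = true))
      else univState d x t i

/-- Evaluation of a circuit given by its description. -/
def univEval {ι κ : Type} {s : ℕ} [Fintype ι] (z : Bits (Desc ι κ s ⊕ ι)) : Bits κ :=
  fun o => decide (∃ w : ι ⊕ Fin s, (z (Sum.inl (Desc.mk (Sum.inr o) w)) &&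
    Sum.elim (z ∘ Sum.inr) (univState (z ∘ Sum.inl) (z ∘ Sum.inr) s) w) = true)

section

variable {ι κ : Type} {s : ℕ} [Fintype ι] [DecidableEq ι]

lemma exists_select {w₀ : ι ⊕ Fin s} {W : ι ⊕ Fin s → Bool} :
    decide (∃ w, (decide (w₀ = w) && W w) = true) = W w₀ := by
  rw [Bool.eq_iff_iff]
  simp

lemma encode_gate (c : BCirc ι κ s) (i : Fin s) (b : Bool) (w : ι ⊕ Fin s) :
    c.encode (Desc.mk (Sum.inl (i, b)) w) =
      decide ((if b then (c.gate i).2 else (c.gate i).1) = w) := by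
  cases b <;> rfl

lemma encode_out (c : BCirc ι κ s) (o : κ) (w : ι ⊕ Fin s) :
    c.encode (Desc.mk (Sum.inr o) w) = decide (c.out o = w) := rfl

lemma univState_encode (c : BCirc ι κ s) (x : Bits ι) (t : ℕ) :
    univState c.encode x t = c.state x t := by
  induction t with
  | zero => rfl
  | succ t ih =>
    funext i
    rw [BCirc.state_succ, ← ih]
    simp only [univState, encode_gate, exists_select]
    by_cases h : (i : ℕ) = t <;> simp [h]

lemma univEval_encode (c : BCirc ι κ s) (x : Bits ι) :
    univEval (Sum.elim c.encode x) = c.eval x := by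
  funext o
  simp only [univEval, Sum.elim_comp_inl, Sum.elim_comp_inr, univState_encode, Sum.elim_inl, encode_out,
    exists_select]
  rfl

end

section

variable {H ι κ : ℕ → Type} [∀ l, Fintype (ι l)] [∀ l, Fintype (κ l)] {s : ℕ → ℕ}

lemma card_wires (hι : PolyBdd fun l => Fintype.card (ι l)) (hs : PolyBdd s) :
    PolyBdd fun l => Fintype.card (ι l ⊕ Fin (s l)) := by
  simpa using hι.add hs

lemma PC.univState (hι : PolyBdd fun l => Fintype.card (ι l)) (hs : PolyBdd s) :
    PC fun l (_ : H l) (z : Bits (Desc (ι l) (κ l) (s l) ⊕ ι l)) =>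
      univState (z ∘ Sum.inl) (z ∘ Sum.inr) (s l) := by
  -- evaluation of the gate `t`
  have hstep : PC fun l (t : ℕ) (z : Bits ((Desc (ι l) (κ l) (s l) ⊕ ι l) ⊕ Fin (s l)))
      (i : Fin (s l)) => bif decide ((i : ℕ) = t) then
        !(decide (∃ w : ι l ⊕ Fin (s l), (z (Sum.inl (Sum.inl (Desc.mk (Sum.inl (i, false)) w))) &&
            Sum.elim (fun a => z (Sum.inl (Sum.inr a))) (fun a => z (Sum.inr a)) w) = true) &&
          decide (∃ w : ι l ⊕ Fin (s l), (z (Sum.inl (Sum.inl (Desc.mk (Sum.inl (i, true)) w))) &&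
            Sum.elim (fun a => z (Sum.inl (Sum.inr a))) (fun a => z (Sum.inr a)) w) = true))
      else z (Sum.inr i) := by
    refine PC.pi (by simpa using hs) ?_
    have hW : PB (H := fun l => (ℕ × Fin (s l)) × (ι l ⊕ Fin (s l)))
        (ι := fun l => (Desc (ι l) (κ l) (s l) ⊕ ι l) ⊕ Fin (s l)) fun l h z =>
        Sum.elim (fun a => z (Sum.inl (Sum.inr a))) (fun a => z (Sum.inr a)) h.2 :=
      (PB.var fun l h => Sum.map Sum.inr (fun a => a) h.2).congr fun l h z => by
        rcases h with ⟨_, a | a⟩ <;> rfl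
    refine PB.cond (PB.const _) (PB.not (PB.and (PB.any (card_wires hι hs) (PB.and ?_ hW))
      (PB.any (card_wires hι hs) (PB.and ?_ hW)))) (PB.var _)
    · exact PB.var _
    · exact PB.var _
  obtain ⟨p, hp, h⟩ := hstep
  have hit : ∀ l t, Cx (fun z : Bits (Desc (ι l) (κ l) (s l) ⊕ ι l) =>
      UnclonableCrypto.univState (z ∘ Sum.inl) (z ∘ Sum.inr) t) (3 + t * p l) := by
    intro l t
    induction t with
    | zero => exact (Cx.const fun _ => false).mono (by omega)
    | succ t ih =>
      refine (((h l t).comp ((Cx.wires fun i => i).pair ih)).mono ?_)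
      rw [Nat.succ_mul]
      omega
  exact ⟨_, (PolyBdd.const 3).add (hs.mul hp), fun l _ => hit l _⟩

lemma PC.univEval (hι : PolyBdd fun l => Fintype.card (ι l))
    (hκ : PolyBdd fun l => Fintype.card (κ l)) (hs : PolyBdd s) :
    PC fun l (_ : H l) => univEval (ι := ι l) (κ := κ l) (s := s l) := by
  refine PC.pi hκ (PB.any (card_wires hι hs) (PB.and (PB.var _) ?_))
  have h := PC.pair (PC.wires (H := fun l => (H l × κ l) × (ι l ⊕ Fin (s l)))
    (ι := fun l => Desc (ι l) (κ l) (s l) ⊕ ι l) fun l _ a => Sum.inr a)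
    (PC.univState hι hs)
  exact PB.apply h fun l h => h.2

end

/-! ### Composition of quantum circuits -/

section Embedding

variable {ι κ τ M N P : Type} [Fintype M] [DecidableEq M] [Fintype N] [DecidableEq N]
  [Fintype P] [DecidableEq P]

/-- `w` and `w'` agree on all the qubits that are not in the range of `f`. -/
def AgreeOff (f : M → N) (w w' : Bits N) : Prop := ∀ i, (∀ o, f o ≠ i) → w i = w' i

instance (f : M → N) (w w' : Bits N) : Decidable (AgreeOff f w w') :=
  inferInstanceAs (Decidable (∀ i, (∀ o, f o ≠ i) → w i = w' i))

/-- The operator `U` acting on the qubits in the range of `f`. -/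
def emb (f : M → N) (U : Op M) : Op N :=
  Matrix.of fun w w' => if AgreeOff f w w' then U (w ∘ f) (w' ∘ f) else 0

lemma emb_apply (f : M → N) (U : Op M) (w w' : Bits N) :
    emb f U w w' = if AgreeOff f w w' then U (w ∘ f) (w' ∘ f) else 0 := rfl

lemma restrict_apply (f : M → N) (X : Op N) (y y' : Bits M) :
    restrict f X y y' = ∑ w : Bits N, ∑ w' : Bits N,
      if w ∘ f = y ∧ w' ∘ f = y' ∧ AgreeOff f w w' then X w w' else 0 := by
  simp only [restrict, Matrix.of_apply]
  congr! 2

/-- `restrict f` and `emb f` are adjoint to each other. -/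
lemma trace_restrict_mul (f : M → N) (X : Op N) (Y : Op M) :
    (restrict f X * Y).trace = (X * emb f Y).trace := by
  simp only [Matrix.trace, Matrix.diag_apply, Matrix.mul_apply, restrict_apply, emb_apply,
    Finset.sum_mul]
  rw [Finset.sum_congr rfl fun y _ => Finset.sum_comm, Finset.sum_comm]
  refine Finset.sum_congr rfl fun w _ => ?_
  rw [Finset.sum_congr rfl fun y _ => Finset.sum_comm, Finset.sum_comm]
  refine Finset.sum_congr rfl fun w' _ => ?_
  have h : AgreeOff f w' w ↔ AgreeOff f w w' :=
    ⟨fun h i hi => (h i hi).symm, fun h i hi => (h i hi).symm⟩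
  by_cases ha : AgreeOff f w w'
  · simp [ha, h, ite_and, ite_mul, Finset.sum_ite_eq]
  · simp [ha, h]

lemma ext_trace {X Y : Op M} (h : ∀ Z : Op M, (X * Z).trace = (Y * Z).trace) : X = Y := by
  ext i j
  have := h (Matrix.single j i 1)
  simpa [Matrix.trace_mul_comm X, Matrix.trace_mul_comm Y, Matrix.trace_single_mul] using this

lemma agreeOff_comp {f : M → N} {g : P → M} (hf : f.Injective) (w w' : Bits N) :
    AgreeOff (f ∘ g) w w' ↔ AgreeOff f w w' ∧ AgreeOff g (w ∘ f) (w' ∘ f) := by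
  constructor
  · intro h
    exact ⟨fun i hi => h i fun o => hi _, fun i hi => h _ fun o ho => hi o (hf ho)⟩
  · rintro ⟨h1, h2⟩ i hi
    by_cases hr : ∃ m, f m = i
    · obtain ⟨m, rfl⟩ := hr
      exact h2 m fun o ho => hi o (congrArg f ho)
    · exact h1 i fun o ho => hr ⟨o, ho⟩

lemma emb_comp {f : M → N} {g : P → M} (hf : f.Injective) (U : Op P) :
    emb (f ∘ g) U = emb f (emb g U) := by
  ext w w'
  simp only [emb_apply, agreeOff_comp hf, ite_and]
  rfl

lemma restrict_comp {f : M → N} {g : P → M} (hf : f.Injective) (X : Op N) :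
    restrict (f ∘ g) X = restrict g (restrict f X) :=
  ext_trace fun Z => by rw [trace_restrict_mul, trace_restrict_mul, trace_restrict_mul, emb_comp hf]

lemma emb_conjTranspose (f : M → N) (U : Op M) : emb f U.conjTranspose = (emb f U).conjTranspose := by
  ext w w'
  have h : AgreeOff f w' w ↔ AgreeOff f w w' :=
    ⟨fun h i hi => (h i hi).symm, fun h i hi => (h i hi).symm⟩
  simp only [emb_apply, Matrix.conjTranspose_apply, h]
  split_ifs <;> simp

lemma emb_mul {f : M → N} (hf : f.Injective) (U V : Op M) : emb f (U * V) = emb f U * emb f V := by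
  ext w w''
  simp only [emb_apply, Matrix.mul_apply, ite_mul, mul_ite, zero_mul, mul_zero]
  have hext : ∀ y : Bits M, Function.extend f y w ∘ f = y := fun y => by
    funext o; exact hf.extend_apply _ _ _
  have hoff : ∀ y : Bits M, AgreeOff f w (Function.extend f y w) := fun y i hi => by
    rw [Function.extend_apply' _ _ _ (by rintro ⟨o, ho⟩; exact hi o ho)]
  symm
  -- only the strings that agree with `w` outside the range of `f` contribute
  calc _ = ∑ x, if AgreeOff f w x then
          if AgreeOff f x w'' then U (w ∘ f) (x ∘ f) * V (x ∘ f) (w'' ∘ f) else 0 else 0 :=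
        Finset.sum_congr rfl fun x _ => by split_ifs <;> rfl
    _ = ∑ x ∈ Finset.univ.filter fun x => AgreeOff f w x, _ := (Finset.sum_filter _ _).symm
    _ = ∑ y : Bits M, if AgreeOff f w w'' then U (w ∘ f) y * V y (w'' ∘ f) else 0 := by
      refine Finset.sum_bij' (fun x _ => x ∘ f) (fun y _ => Function.extend f y w) ?_ ?_ ?_ ?_ ?_
      · simp
      · intro y _; simpa using hoff y
      · intro x hx
        have hx : AgreeOff f w x := by simpa using hx
        funext i
        by_cases hr : ∃ m, f m = i
        · obtain ⟨m, rfl⟩ := hr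
          exact hf.extend_apply _ _ _
        · rw [Function.extend_apply' _ _ _ hr]
          exact hx i fun o ho => hr ⟨o, ho⟩
      · intro y _; exact hext y
      · intro x hx
        have hx : AgreeOff f w x := by simpa using hx
        have : AgreeOff f x w'' ↔ AgreeOff f w w'' :=
          forall₂_congr fun i hi => by rw [hx i hi]
        simp only [this]
    _ = _ := by split_ifs <;> simp

lemma restrict_conj {f : M → N} (hf : f.Injective) (U : Op M) (X : Op N) :
    restrict f (emb f U * X * (emb f U).conjTranspose) = U * restrict f X * U.conjTranspose := by
  refine ext_trace fun Z => ?_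
  rw [trace_restrict_mul, ← emb_conjTranspose, Matrix.mul_assoc, ← emb_mul hf, Matrix.mul_assoc,
    Matrix.trace_mul_comm, Matrix.mul_assoc, ← emb_mul hf, ← trace_restrict_mul,
    Matrix.mul_assoc (U * _), Matrix.mul_assoc U, Matrix.trace_mul_comm U]
  simp only [Matrix.mul_assoc]

lemma restrict_equiv (e : M ≃ N) (X : Op N) (y y' : Bits M) :
    restrict e X y y' = X (y ∘ e.symm) (y' ∘ e.symm) := by
  have hoff : ∀ w w' : Bits N, AgreeOff e w w' := fun w w' i hi =>
    absurd (e.apply_symm_apply i) (hi _)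
  have hiff : ∀ (w : Bits N) (y : Bits M), w ∘ e = y ↔ w = y ∘ e.symm := fun w y =>
    ⟨by rintro rfl; funext i; simp, by rintro rfl; funext i; simp⟩
  simp [restrict_apply, hoff, hiff, ite_and]

end Embedding

section OnLeft

variable {ι κ τ ν : Type}

lemma onLeft_apply (Φ : Op ι → Op κ) (ρ : Op (ι ⊕ τ)) (w w' : Bits (κ ⊕ τ)) :
    onLeft Φ ρ w w' =
      Φ (Matrix.of fun x x' => ρ (Sum.elim x (w ∘ Sum.inr)) (Sum.elim x' (w' ∘ Sum.inr)))
      (w ∘ Sum.inl) (w' ∘ Sum.inl) := rfl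

lemma onLeft_onLeft (Ψ : Op κ → Op ν) (Φ : Op ι → Op κ) (ρ : Op (ι ⊕ τ)) :
    onLeft Ψ (onLeft Φ ρ) = onLeft (fun ρ => Ψ (Φ ρ)) ρ := by
  ext w w'
  simp only [onLeft_apply, Sum.elim_comp_inr, Sum.elim_comp_inl]
  rfl

lemma onLeft_id (ρ : Op (ι ⊕ τ)) : onLeft (fun ρ => ρ) ρ = ρ := by
  ext w w'
  simp [onLeft_apply]

lemma onLeft_tensor {Φ : Op ι → Op κ} (hΦ : ∀ (c : ℂ) ρ, Φ (c • ρ) = c • Φ ρ) (ρ : Op ι)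
    (σ : Op τ) : onLeft Φ (tensor ρ σ) = tensor (Φ ρ) σ := by
  ext w w'
  have h : (Matrix.of fun x x' => tensor ρ σ (Sum.elim x (w ∘ Sum.inr))
      (Sum.elim x' (w' ∘ Sum.inr))) = σ (w ∘ Sum.inr) (w' ∘ Sum.inr) • ρ := by
    ext x x'
    simp [tensor, mul_comm]
  rw [onLeft_apply, h, hΦ]
  simp [tensor, mul_comm]

variable [Fintype ι] [DecidableEq ι] [Fintype κ] [DecidableEq κ] [Fintype τ] [DecidableEq τ]

lemma sum_bits_sum {A : Type*} [AddCommMonoid A] (f : Bits (ι ⊕ κ) → A) :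
    ∑ w, f w = ∑ x : Bits ι, ∑ y : Bits κ, f (Sum.elim x y) := by
  rw [← Finset.sum_product', Finset.univ_product_univ]
  exact Fintype.sum_equiv (Equiv.sumArrowEquivProdArrow ι κ Bool) _ _ fun w => by
    simp [Equiv.sumArrowEquivProdArrow]

lemma agreeOff_inl (w w' : Bits (ι ⊕ τ)) :
    AgreeOff Sum.inl w w' ↔ w ∘ Sum.inr = w' ∘ Sum.inr := by
  constructor
  · intro h
    funext i
    exact h _ fun o => by simp
  · rintro h (i | i) hi
    · exact absurd rfl (hi i)
    · exact congrFun h i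

lemma emb_inl_apply (U : Op ι) (w w' : Bits (ι ⊕ τ)) :
    emb Sum.inl U w w' =
      if w ∘ Sum.inr = w' ∘ Sum.inr then U (w ∘ Sum.inl) (w' ∘ Sum.inl) else 0 := by
  rw [emb_apply]
  exact if_congr (agreeOff_inl w w') rfl rfl

lemma emb_inl_conj (U : Op ι) (ρ : Op (ι ⊕ τ)) :
    emb Sum.inl U * ρ * (emb Sum.inl U).conjTranspose =
      onLeft (fun ρ => U * ρ * U.conjTranspose) ρ := by
  ext w w'
  simp only [onLeft_apply, Matrix.mul_apply, emb_inl_apply, sum_bits_sum,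
    Matrix.conjTranspose_apply, Matrix.of_apply]
  have h : ∀ (x : Bits ι) (y : Bits τ), (Sum.elim x y : Bits (ι ⊕ τ)) ∘ Sum.inr = y := fun _ _ => rfl
  have h' : ∀ (x : Bits ι) (y : Bits τ), (Sum.elim x y : Bits (ι ⊕ τ)) ∘ Sum.inl = x := fun _ _ => rfl
  simp only [h, h']
  simp only [ite_mul, zero_mul, Finset.sum_ite_eq, Finset.mem_univ, if_true, RCLike.star_def,
    apply_ite (starRingEnd ℂ), map_zero, mul_ite, mul_zero]

lemma restrict_map_id (f : κ → ι) (X : Op (ι ⊕ τ)) :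
    restrict (Sum.map f id) X = onLeft (restrict f) X := by
  ext y y'
  rw [restrict_apply, onLeft_apply, restrict_apply, sum_bits_sum]
  simp only [sum_bits_sum (ι := ι) (κ := τ)]
  have h1 : ∀ (x : Bits ι) (z : Bits τ) (y : Bits (κ ⊕ τ)),
      Sum.elim x z ∘ Sum.map f id = y ↔ z = y ∘ Sum.inr ∧ x ∘ f = y ∘ Sum.inl := by
    intro x z y
    rw [Sum.elim_comp_map, ← Sum.elim_comp_inl_inr y, Sum.elim_eq_iff, and_comm]
    simp
  have h2 : ∀ (x x' : Bits ι) (z z' : Bits τ),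
      AgreeOff (Sum.map f id) (Sum.elim x z) (Sum.elim x' z') ↔ AgreeOff f x x' := by
    intro x x' z z'
    constructor
    · intro h i hi
      exact h (Sum.inl i) (by rintro (o | o) <;> simp [hi])
    · rintro h (i | i) hi
      · exact h i fun o ho => hi (Sum.inl o) (by simp [ho])
      · exact absurd rfl (hi (Sum.inr i))
  simp only [h1, h2, Matrix.of_apply]
  refine Finset.sum_congr rfl fun x _ => ?_
  rw [Finset.sum_comm]
  refine Finset.sum_congr rfl fun x' _ => ?_
  by_cases ha : AgreeOff f x x'
  · simp [ha, ite_and, and_assoc]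
  · simp [ha]

end OnLeft

section

variable {ι κ τ M N : Type} [Fintype M] [DecidableEq M] [Fintype N] [DecidableEq N]
  [Fintype ι] [DecidableEq ι] [Fintype κ] [DecidableEq κ] [Fintype τ] [DecidableEq τ]

/-- The gate `g` on renamed qubits. -/
def QGate.map {M N : Type} (f : M ↪ N) : QGate M → QGate N
  | .H i => .H (f i)
  | .T i => .T (f i)
  | .CNOT c t h => .CNOT (f c) (f t) fun e => h (f.injective e)

lemma eq_iff_agreeOff (f : M ↪ N) (w w' : Bits N) :
    w = w' ↔ AgreeOff f w w' ∧ w ∘ f = w' ∘ f := by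
  constructor
  · rintro rfl
    exact ⟨fun _ _ => rfl, rfl⟩
  · rintro ⟨h1, h2⟩
    funext i
    by_cases hr : ∃ m, f m = i
    · obtain ⟨m, rfl⟩ := hr
      exact congrFun h2 m
    · exact h1 i fun o ho => hr ⟨o, ho⟩

lemma QGate.unitary_map (f : M ↪ N) (g : QGate M) : (g.map f).unitary = emb f g.unitary := by
  ext w w'
  rw [emb_apply]
  cases g with
  | H i =>
    have h : (∀ j, j ≠ f i → w j = w' j) ↔
        AgreeOff f w w' ∧ ∀ j, j ≠ i → (w ∘ f) j = (w' ∘ f) j := by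
      constructor
      · exact fun h => ⟨fun j hj => h j (hj i).symm, fun j hj => h _ (f.injective.ne hj)⟩
      · rintro ⟨h1, h2⟩ j hj
        by_cases hr : ∃ m, f m = j
        · obtain ⟨m, rfl⟩ := hr
          exact h2 m fun e => hj (by rw [e])
        · exact h1 j fun o ho => hr ⟨o, ho⟩
    simp only [map, unitary, Matrix.of_apply, h, ite_and]
    rfl
  | T i =>
    simp only [map, unitary, Matrix.diagonal_apply, eq_iff_agreeOff f w w', ite_and]
    rfl
  | CNOT c t hct =>
    have h : w = Function.update w' (f t) (xor (w' (f t)) (w' (f c))) ↔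
        AgreeOff f w w' ∧
          w ∘ f = Function.update (w' ∘ f) t (xor ((w' ∘ f) t) ((w' ∘ f) c)) := by
      rw [eq_iff_agreeOff f, Function.update_comp_eq_of_injective _ f.injective]
      refine and_congr (forall₂_congr fun i hi => ?_) Iff.rfl
      rw [Function.update_of_ne (hi t).symm]
    simp only [map, unitary, Matrix.of_apply, h, ite_and]

/-- The effect of a list of gates on a state. -/
def evolve (gs : List (QGate N)) (X : Op N) : Op N :=
  gs.foldl (fun M g => g.unitary * M * g.unitary.conjTranspose) X

lemma QCirc.run_eq (A : QCirc ι κ) (ρ : Op ι) :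
    A.run ρ = restrict A.out (evolve A.gates (tensor ρ (basis fun _ => false))) := rfl

lemma evolve_cons (g : QGate N) (gs : List (QGate N)) (X : Op N) :
    evolve (g :: gs) X = evolve gs (g.unitary * X * g.unitary.conjTranspose) := rfl

lemma evolve_append (gs gs' : List (QGate N)) (X : Op N) :
    evolve (gs ++ gs') X = evolve gs' (evolve gs X) := List.foldl_append ..

lemma evolve_smul (gs : List (QGate N)) (c : ℂ) (X : Op N) :
    evolve gs (c • X) = c • evolve gs X := by
  induction gs generalizing X with
  | nil => rfl
  | cons g gs ih => rw [evolve_cons, evolve_cons, ← ih]; simp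

lemma evolve_add (gs : List (QGate N)) (X Y : Op N) :
    evolve gs (X + Y) = evolve gs X + evolve gs Y := by
  induction gs generalizing X Y with
  | nil => rfl
  | cons g gs ih =>
    rw [evolve_cons, evolve_cons, evolve_cons, ← ih, Matrix.mul_add, Matrix.add_mul]

lemma restrict_evolve (f : M ↪ N) (gs : List (QGate M)) (X : Op N) :
    restrict f (evolve (gs.map (QGate.map f)) X) = evolve gs (restrict f X) := by
  induction gs generalizing X with
  | nil => rfl
  | cons g gs ih =>
    rw [List.map_cons, evolve_cons, evolve_cons, ih, QGate.unitary_map,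
      restrict_conj f.injective]

lemma evolve_inl (gs : List (QGate ι)) (X : Op (ι ⊕ τ)) :
    evolve (gs.map (QGate.map Function.Embedding.inl)) X = onLeft (evolve gs) X := by
  induction gs generalizing X with
  | nil => exact (onLeft_id X).symm
  | cons g gs ih =>
    rw [List.map_cons, evolve_cons, ih, QGate.unitary_map]
    refine (congrArg _ (emb_inl_conj g.unitary X)).trans ?_
    rw [onLeft_onLeft]
    rfl

lemma restrict_smul (f : M → N) (c : ℂ) (X : Op N) : restrict f (c • X) = c • restrict f X := by
  ext y y'
  simp [restrict_apply, Finset.mul_sum]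

lemma restrict_add (f : M → N) (X Y : Op N) : restrict f (X + Y) = restrict f X + restrict f Y := by
  ext y y'
  simp only [restrict_apply, Matrix.add_apply, ← Finset.sum_add_distrib]
  refine Finset.sum_congr rfl fun w _ => Finset.sum_congr rfl fun w' _ => ?_
  split_ifs <;> simp

lemma tensor_smul_left (c : ℂ) (ρ : Op ι) (σ : Op κ) : tensor (c • ρ) σ = c • tensor ρ σ := by
  ext; simp [tensor, mul_assoc]

lemma tensor_add_left (ρ ρ' : Op ι) (σ : Op κ) :
    tensor (ρ + ρ') σ = tensor ρ σ + tensor ρ' σ := by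
  ext; simp [tensor, add_mul]

lemma QCirc.run_smul (A : QCirc ι κ) (c : ℂ) (ρ : Op ι) : A.run (c • ρ) = c • A.run ρ := by
  rw [run_eq, run_eq, tensor_smul_left, evolve_smul, restrict_smul]

lemma QCirc.run_add (A : QCirc ι κ) (ρ σ : Op ι) : A.run (ρ + σ) = A.run ρ + A.run σ := by
  rw [run_eq, run_eq, run_eq, tensor_add_left, evolve_add, restrict_add]

/-- The channel of a circuit as a linear map. -/
def QCirc.lin (A : QCirc ι κ) : Op ι →ₗ[ℂ] Op κ where
  toFun := A.run
  map_add' := A.run_add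
  map_smul' := A.run_smul

lemma QCirc.run_sum (A : QCirc ι κ) {α : Type*} (s : Finset α) (f : α → Op ι) :
    A.run (∑ a ∈ s, f a) = ∑ a ∈ s, A.run (f a) := map_sum A.lin f s

lemma restrict_embedding_equiv (e : M ≃ N) (gs : List (QGate κ)) (f : κ ↪ M) (X : Op N) :
    restrict e (evolve (gs.map (QGate.map (f.trans e.toEmbedding))) X) =
      evolve (gs.map (QGate.map f)) (restrict e X) := by
  have : gs.map (QGate.map (f.trans e.toEmbedding)) =
      (gs.map (QGate.map f)).map (QGate.map e.toEmbedding) := by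
    rw [List.map_map]
    refine List.map_congr_left fun g _ => ?_
    cases g <;> rfl
  rw [this]
  exact restrict_evolve e.toEmbedding _ _

/-- The circuit `A` on the left part of a register. -/
def QCirc.left (A : QCirc ι κ) (τ : Type) : QCirc (ι ⊕ τ) (κ ⊕ τ) :=
  let e : (ι ⊕ Fin A.anc) ⊕ τ ≃ (ι ⊕ τ) ⊕ Fin A.anc := 
    (Equiv.sumAssoc _ _ _).trans (((Equiv.refl _).sumCongr (Equiv.sumComm _ _)).trans
      (Equiv.sumAssoc _ _ _).symm)
  { anc := A.anc
    gates := A.gates.map (QGate.map (Function.Embedding.inl.trans e.toEmbedding))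
    out := (A.out.sumMap (Function.Embedding.refl τ)).trans e.toEmbedding }

lemma QCirc.left_run (A : QCirc ι κ) (ρ : Op (ι ⊕ τ)) : (A.left τ).run ρ = onLeft A.run ρ := by
  let e : (ι ⊕ Fin A.anc) ⊕ τ ≃ (ι ⊕ τ) ⊕ Fin A.anc :=
    (Equiv.sumAssoc _ _ _).trans (((Equiv.refl _).sumCongr (Equiv.sumComm _ _)).trans
      (Equiv.sumAssoc _ _ _).symm)
  have h0 : restrict e (tensor ρ (basis fun _ : Fin A.anc => false)) =
      onLeft (fun σ => tensor σ (basis fun _ : Fin A.anc => false)) ρ := by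
    ext y y'
    rw [restrict_equiv, onLeft_apply]
    have h : ∀ y : Bits ((ι ⊕ Fin A.anc) ⊕ τ), (y ∘ e.symm) ∘ Sum.inl =
        Sum.elim ((y ∘ Sum.inl) ∘ Sum.inl) (y ∘ Sum.inr) := fun y => by
      funext i; rcases i with i | i <;> rfl
    simp only [tensor, Matrix.of_apply, h]
    rfl
  have h1 : (A.left τ).run ρ = restrict (e ∘ Sum.map A.out id)
      (evolve (A.gates.map (QGate.map (Function.Embedding.inl.trans e.toEmbedding)))
        (tensor ρ (basis fun _ : Fin A.anc => false))) := rfl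
  rw [h1, restrict_comp e.injective, restrict_embedding_equiv, evolve_inl, h0, restrict_map_id,
    onLeft_onLeft, onLeft_onLeft]
  rfl

/-- First `A`, then `B`. -/
def QCirc.comp (B : QCirc κ τ) (A : QCirc ι κ) : QCirc ι τ :=
  let e : (ι ⊕ Fin A.anc) ⊕ Fin B.anc ≃ ι ⊕ Fin (A.anc + B.anc) :=
    (Equiv.sumAssoc _ _ _).trans ((Equiv.refl _).sumCongr finSumFinEquiv)
  let ψ : κ ⊕ Fin B.anc ↪ ι ⊕ Fin (A.anc + B.anc) :=
    (A.out.sumMap (Function.Embedding.refl _)).trans e.toEmbedding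
  { anc := A.anc + B.anc
    gates := A.gates.map (QGate.map (Function.Embedding.inl.trans e.toEmbedding)) ++
      B.gates.map (QGate.map ψ)
    out := B.out.trans ψ }

lemma QCirc.comp_run (B : QCirc κ τ) (A : QCirc ι κ) (ρ : Op ι) :
    (B.comp A).run ρ = B.run (A.run ρ) := by
  let e : (ι ⊕ Fin A.anc) ⊕ Fin B.anc ≃ ι ⊕ Fin (A.anc + B.anc) :=
    (Equiv.sumAssoc _ _ _).trans ((Equiv.refl _).sumCongr finSumFinEquiv)
  let ψ : κ ⊕ Fin B.anc ↪ ι ⊕ Fin (A.anc + B.anc) :=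
    (A.out.sumMap (Function.Embedding.refl _)).trans e.toEmbedding
  have h0 : restrict e (tensor ρ (basis fun _ : Fin (A.anc + B.anc) => false)) =
      tensor (tensor ρ (basis fun _ : Fin A.anc => false))
        (basis fun _ : Fin B.anc => false) := by
    ext y y'
    have h : ∀ y : Bits ((ι ⊕ Fin A.anc) ⊕ Fin B.anc),
        (fun _ => false) = (y ∘ e.symm) ∘ Sum.inr ↔
          (fun _ => false) = (y ∘ Sum.inl) ∘ Sum.inr ∧ (fun _ => false) = y ∘ Sum.inr := by
      intro y
      constructor
      · intro h
        exact ⟨funext fun i => by simpa [e] using congrFun h (Fin.castAdd _ i),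
          funext fun i => by simpa [e] using congrFun h (Fin.natAdd _ i)⟩
      · rintro ⟨h1, h2⟩
        funext i
        refine Fin.addCases (fun i => ?_) (fun i => ?_) i
        · simpa [e] using congrFun h1 i
        · simpa [e] using congrFun h2 i
    have h' : ∀ y : Bits ((ι ⊕ Fin A.anc) ⊕ Fin B.anc),
        (y ∘ e.symm) ∘ Sum.inl = (y ∘ Sum.inl) ∘ Sum.inl := fun y => rfl
    rw [restrict_equiv]
    simp only [tensor, basis, Matrix.of_apply, Matrix.single_apply, h, h']
    split_ifs <;> first | (exfalso; tauto) | simp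
  have h1 : (B.comp A).run ρ = restrict (ψ ∘ B.out)
      (evolve (A.gates.map (QGate.map (Function.Embedding.inl.trans e.toEmbedding)) ++
        B.gates.map (QGate.map ψ)) (tensor ρ (basis fun _ : Fin (A.anc + B.anc) => false))) := rfl
  have h2 : (ψ : _ → _) = e ∘ Sum.map A.out id := rfl
  rw [h1, restrict_comp ψ.injective, evolve_append, restrict_evolve, h2,
    restrict_comp e.injective, restrict_embedding_equiv, evolve_inl, h0, restrict_map_id,
    onLeft_onLeft, onLeft_tensor]
  · rfl
  · intro c ρ
    rw [evolve_smul, restrict_smul]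

/-- Discarding and renaming qubits. -/
def QCirc.proj (f : κ ↪ ι) : QCirc ι κ := ⟨0, [], f.trans Function.Embedding.inl⟩

lemma QCirc.proj_run (f : κ ↪ ι) (ρ : Op ι) : (QCirc.proj f).run ρ = restrict f ρ := by
  have h : (QCirc.proj f).run ρ = restrict ((Equiv.sumEmpty ι (Fin 0)).symm ∘ f)
      (tensor ρ (basis fun _ : Fin 0 => false)) := rfl
  rw [h, restrict_comp (Equiv.injective _)]
  congr 1
  ext y y'
  rw [restrict_equiv]
  simp [tensor, basis, Subsingleton.elim _ (fun _ : Fin 0 => false)]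
  rfl

end

/-! ### Quantum circuits for classical functions -/

section

variable {N : Type} [Fintype N] [DecidableEq N]

/-- The unitary matrix of a list of gates. -/
def listU (gs : List (QGate N)) : Op N := gs.foldl (fun U g => g.unitary * U) 1

lemma foldl_unitary (gs : List (QGate N)) (U : Op N) :
    gs.foldl (fun U g => g.unitary * U) U = listU gs * U := by
  rw [listU]
  induction gs generalizing U with
  | nil => simp
  | cons g gs ih =>
    rw [List.foldl_cons, List.foldl_cons, ih, ih (_ * 1), Matrix.mul_one, Matrix.mul_assoc]

lemma listU_cons (g : QGate N) (gs : List (QGate N)) :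
    listU (g :: gs) = listU gs * g.unitary := by
  rw [listU, List.foldl_cons, Matrix.mul_one, foldl_unitary]

lemma listU_append (gs gs' : List (QGate N)) : listU (gs ++ gs') = listU gs' * listU gs := by
  rw [listU, List.foldl_append, foldl_unitary]
  rfl

lemma evolve_eq (gs : List (QGate N)) (X : Op N) :
    evolve gs X = listU gs * X * (listU gs).conjTranspose := by
  induction gs generalizing X with
  | nil => simp [evolve, listU]
  | cons g gs ih =>
    rw [evolve_cons, ih, listU_cons, Matrix.conjTranspose_mul]
    simp only [Matrix.mul_assoc]

/-- The gates map the basis vector `w` to the basis vector `F w` with the phase `c w`. -/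
def Monomial (gs : List (QGate N)) (c : Bits N → ℂ) (F : Bits N → Bits N) : Prop :=
  ∀ w w', listU gs w' w = if w' = F w then c w else 0

lemma Monomial.append {gs gs' : List (QGate N)} {c c' : Bits N → ℂ} {F F' : Bits N → Bits N}
    (h : Monomial gs c F) (h' : Monomial gs' c' F') :
    Monomial (gs ++ gs') (fun w => c' (F w) * c w) (fun w => F' (F w)) := by
  intro w w'
  rw [listU_append, Matrix.mul_apply]
  simp only [h _ _, h' _ _, mul_ite, mul_zero, Finset.sum_ite_eq', Finset.mem_univ, if_true,
    ite_mul, zero_mul]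

lemma Monomial.nil : Monomial ([] : List (QGate N)) (fun _ => 1) (fun w => w) := by
  intro w w'
  simp [listU, Matrix.one_apply]

lemma Monomial.congr {gs : List (QGate N)} {c c' : Bits N → ℂ} {F F' : Bits N → Bits N}
    (h : Monomial gs c F) (hc : ∀ w, c w = c' w) (hF : ∀ w, F w = F' w) : Monomial gs c' F' := by
  intro w w'
  rw [h, hc, hF]

/-- `exp (i π / 4)`. -/
def omega : ℂ := Complex.exp (Complex.I * (Real.pi / 4 : ℝ))

lemma omega_pow_four : omega ^ 4 = -1 := by
  rw [omega, ← Complex.exp_nat_mul, ← Complex.exp_pi_mul_I]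
  congr 1
  push_cast
  ring

lemma omega_pow_eight : omega ^ 8 = 1 := by
  rw [show (8 : ℕ) = 4 * 2 from rfl, pow_mul, omega_pow_four]
  norm_num

lemma monomial_T (i : N) (n : ℕ) :
    Monomial (List.replicate n (QGate.T i)) (fun w => if w i then omega ^ n else 1)
      (fun w => w) := by
  induction n with
  | zero => exact Monomial.nil.congr (by simp) (by simp)
  | succ n ih =>
    have h1 : Monomial [QGate.T i] (fun w => if w i then omega else 1) (fun w => w) := by
      intro w w'
      simp only [listU, List.foldl_cons, List.foldl_nil, Matrix.mul_one, QGate.unitary,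
        Matrix.diagonal_apply]
      split_ifs with h2 <;> simp_all [omega]
    refine (h1.append ih).congr (fun w => ?_) fun w => rfl
    split_ifs
    · rw [pow_succ]
    · simp

lemma monomial_CNOT (a t : N) (h : a ≠ t) :
    Monomial [QGate.CNOT a t h] (fun _ => 1)
      (fun w => Function.update w t (xor (w t) (w a))) := by
  intro w w'
  simp [listU, QGate.unitary]

/-- Only the two strings that agree with `w` outside of `i` contribute to a Hadamard gate. -/
lemma sum_unitary_H (i : N) (w : Bits N) (f : Bits N → ℂ) :
    ∑ v, (QGate.H i).unitary w v * f v =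
      ∑ b : Bool, (QGate.H i).unitary w (Function.update w i b) * f (Function.update w i b) := by
  symm
  refine Finset.sum_of_injOn (fun b : Bool => Function.update w i b) ?_ ?_ ?_ ?_
  · intro b _ b' _ hb
    simpa using congrFun hb i
  · simp
  · intro v _ hv
    have : ¬ ∀ j, j ≠ i → w j = v j := by
      intro hj
      refine hv ⟨v i, by simp, ?_⟩
      funext j
      by_cases hji : j = i
      · subst hji; simp
      · simp [hji, hj j hji]
    simp [QGate.unitary, this]
  · simp

lemma unitary_H_update (i : N) (w : Bits N) (b : Bool) :
    (QGate.H i).unitary w (Function.update w i b) =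
      (if w i && b then -1 else 1) * ((Real.sqrt 2 : ℝ) : ℂ)⁻¹ := by
  have h : ∀ j, j ≠ i → w j = (Function.update w i b) j := fun j hj => by
    rw [Function.update_of_ne hj]
  simp only [QGate.unitary, Matrix.of_apply, Function.update_self]
  rw [if_pos h]

lemma sqrt_two_inv_mul : ((Real.sqrt 2 : ℝ) : ℂ)⁻¹ * ((Real.sqrt 2 : ℝ) : ℂ)⁻¹ = 1 / 2 := by
  rw [← mul_inv, ← Complex.ofReal_mul, Real.mul_self_sqrt (by norm_num)]
  norm_num

/-- A diagonal sign between two Hadamard gates is a controlled bit flip. -/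
lemma monomial_H_conj {gs : List (QGate N)} (i : N) (g : Bits N → Bool)
    (hg : ∀ w b, g (Function.update w i b) = g w)
    (h : Monomial gs (fun w => if w i && g w then -1 else 1) (fun w => w)) :
    Monomial (QGate.H i :: (gs ++ [QGate.H i])) (fun _ => 1)
      (fun w => Function.update w i (xor (w i) (g w))) := by
  intro w w'
  have hU : listU (QGate.H i :: (gs ++ [QGate.H i])) =
      (QGate.H i).unitary * (listU gs * (QGate.H i).unitary) := by
    rw [listU_cons, listU_append, Matrix.mul_assoc]
    simp [listU]
  have hD : ∀ v, (listU gs * (QGate.H i).unitary) v w =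
      (if v i && g v then -1 else 1) * (QGate.H i).unitary v w := by
    intro v
    rw [Matrix.mul_apply, Finset.sum_eq_single v]
    · rw [h]; simp
    · intro b _ hb
      rw [h, if_neg (Ne.symm hb), zero_mul]
    · simp
  rw [hU, Matrix.mul_apply, sum_unitary_H]
  have hs := sqrt_two_inv_mul
  have hcond : ∀ b, (∀ j, j ≠ i → (Function.update w' i b) j = w j) ↔ ∀ j, j ≠ i → w' j = w j :=
    fun b => forall₂_congr fun j hj => by rw [Function.update_of_ne hj]
  simp only [hD, unitary_H_update]
  simp only [QGate.unitary, Matrix.of_apply, hcond, hg, Function.update_self, Fintype.sum_bool]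
  by_cases hag : ∀ j, j ≠ i → w' j = w j
  · have hgw : g w' = g w := by
      have : w' = Function.update w i (w' i) := by
        funext j
        by_cases hji : j = i
        · subst hji; simp
        · simp [hji, hag j hji]
      rw [this, hg]
    have hiff : w' = Function.update w i (xor (w i) (g w)) ↔ w' i = xor (w i) (g w) := by
      constructor
      · intro h; rw [h]; simp
      · intro h
        funext j
        by_cases hji : j = i
        · subst hji; simp [h]
        · simp [hji, hag j hji]
    simp only [if_pos hag, hiff, hgw]
    cases w' i <;> cases w i <;> cases g w <;> simp <;> linear_combination 2 * hs
  · have hne : w' ≠ Function.update w i (xor (w i) (g w)) := by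
      rintro rfl
      exact hag fun j hj => by rw [Function.update_of_ne hj]
    simp [hag, hne]

/-- The bit flip on `i`. -/
def gatesX (i : N) : List (QGate N) := QGate.H i :: (List.replicate 4 (QGate.T i) ++ [QGate.H i])

lemma monomial_X (i : N) :
    Monomial (gatesX i) (fun _ => 1) (fun w => Function.update w i (!w i)) := by
  refine (monomial_H_conj i (fun _ => true) (fun _ _ => rfl) ?_).congr (fun _ => rfl)
    fun w => by simp
  exact (monomial_T i 4).congr (fun w => by rw [omega_pow_four]; simp) fun _ => rfl

/-- The doubly controlled sign. -/
def gatesCCZ (a b t : N) (hab : a ≠ b) (hat : a ≠ t) (hbt : b ≠ t) : List (QGate N) :=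
  [QGate.CNOT b t hbt] ++ List.replicate 7 (QGate.T t) ++ [QGate.CNOT a t hat] ++
    List.replicate 1 (QGate.T t) ++ [QGate.CNOT b t hbt] ++ List.replicate 7 (QGate.T t) ++
    [QGate.CNOT a t hat] ++ List.replicate 1 (QGate.T b) ++ List.replicate 1 (QGate.T t) ++
    [QGate.CNOT a b hab] ++ List.replicate 1 (QGate.T a) ++ List.replicate 7 (QGate.T b) ++
    [QGate.CNOT a b hab]

lemma monomial_CCZ (a b t : N) (hab : a ≠ b) (hat : a ≠ t) (hbt : b ≠ t) :
    Monomial (gatesCCZ a b t hab hat hbt) (fun w => if w t && (w a && w b) then -1 else 1)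
      (fun w => w) := by
  refine ((((((((((((monomial_CNOT b t hbt).append (monomial_T t 7)).append
    (monomial_CNOT a t hat)).append (monomial_T t 1)).append (monomial_CNOT b t hbt)).append
    (monomial_T t 7)).append (monomial_CNOT a t hat)).append (monomial_T b 1)).append
    (monomial_T t 1)).append (monomial_CNOT a b hab)).append (monomial_T a 1)).append
    (monomial_T b 7)).append (monomial_CNOT a b hab) |>.congr (fun w => ?_) fun w => ?_
  · have h8 := omega_pow_eight
    have h4 := omega_pow_four
    simp only [Function.update_self, Function.update_of_ne hat, Function.update_of_ne hbt,
      Function.update_of_ne hab]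
    cases w a <;> cases w b <;> cases w t <;> simp <;> ring_nf
    all_goals first | exact h4 | rw [show (16 : ℕ) = 8 * 2 from rfl, pow_mul, h8, one_pow]
  · funext j
    by_cases hjt : j = t
    · subst hjt
      simp [Function.update_of_ne hat, Function.update_of_ne hbt, Function.update_of_ne hbt.symm]
      cases w a <;> cases w b <;> cases w j <;> rfl
    · by_cases hjb : j = b
      · subst hjb
        simp [Function.update_of_ne hat, Function.update_of_ne hbt, Function.update_of_ne hab]
      · simp [Function.update_of_ne hjt, Function.update_of_ne hjb]

/-- The Toffoli gate. -/
def gatesToffoli (a b t : N) (hab : a ≠ b) (hat : a ≠ t) (hbt : b ≠ t) : List (QGate N) :=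
  QGate.H t :: (gatesCCZ a b t hab hat hbt ++ [QGate.H t])

lemma monomial_Toffoli (a b t : N) (hab : a ≠ b) (hat : a ≠ t) (hbt : b ≠ t) :
    Monomial (gatesToffoli a b t hab hat hbt) (fun _ => 1)
      (fun w => Function.update w t (xor (w t) (w a && w b))) :=
  monomial_H_conj t (fun w => w a && w b)
    (fun w c => by rw [Function.update_of_ne hat, Function.update_of_ne hbt])
    (monomial_CCZ a b t hab hat hbt)

end

section

variable {N : Type} [Fintype N] [DecidableEq N]

/-- The gates map the basis vector `w` to the basis vector `w'`. -/
def Maps (gs : List (QGate N)) (w w' : Bits N) : Prop :=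
  ∀ v, listU gs v w = if v = w' then 1 else 0

lemma Maps.nil (w : Bits N) : Maps [] w w := fun v => Monomial.nil w v

lemma Maps.congr {gs : List (QGate N)} {w w' w'' : Bits N} (h : Maps gs w w') (e : w' = w'') :
    Maps gs w w'' := e ▸ h

lemma Maps.append {gs gs' : List (QGate N)} {w w' w'' : Bits N} (h : Maps gs w w')
    (h' : Maps gs' w' w'') : Maps (gs ++ gs') w w'' := by
  intro v
  rw [listU_append, Matrix.mul_apply]
  simp only [h _, mul_ite, mul_one, mul_zero, Finset.sum_ite_eq', Finset.mem_univ, if_true, h' _]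

lemma Monomial.maps {gs : List (QGate N)} {F : Bits N → Bits N}
    (h : Monomial gs (fun _ => 1) F) {w w' : Bits N} (hw : F w = w') : Maps gs w w' :=
  fun v => by rw [h, hw]

lemma Maps.evolve {gs : List (QGate N)} {w v w' v' : Bits N} (h : Maps gs w w')
    (h' : Maps gs v v') : evolve gs (Matrix.single w v 1) = Matrix.single w' v' 1 := by
  rw [evolve_eq]
  ext a b
  rw [Matrix.mul_apply, Finset.sum_eq_single v]
  · rw [Matrix.mul_apply, Finset.sum_eq_single w]
    · rw [h, Matrix.conjTranspose_apply, h', Matrix.single_apply]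
      by_cases h1 : w' = a <;> by_cases h2 : v' = b <;> simp [h1, h2, eq_comm]
    · intro c _ hc
      simp [hc.symm]
    · simp
  · intro c _ hc
    rw [Matrix.mul_apply, Finset.sum_eq_zero, zero_mul]
    intro d _
    simp [hc.symm]
  · simp

/-- The NAND of the qubits `a` and `b`, written onto the blank qubit `t`. If `a` or `b` is the
qubit `t` itself, then its value is `false`. -/
def gatesNand (a b t : N) : List (QGate N) :=
  if h : a = t ∨ b = t then gatesX t
  else if hab : a = b then gatesX t ++ [QGate.CNOT a t fun e => h (Or.inl e)]
  else gatesX t ++ gatesToffoli a b t hab (fun e => h (Or.inl e)) (fun e => h (Or.inr e))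

lemma length_gatesNand (a b t : N) : (gatesNand a b t).length ≤ 39 := by
  unfold gatesNand gatesToffoli gatesCCZ gatesX
  split_ifs <;> simp

lemma maps_gatesNand (a b t : N) (w : Bits N) (hw : w t = false) :
    Maps (gatesNand a b t) w (Function.update w t (!(w a && w b))) := by
  unfold gatesNand
  split_ifs with h hab
  · refine (monomial_X t).maps ?_
    rcases h with rfl | rfl <;> simp [hw]
  · subst hab
    have ha : a ≠ t := fun e => h (Or.inl e)
    refine ((monomial_X t).maps rfl).append ((monomial_CNOT a t ha).maps ?_)
    simp [Function.update_of_ne ha, hw]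
  · have ha : a ≠ t := fun e => h (Or.inl e)
    have hb : b ≠ t := fun e => h (Or.inr e)
    refine ((monomial_X t).maps rfl).append ((monomial_Toffoli a b t hab ha hb).maps ?_)
    simp [Function.update_of_ne ha, Function.update_of_ne hb, hw]

end

namespace BCirc

variable {ι κ : Type} {s : ℕ} [Fintype ι] [DecidableEq ι] [Fintype κ] [DecidableEq κ]

/-- The qubit that holds a wire. -/
def qubit (κ : Type) [Fintype κ] (a : ι ⊕ Fin s) : ι ⊕ Fin (s + Fintype.card κ) :=
  Sum.map id (Fin.castAdd _) a

/-- The quantum gates for the first `n` gates of `c`. -/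
def qGates (c : BCirc ι κ s) : ℕ → List (QGate (ι ⊕ Fin (s + Fintype.card κ)))
  | 0 => []
  | n + 1 => c.qGates n ++ if h : n < s then
      gatesNand (qubit κ (c.gate ⟨n, h⟩).1) (qubit κ (c.gate ⟨n, h⟩).2) (qubit κ (Sum.inr ⟨n, h⟩))
      else []

/-- The quantum gates that copy the first `n` outputs of `c` to blank qubits. -/
def qCopy (c : BCirc ι κ s) : ℕ → List (QGate (ι ⊕ Fin (s + Fintype.card κ)))
  | 0 => []
  | n + 1 => c.qCopy n ++ if h : n < Fintype.card κ then
      [QGate.CNOT (qubit κ (c.out ((Fintype.equivFin κ).symm ⟨n, h⟩)))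
        (Sum.inr (Fin.natAdd s ⟨n, h⟩)) (by
          rcases c.out ((Fintype.equivFin κ).symm ⟨n, h⟩) with a | a
          · simp [qubit]
          · simp only [qubit, Sum.map_inr, ne_eq, Sum.inr.injEq, Fin.ext_iff, Fin.val_castAdd,
              Fin.val_natAdd]
            omega)]
      else []

lemma length_qGates (c : BCirc ι κ s) (n : ℕ) : (c.qGates n).length ≤ n * 39 := by
  induction n with
  | zero => simp [qGates]
  | succ n ih =>
    rw [qGates, List.length_append]
    split_ifs
    · have := length_gatesNand (N := ι ⊕ Fin (s + Fintype.card κ))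
      have h := this (qubit κ (c.gate ⟨n, by assumption⟩).1) (qubit κ (c.gate ⟨n, by assumption⟩).2)
        (qubit κ (Sum.inr ⟨n, by assumption⟩))
      omega
    · simp; omega

lemma length_qCopy (c : BCirc ι κ s) (n : ℕ) : (c.qCopy n).length ≤ n := by
  induction n with
  | zero => simp [qCopy]
  | succ n ih =>
    rw [qCopy, List.length_append]
    split_ifs <;> simp <;> omega

/-- The contents of the qubits: the input, the gates and the outputs. -/
def qState (x : Bits ι) (v : Fin s → Bool) {q : ℕ} (y : Fin q → Bool) : Bits (ι ⊕ Fin (s + q)) :=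
  Sum.elim x (Fin.addCases v y)

lemma qState_qubit (x : Bits ι) (v : Fin s → Bool) (y : Fin (Fintype.card κ) → Bool)
    (a : ι ⊕ Fin s) : qState x v y (qubit κ a) = Sum.elim x v a := by
  rcases a with a | a <;> simp [qState, qubit]

lemma maps_qGates (c : BCirc ι κ s) (x : Bits ι) (n : ℕ) :
    Maps (c.qGates n) (qState x (fun _ => false) fun _ => false)
      (qState x (c.state x n) fun _ => false) := by
  induction n with
  | zero => exact Maps.nil _
  | succ n ih =>
    refine ih.append ?_
    split_ifs with h
    · have h0 : c.state x n ⟨n, h⟩ = false := by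
        obtain ⟨v, hv⟩ := c.exists_isVal x
        rw [state_eq_of_isVal hv]
        simp
      refine (maps_gatesNand _ _ _ _ (by rw [qState_qubit]; exact h0)).congr ?_
      · simp only [qState_qubit]
        symm
        funext i
        rcases i with i | i
        · simp [qState, qubit]
        · refine Fin.addCases (fun i => ?_) (fun i => ?_) i
          · have : (Sum.inr (Fin.castAdd (Fintype.card κ) i) : ι ⊕ Fin (s + Fintype.card κ)) =
              qubit κ (Sum.inr i) := rfl
            rw [this, qState_qubit, Sum.elim_inr, state_succ]
            by_cases hi : (i : ℕ) = n
            · subst hi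
              simp
            · rw [if_neg hi, Function.update_of_ne, qState_qubit, Sum.elim_inr]
              simp only [qubit, Sum.map_inr, ne_eq, Sum.inr.injEq, Fin.ext_iff, Fin.val_castAdd]
              exact hi
          · rw [Function.update_of_ne]
            · simp [qState]
            · simp only [qubit, Sum.map_inr, ne_eq, Sum.inr.injEq, Fin.ext_iff, Fin.val_castAdd,
                Fin.val_natAdd]
              omega
    · refine (Maps.nil _).congr (congrArg (fun v => qState x v _) ?_)
      symm
      funext i
      rw [state_succ, if_neg (by have := i.2; omega)]

lemma maps_qCopy (c : BCirc ι κ s) (x : Bits ι) (n : ℕ) :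
    Maps (c.qCopy n) (qState x (c.state x s) fun _ => false)
      (qState x (c.state x s) fun j =>
        decide ((j : ℕ) < n) && c.eval x ((Fintype.equivFin κ).symm j)) := by
  induction n with
  | zero => simpa [qCopy] using Maps.nil _
  | succ n ih =>
    refine ih.append ?_
    split_ifs with h
    · refine (monomial_CNOT _ _ _).maps ?_
      rw [qState_qubit]
      funext i
      rcases i with i | i
      · simp [qState]
      · refine Fin.addCases (fun i => ?_) (fun i => ?_) i
        · rw [Function.update_of_ne]
          · simp [qState]
          · simp only [ne_eq, Sum.inr.injEq, Fin.ext_iff, Fin.val_castAdd, Fin.val_natAdd]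
            omega
        · by_cases hi : (i : ℕ) = n
          · subst hi
            simp [qState, eval]
          · rw [Function.update_of_ne]
            · have : (i : ℕ) < n + 1 ↔ (i : ℕ) < n := by omega
              simp only [qState, Sum.elim_inr, Fin.addCases_right, this]
            · simp only [ne_eq, Sum.inr.injEq, Fin.ext_iff, Fin.val_natAdd]
              omega
    · refine (Maps.nil _).congr (congrArg (qState x _) ?_)
      funext j
      have := j.2
      have h1 : (j : ℕ) < n + 1 := by omega
      have h2 : (j : ℕ) < n := by omega
      simp [h1, h2]

/-- A quantum circuit for a Boolean circuit. -/
def toQCirc (c : BCirc ι κ s) : QCirc ι κ where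
  anc := s + Fintype.card κ
  gates := c.qGates s ++ c.qCopy (Fintype.card κ)
  out := ⟨fun o => Sum.inr (Fin.natAdd s (Fintype.equivFin κ o)), fun o o' h => by
    simpa using h⟩

end BCirc

section

variable {ι κ M N : Type} [Fintype ι] [DecidableEq ι] [Fintype κ] [DecidableEq κ]
  [Fintype M] [DecidableEq M] [Fintype N] [DecidableEq N]

lemma restrict_single (f : M → N) (w w' : Bits N) : restrict f (Matrix.single w w' (1 : ℂ)) =
    if AgreeOff f w w' then Matrix.single (w ∘ f) (w' ∘ f) 1 else 0 := by
  ext y y'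
  rw [restrict_apply, Finset.sum_eq_single w, Finset.sum_eq_single w']
  · by_cases h : AgreeOff f w w' <;>
      by_cases h1 : w ∘ f = y <;> by_cases h2 : w' ∘ f = y' <;> simp [h, h1, h2]
  · intro b _ hb
    simp [hb.symm]
  · simp
  · intro b _ hb
    simp [hb.symm]
  · simp

lemma tensor_single_basis (x x' : Bits ι) (y : Bits κ) :
    tensor (Matrix.single x x' 1) (basis y) = Matrix.single (Sum.elim x y) (Sum.elim x' y) 1 := by
  ext w w'
  have h : ∀ (x : Bits ι) (w : Bits (ι ⊕ κ)), Sum.elim x y = w ↔ x = w ∘ Sum.inl ∧ y = w ∘ Sum.inr :=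
    fun x w => by
      constructor
      · rintro rfl; exact ⟨rfl, rfl⟩
      · rintro ⟨rfl, rfl⟩; exact Sum.elim_comp_inl_inr w
  simp only [tensor, basis, Matrix.of_apply, Matrix.single_apply, h]
  split_ifs <;> first | (exfalso; tauto) | simp

/-- Measuring all the qubits and applying `f` to the outcome. -/
def clas (f : Bits ι → Bits κ) (ρ : Op ι) : Op κ := ∑ x, ρ x x • basis (f x)

lemma BCirc.toQCirc_run {s : ℕ} (c : BCirc ι κ s) (ρ : Op ι) : c.toQCirc.run ρ = clas c.eval ρ := by
  have hs : ∀ x x' : Bits ι, c.toQCirc.run (Matrix.single x x' 1) =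
      if x = x' then basis (c.eval x) else 0 := by
    intro x x'
    have hm : ∀ x, Maps (c.qGates s ++ c.qCopy (Fintype.card κ))
        (Sum.elim x fun _ => false) (qState x (c.state x s) fun j =>
        c.eval x ((Fintype.equivFin κ).symm j)) := by
      intro x
      have h := (maps_qGates c x s).append (maps_qCopy c x (Fintype.card κ))
      have h1 : (qState x (fun _ : Fin s => false) fun _ : Fin (Fintype.card κ) => false) =
          Sum.elim x fun _ => false := by
        funext i
        rcases i with i | i
        · rfl
        · refine Fin.addCases (fun i => ?_) (fun i => ?_) i <;> simp [qState]
      simpa [h1] using h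
    have h := (hm x).evolve (hm x')
    have hrun : ∀ ρ : Op ι, c.toQCirc.run ρ =
        restrict (fun o => (Sum.inr (Fin.natAdd s (Fintype.equivFin κ o)) :
          ι ⊕ Fin (s + Fintype.card κ)))
          (evolve (c.qGates s ++ c.qCopy (Fintype.card κ))
            (tensor ρ (basis fun _ : Fin (s + Fintype.card κ) => false))) := fun _ => rfl
    rw [hrun, tensor_single_basis, h, restrict_single]
    by_cases hx : x = x'
    · subst hx
      rw [if_pos (show AgreeOff _ _ _ from fun _ _ => rfl), if_pos rfl, basis]
      congr 1 <;> (funext o; simp [qState])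
    · rw [if_neg hx, if_neg]
      intro ha
      refine hx (funext fun i => ?_)
      simpa [qState] using ha (Sum.inl i) fun o => by simp
  conv_lhs => rw [Matrix.matrix_eq_sum_single ρ]
  have h1 : ∀ x x' : Bits ι, Matrix.single x x' (ρ x x') = ρ x x' • Matrix.single x x' (1 : ℂ) := by
    intro x x'; simp
  simp only [QCirc.run_sum, h1, QCirc.run_smul, hs, clas]
  refine Finset.sum_congr rfl fun x _ => ?_
  simp

end

/-! ### Probabilities and random bits -/

section

variable {N : Type} [Fintype N] [DecidableEq N]

lemma QGate.conjTranspose_mul_unitary (g : QGate N) : g.unitary.conjTranspose * g.unitary = 1 := by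
  cases g with
  | H i =>
    have hh : (QGate.H i).unitary.conjTranspose = (QGate.H i).unitary := by
      ext w w'
      simp only [unitary, Matrix.conjTranspose_apply, Matrix.of_apply]
      have : (∀ j, j ≠ i → w' j = w j) ↔ ∀ j, j ≠ i → w j = w' j :=
        forall₂_congr fun j _ => eq_comm
      simp only [this, Bool.and_comm (w' i)]
      split_ifs <;> simp
    rw [hh]
    ext w w'
    rw [Matrix.mul_apply, sum_unitary_H]
    have hcond : ∀ b, (∀ j, j ≠ i → (Function.update w i b) j = w' j) ↔ ∀ j, j ≠ i → w j = w' j :=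
      fun b => forall₂_congr fun j hj => by rw [Function.update_of_ne hj]
    have hs := sqrt_two_inv_mul
    simp only [unitary_H_update, Fintype.sum_bool, Matrix.one_apply]
    simp only [unitary, Matrix.of_apply, hcond, Function.update_self]
    by_cases hag : ∀ j, j ≠ i → w j = w' j
    · have hiff : w = w' ↔ w i = w' i := by
        refine ⟨fun h => by rw [h], fun h => ?_⟩
        funext j
        by_cases hji : j = i
        · subst hji; exact h
        · exact hag j hji
      simp only [if_pos hag, hiff]
      cases w i <;> cases w' i <;> simp <;> linear_combination 2 * hs
    · have hne : w ≠ w' := by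
        rintro rfl
        exact hag fun _ _ => rfl
      simp [hag, hne]
  | T i =>
    rw [unitary, Matrix.diagonal_conjTranspose, Matrix.diagonal_mul_diagonal, ← Matrix.diagonal_one]
    congr 1
    funext w
    simp only [Pi.star_apply]
    split_ifs
    · rw [RCLike.star_def, ← Complex.exp_conj, ← Complex.exp_add, map_mul,
        Complex.conj_I, Complex.conj_ofReal, neg_mul, neg_add_cancel, Complex.exp_zero]
    · simp
  | CNOT c t h =>
    ext w w'
    have hinv : ∀ v : Bits N, Function.update (Function.update v t (xor (v t) (v c))) t
        (xor ((Function.update v t (xor (v t) (v c))) t)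
          ((Function.update v t (xor (v t) (v c))) c)) = v := by
      intro v
      rw [Function.update_of_ne h, Function.update_self, Function.update_idem]
      simp
    simp only [unitary, Matrix.mul_apply, Matrix.conjTranspose_apply, Matrix.of_apply]
    rw [Finset.sum_eq_single (Function.update w t (xor (w t) (w c)))]
    · rw [if_pos rfl, Matrix.one_apply]
      by_cases hw : w = w'
      · subst hw; simp
      · rw [if_neg, if_neg hw]
        · simp
        · intro he
          refine hw ?_
          rw [← hinv w, he, hinv]
    · intro v _ hv
      simp [hv]
    · simp

lemma conjTranspose_mul_listU (gs : List (QGate N)) :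
    (listU gs).conjTranspose * listU gs = 1 := by
  induction gs with
  | nil => simp [listU]
  | cons g gs ih =>
    rw [listU_cons, Matrix.conjTranspose_mul, Matrix.mul_assoc,
      ← Matrix.mul_assoc (listU gs).conjTranspose, ih, Matrix.one_mul,
      QGate.conjTranspose_mul_unitary]

lemma sum_normSq_listU (gs : List (QGate N)) (w : Bits N) :
    ∑ v, Complex.normSq (listU gs v w) = 1 := by
  have h := congrFun (congrFun (conjTranspose_mul_listU gs) w) w
  rw [Matrix.mul_apply, Matrix.one_apply_eq] at h
  have h' := congrArg Complex.re h
  rw [Complex.re_sum] at h'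
  rw [← Complex.one_re, ← h']
  refine Finset.sum_congr rfl fun v _ => ?_
  rw [Matrix.conjTranspose_apply, RCLike.star_def, ← Complex.normSq_eq_conj_mul_self]
  simp

lemma evolve_basis_diag (gs : List (QGate N)) (w v : Bits N) :
    evolve gs (basis w) v v = (Complex.normSq (listU gs v w) : ℂ) := by
  rw [evolve_eq, basis, Matrix.mul_apply, Finset.sum_eq_single w]
  · rw [Matrix.mul_apply, Finset.sum_eq_single w]
    · rw [Matrix.single_apply_same, Matrix.conjTranspose_apply, RCLike.star_def, mul_one,
        Complex.mul_conj]
    · intro c _ hc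
      simp [hc.symm]
    · simp
  · intro c _ hc
    rw [Matrix.mul_apply, Finset.sum_eq_zero, zero_mul]
    intro d _
    simp [hc.symm]
  · simp

variable {ι κ : Type} [Fintype ι] [DecidableEq ι] [Fintype κ] [DecidableEq κ]

lemma tensor_basis (x : Bits ι) (y : Bits κ) : tensor (basis x) (basis y) = basis (Sum.elim x y) :=
  tensor_single_basis x x y

lemma restrict_diag {M : Type} [Fintype M] [DecidableEq M] (f : M → N) (X : Op N) (y : Bits M) :
    restrict f X y y = ∑ w : Bits N, if w ∘ f = y then X w w else 0 := by
  rw [restrict_apply]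
  refine Finset.sum_congr rfl fun w _ => ?_
  rw [Finset.sum_eq_single w]
  · have : AgreeOff f w w := fun _ _ => rfl
    simp [this]
  · intro w' _ hw'
    rw [if_neg]
    rintro ⟨h1, h2, h3⟩
    refine hw' (funext fun i => ?_)
    by_cases hr : ∃ m, f m = i
    · obtain ⟨m, rfl⟩ := hr
      exact (congrFun h2 m).trans (congrFun h1 m).symm
    · exact (h3 i fun o ho => hr ⟨o, ho⟩).symm
  · simp

lemma QCirc.prob_run_basis (A : QCirc ι κ) (x : Bits ι) (y : Bits κ) :
    prob (A.run (basis x)) y = ∑ w, if w ∘ A.out = y then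
      Complex.normSq (listU A.gates w (Sum.elim x fun _ => false)) else 0 := by
  rw [prob, QCirc.run_eq, restrict_diag, Complex.re_sum]
  refine Finset.sum_congr rfl fun w _ => ?_
  rw [tensor_basis, evolve_basis_diag]
  split_ifs <;> simp

lemma QCirc.prob_nonneg (A : QCirc ι κ) (x : Bits ι) (y : Bits κ) :
    0 ≤ prob (A.run (basis x)) y := by
  rw [prob_run_basis]
  exact Finset.sum_nonneg fun w _ => by split_ifs <;> simp [Complex.normSq_nonneg]

lemma QCirc.prob_le_one (A : QCirc ι κ) (x : Bits ι) (y : Bits κ) :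
    prob (A.run (basis x)) y ≤ 1 := by
  rw [prob_run_basis, ← sum_normSq_listU A.gates (Sum.elim x fun _ => false)]
  exact Finset.sum_le_sum fun w _ => by split_ifs <;> simp [Complex.normSq_nonneg]

lemma listU_H_zero (L : List N) (hL : L.Nodup) (w : Bits N) :
    listU (L.map QGate.H) w (fun _ => false) =
      if ∀ i, i ∉ L → w i = false then (((Real.sqrt 2 : ℝ) : ℂ)⁻¹) ^ L.length else 0 := by
  induction L using List.reverseRecOn generalizing w with
  | nil =>
    have : (∀ i, i ∉ ([] : List N) → w i = false) ↔ w = fun _ => false :=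
      ⟨fun h => funext fun i => h i (by simp), fun h i _ => by rw [h]⟩
    rw [List.map_nil, listU, List.foldl_nil, Matrix.one_apply, List.length_nil, pow_zero]
    exact if_congr this.symm rfl rfl
  | append_singleton L i ih =>
    rw [List.nodup_append] at hL
    have hi : i ∉ L := fun h => hL.2.2 i h i (by simp) rfl
    rw [List.map_append, listU_append, Matrix.mul_apply]
    have h1 : listU (List.map QGate.H [i]) = (QGate.H i).unitary := by simp [listU]
    rw [h1, sum_unitary_H, Fintype.sum_bool, ih hL.1, ih hL.1, unitary_H_update, unitary_H_update]
    have hneg : ¬ ∀ j, j ∉ L → (Function.update w i true) j = false := fun h => by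
      simpa using h i hi
    rw [if_neg hneg, mul_zero, zero_add]
    · have : (∀ j, j ∉ L → (Function.update w i false) j = false) ↔
          ∀ j, j ∉ L ++ [i] → w j = false := by
        refine forall_congr' fun j => ?_
        by_cases hj : j = i
        · subst hj; simp
        · simp [hj]
      simp only [this, Bool.and_false, Bool.false_eq_true, if_false, one_mul]
      split_ifs <;> simp [pow_succ, mul_comm]

/-- A circuit with uniformly distributed output, except for coherences. -/
def QCirc.coins (r : ℕ) : QCirc Empty (Fin r) where
  anc := r
  gates := (List.finRange r).map fun i => QGate.H (Sum.inr i)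
  out := Function.Embedding.inr

lemma QCirc.coins_run_diag (r : ℕ) (y : Bits (Fin r)) :
    (QCirc.coins r).run (basis Empty.elim) y y = ((2 : ℂ) ^ r)⁻¹ := by
  have hrun : (QCirc.coins r).run (basis Empty.elim) = restrict (Equiv.emptySum Empty (Fin r)).symm
      (evolve ((List.finRange r).map fun i => QGate.H (Sum.inr i))
        (tensor (basis Empty.elim) (basis fun _ : Fin r => false))) := rfl
  have hL : ((List.finRange r).map fun i => QGate.H (Sum.inr i : Empty ⊕ Fin r)) =
      ((List.finRange r).map (Sum.inr : Fin r → Empty ⊕ Fin r)).map QGate.H := by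
    rw [List.map_map]; rfl
  have h0 : (Sum.elim Empty.elim fun _ => false : Bits (Empty ⊕ Fin r)) = fun _ => false := by
    funext i; rcases i with i | i
    · exact i.elim
    · rfl
  rw [hrun, restrict_equiv, tensor_basis, evolve_basis_diag, hL, h0, listU_H_zero]
  · rw [if_pos]
    · rw [List.length_map, List.length_finRange, map_pow]
      have : Complex.normSq ((Real.sqrt 2 : ℝ) : ℂ)⁻¹ = 2⁻¹ := by
        rw [map_inv₀, Complex.normSq_ofReal, Real.mul_self_sqrt (by norm_num)]
      rw [this]
      simp
    · rintro (i | i) hi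
      · exact i.elim
      · simp at hi
  · exact (List.nodup_finRange r).map Sum.inr_injective

end

/-! ### Classically controlled quantum circuits -/

/-- Number of gates and ancillas. -/
def QCirc.cost {ι κ : Type} (A : QCirc ι κ) : ℕ := A.gates.length + A.anc

/-- The states `S z` are prepared from the classical input `z` by a circuit of cost at most `s`. -/
def QS {χ κ : Type} [Fintype χ] [DecidableEq χ] [Fintype κ] (S : Bits χ → Op κ) (s : ℕ) : Prop :=
  ∃ A : QCirc χ κ, A.cost ≤ s ∧ ∀ z, A.run (basis z) = S z

/-- The channels `Ψ z` are applied, under control of the classical input `z`, by a circuit of cost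
at most `s`. -/
def QK {χ ι κ : Type} [Fintype χ] [DecidableEq χ] [Fintype ι] [DecidableEq ι] [Fintype κ]
    (Ψ : Bits χ → Op ι → Op κ) (s : ℕ) : Prop :=
  ∃ A : QCirc (χ ⊕ ι) κ, A.cost ≤ s ∧ ∀ z ρ, A.run (tensor (basis z) ρ) = Ψ z ρ

section

variable {χ χ' ι κ τ μ : Type} [Fintype χ] [DecidableEq χ] [Fintype χ'] [DecidableEq χ']
  [Fintype ι] [DecidableEq ι] [Fintype κ] [DecidableEq κ] [Fintype τ] [DecidableEq τ]
  [Fintype μ] [DecidableEq μ]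

lemma QCirc.cost_comp (B : QCirc κ τ) (A : QCirc ι κ) : (B.comp A).cost = A.cost + B.cost := by
  simp only [cost, comp, List.length_append, List.length_map]
  omega

lemma QCirc.cost_left (A : QCirc ι κ) : (A.left τ).cost = A.cost := by
  simp [cost, left]

/-- Renaming of the qubits. -/
def QCirc.relabel (e : κ ≃ ι) : QCirc ι κ := QCirc.proj e.toEmbedding

lemma QCirc.relabel_run (e : κ ≃ ι) (ρ : Op ι) : (QCirc.relabel e).run ρ = restrict e ρ :=
  QCirc.proj_run _ _

lemma QCirc.cost_relabel (e : κ ≃ ι) : (QCirc.relabel e).cost = 0 := rfl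

lemma BCirc.cost_toQCirc {s : ℕ} (c : BCirc ι κ s) :
    c.toQCirc.cost ≤ 40 * s + 2 * Fintype.card κ := by
  have h1 := c.length_qGates s
  have h2 := c.length_qCopy (Fintype.card κ)
  simp only [QCirc.cost, toQCirc, List.length_append]
  omega

lemma clas_basis (f : Bits ι → Bits κ) (x : Bits ι) : clas f (basis x) = basis (f x) := by
  rw [clas, Finset.sum_eq_single x]
  · simp [basis]
  · intro y _ hy
    simp [basis, hy.symm]
  · simp

/-- Two copies of the register `χ`. -/
lemma cx_dup : Cx (fun z : Bits χ => Sum.elim z z) 0 :=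
  (Cx.wires fun i => i).pair (Cx.wires fun i => i)

section Relabel

lemma restrict_comm (ρ : Op χ) (σ : Op ι) :
    restrict (Equiv.sumComm ι χ) (tensor ρ σ) = tensor σ ρ := by
  ext y y'
  rw [restrict_equiv]
  simp only [tensor, Matrix.of_apply, mul_comm (σ _ _)]
  rfl

end Relabel

lemma tensor_sum_left {α : Type*} (s : Finset α) (f : α → Op ι) (σ : Op κ) :
    tensor (∑ a ∈ s, f a) σ = ∑ a ∈ s, tensor (f a) σ := by
  ext w w'
  simp [tensor, Matrix.sum_apply, Finset.sum_mul]

lemma restrict_inr_tensor_basis (z : Bits χ) (ρ : Op ι) :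
    restrict Sum.inr (tensor (basis z) ρ) = ρ := by
  ext y y'
  have h : ∀ a a' : Bits χ, ∀ b b' : Bits ι,
      AgreeOff Sum.inr (Sum.elim a b) (Sum.elim a' b') ↔ a = a' := by
    intro a a' b b'
    constructor
    · intro h; funext i; exact h (Sum.inl i) fun o => by simp
    · rintro rfl (i | i) hi
      · rfl
      · exact absurd rfl (hi i)
  rw [restrict_apply, sum_bits_sum]
  simp only [sum_bits_sum (ι := χ) (κ := ι), h]
  have h1 : ∀ (a : Bits χ) (b : Bits ι), (Sum.elim a b : Bits (χ ⊕ ι)) ∘ Sum.inr = b := fun _ _ => rfl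
  have h2 : ∀ (a : Bits χ) (b : Bits ι), (Sum.elim a b : Bits (χ ⊕ ι)) ∘ Sum.inl = a := fun _ _ => rfl
  simp only [h1, tensor, Matrix.of_apply, h2, basis, Matrix.single_apply]
  rw [Finset.sum_eq_single z]
  · rw [Finset.sum_eq_single y]
    · rw [Finset.sum_eq_single z]
      · rw [Finset.sum_eq_single y'] <;> simp +contextual
      · intro b _ hb; simp [hb.symm]
      · simp
    · intro b _ hb; simp [hb]
    · simp
  · intro b _ hb; simp [hb.symm]
  · simp

namespace QS

lemma of_cx {f : Bits χ → Bits κ} {s : ℕ} (hf : Cx f s) :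
    QS (fun z => basis (f z)) (40 * s + 2 * Fintype.card κ) := by
  obtain ⟨c, hc⟩ := hf
  refine ⟨c.toQCirc, c.cost_toQCirc, fun z => ?_⟩
  rw [c.toQCirc_run, clas_basis, hc]

/-- First the states `S z`, then the channels `Ψ z`. -/
lemma bind {S : Bits χ → Op ι} {Ψ : Bits χ → Op ι → Op κ} {s t : ℕ} (hS : QS S s) (hΨ : QK Ψ t) :
    QS (fun z => Ψ z (S z)) (4 * Fintype.card χ + s + t) := by
  obtain ⟨D, hDc, hD⟩ := of_cx (cx_dup (χ := χ))
  obtain ⟨A, hAc, hA⟩ := hS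
  obtain ⟨B, hBc, hB⟩ := hΨ
  have hD' : ∀ z, D.run (basis z) = basis (Sum.elim z z) := hD
  refine ⟨B.comp ((QCirc.relabel (Equiv.sumComm χ ι)).comp ((A.left χ).comp D)), ?_, fun z => ?_⟩
  · simp only [QCirc.cost_comp, QCirc.cost_left, QCirc.cost_relabel, Fintype.card_sum] at *
    omega
  · rw [QCirc.comp_run, QCirc.comp_run, QCirc.comp_run, hD', ← tensor_basis, QCirc.left_run,
      onLeft_tensor A.run_smul, hA, QCirc.relabel_run, restrict_comm, hB]

lemma pre {S : Bits χ' → Op κ} {f : Bits χ → Bits χ'} {s t : ℕ} (hS : QS S s) (hf : Cx f t) :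
    QS (fun z => S (f z)) (40 * t + 2 * Fintype.card χ' + s) := by
  obtain ⟨F, hFc, hF⟩ := of_cx hf
  obtain ⟨A, hAc, hA⟩ := hS
  have hF' : ∀ z, F.run (basis z) = basis (f z) := hF
  refine ⟨A.comp F, ?_, fun z => ?_⟩
  · rw [QCirc.cost_comp]; omega
  · rw [QCirc.comp_run, hF', hA]

lemma coins (r : ℕ) :
    QS (fun _ : Bits Empty => ∑ y : Bits (Fin r), ((2 : ℂ) ^ r)⁻¹ • basis y) (4 * r) := by
  obtain ⟨F, hF⟩ := Cx.wires (fun i : Fin r => i)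
  refine ⟨F.toQCirc.comp (QCirc.coins r), ?_, fun z => ?_⟩
  · have h := F.cost_toQCirc
    simp only [Fintype.card_fin] at h
    rw [QCirc.cost_comp]
    simp only [QCirc.cost, QCirc.coins, List.length_map, List.length_finRange] at *
    omega
  · rw [QCirc.comp_run, F.toQCirc_run, clas, Subsingleton.elim z Empty.elim]
    refine Finset.sum_congr rfl fun y _ => ?_
    rw [QCirc.coins_run_diag, hF]
    rfl

/-- Averaging over random bits. -/
lemma rand {r : ℕ} {S : Bits (χ ⊕ Fin r) → Op κ} {s : ℕ} (hS : QS S s) :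
    QS (fun z => ∑ y : Bits (Fin r), ((2 : ℂ) ^ r)⁻¹ • S (Sum.elim z y)) (4 * r + s) := by
  obtain ⟨C, hCc, hC⟩ := coins r
  obtain ⟨A, hAc, hA⟩ := hS
  have hC' : ∀ z, C.run (basis z) = ∑ y : Bits (Fin r), ((2 : ℂ) ^ r)⁻¹ • basis y := hC
  refine ⟨A.comp ((QCirc.relabel (Equiv.sumComm χ (Fin r))).comp ((C.left χ).comp
    (QCirc.relabel (Equiv.emptySum Empty χ)))), ?_, fun z => ?_⟩
  · simp only [QCirc.cost_comp, QCirc.cost_left, QCirc.cost_relabel] at *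
    omega
  · have h0 : restrict (Equiv.emptySum Empty χ) (basis z) =
        tensor (basis Empty.elim) (basis z) := by
      rw [tensor_basis]
      ext y y'
      have h : ∀ y : Bits (Empty ⊕ χ), z = y ∘ (Equiv.emptySum Empty χ).symm ↔
          Sum.elim Empty.elim z = y := by
        intro y
        constructor
        · rintro rfl; funext i; rcases i with i | i
          · exact i.elim
          · rfl
        · rintro rfl; rfl
      rw [restrict_equiv]
      simp only [basis, Matrix.single_apply, h]
    rw [QCirc.comp_run, QCirc.comp_run, QCirc.comp_run,
      QCirc.relabel_run (Equiv.emptySum Empty χ), h0, QCirc.left_run,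
      onLeft_tensor C.run_smul, hC', tensor_sum_left, QCirc.run_sum, QCirc.run_sum]
    refine Finset.sum_congr rfl fun y _ => ?_
    rw [tensor_smul_left, QCirc.run_smul, QCirc.run_smul, QCirc.relabel_run, restrict_comm,
      tensor_basis, hA]

end QS

end

section

variable {χ χ' ι κ τ μ β γ : Type} [Fintype χ] [DecidableEq χ] [Fintype χ'] [DecidableEq χ']
  [Fintype ι] [DecidableEq ι] [Fintype κ] [DecidableEq κ] [Fintype τ] [DecidableEq τ]
  [Fintype μ] [DecidableEq μ] [Fintype β] [DecidableEq β] [Fintype γ] [DecidableEq γ]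

namespace QK

lemma mono {Ψ : Bits χ → Op ι → Op κ} {s t : ℕ} (h : QK Ψ s) (hst : s ≤ t) : QK Ψ t :=
  let ⟨A, hA, h⟩ := h
  ⟨A, hA.trans hst, h⟩

lemma of_circ (A : QCirc ι κ) : QK (fun _ : Bits χ => A.run) A.cost := by
  refine ⟨A.comp (QCirc.proj Function.Embedding.inr), ?_, fun z ρ => ?_⟩
  · rw [QCirc.cost_comp]
    simp [QCirc.cost, QCirc.proj]
  · rw [QCirc.comp_run, QCirc.proj_run]
    exact congrArg _ (restrict_inr_tensor_basis z ρ)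

lemma of_ctrl (A : QCirc (χ ⊕ ι) κ) : QK (fun (z : Bits χ) ρ => A.run (tensor (basis z) ρ)) A.cost :=
  ⟨A, le_rfl, fun _ _ => rfl⟩

lemma pre {Ψ : Bits χ' → Op ι → Op κ} {f : Bits χ → Bits χ'} {s t : ℕ} (hΨ : QK Ψ s)
    (hf : Cx f t) : QK (fun z => Ψ (f z)) (40 * t + 2 * Fintype.card χ' + s) := by
  obtain ⟨F, hFc, hF⟩ := QS.of_cx hf
  obtain ⟨A, hAc, hA⟩ := hΨ
  have hF' : ∀ z, F.run (basis z) = basis (f z) := hF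
  refine ⟨A.comp (F.left ι), ?_, fun z ρ => ?_⟩
  · rw [QCirc.cost_comp, QCirc.cost_left]; omega
  · rw [QCirc.comp_run, QCirc.left_run, onLeft_tensor F.run_smul, hF', hA]

lemma comp {Ψ : Bits χ → Op ι → Op κ} {Φ : Bits χ → Op κ → Op τ} {s t : ℕ} (hΦ : QK Φ t)
    (hΨ : QK Ψ s) : QK (fun z ρ => Φ z (Ψ z ρ)) (4 * Fintype.card χ + s + t) := by
  obtain ⟨D, hDc, hD⟩ := QS.of_cx (cx_dup (χ := χ))
  obtain ⟨A, hAc, hA⟩ := hΨ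
  obtain ⟨B, hBc, hB⟩ := hΦ
  have hD' : ∀ z, D.run (basis z) = basis (Sum.elim z z) := hD
  refine ⟨B.comp ((QCirc.relabel (Equiv.sumComm χ κ)).comp ((A.left χ).comp
    ((QCirc.relabel ((Equiv.sumComm _ _).trans (Equiv.sumAssoc χ χ ι).symm)).comp (D.left ι)))),
    ?_, fun z ρ => ?_⟩
  · simp only [QCirc.cost_comp, QCirc.cost_left, QCirc.cost_relabel, Fintype.card_sum] at *
    omega
  · have h : restrict ((Equiv.sumComm _ _).trans (Equiv.sumAssoc χ χ ι).symm)
        (tensor (tensor (basis z) (basis z)) ρ) = tensor (tensor (basis z) ρ) (basis z) := by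
      ext y y'
      rw [restrict_equiv]
      simp only [tensor, Matrix.of_apply]
      rw [mul_assoc, mul_comm]
      rfl
    rw [QCirc.comp_run, QCirc.comp_run, QCirc.comp_run, QCirc.comp_run, QCirc.left_run D,
      onLeft_tensor D.run_smul, hD', ← tensor_basis, QCirc.relabel_run (Equiv.trans _ _), h,
      QCirc.left_run, onLeft_tensor A.run_smul, hA, QCirc.relabel_run, restrict_comm, hB]

lemma onLeft {Ψ : Bits χ → Op ι → Op κ} {s : ℕ} (hΨ : QK Ψ s) :
    QK (fun z (ρ : Op (ι ⊕ τ)) => onLeft (Ψ z) ρ) s := by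
  obtain ⟨A, hAc, hA⟩ := hΨ
  refine ⟨(A.left τ).comp (QCirc.relabel (Equiv.sumAssoc χ ι τ)), ?_, fun z ρ => ?_⟩
  · simpa only [QCirc.cost_comp, QCirc.cost_left, QCirc.cost_relabel, zero_add] using hAc
  · rw [QCirc.comp_run, QCirc.relabel_run, QCirc.left_run]
    ext w w'
    change _ = UnclonableCrypto.onLeft (Ψ z) ρ w w'
    rw [onLeft_apply, onLeft_apply, ← hA]
    congr 2
    ext x x'
    have h : ∀ (x : Bits (χ ⊕ ι)) (t : Bits τ), (Sum.elim x t ∘ (Equiv.sumAssoc χ ι τ).symm) ∘ Sum.inr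
        = Sum.elim (x ∘ Sum.inr) t := by
      intro x t; funext i; rcases i with i | i <;> rfl
    simp only [Matrix.of_apply, restrict_equiv, tensor, h]
    rfl

lemma swap : QK (fun _ : Bits χ => restrict (Equiv.sumComm ι κ)) 0 := by
  have h := of_circ (χ := χ) (QCirc.relabel (Equiv.sumComm ι κ))
  simp only [QCirc.cost_relabel] at h
  have h' : (QCirc.relabel (Equiv.sumComm ι κ)).run = restrict (Equiv.sumComm ι κ) :=
    funext fun ρ => QCirc.relabel_run _ _
  rwa [h'] at h

lemma onRight {Ψ : Bits χ → Op ι → Op κ} {s : ℕ} (hΨ : QK Ψ s) :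
    QK (fun z (ρ : Op (τ ⊕ ι)) => onRight (Ψ z) ρ) (8 * Fintype.card χ + s) := by
  have h := (swap (χ := χ)).comp ((hΨ.onLeft (τ := τ)).comp (swap (χ := χ) (ι := ι) (κ := τ)))
  refine (mono (t := 8 * Fintype.card χ + s) h (by omega)).imp fun A hA => ⟨hA.1, fun z ρ => ?_⟩
  rw [hA.2]
  ext w w'
  change restrict (Equiv.sumComm τ κ) _ w w' = UnclonableCrypto.onRight (Ψ z) ρ w w'
  rw [restrict_equiv, onLeft_apply]
  have h : ∀ (x : Bits ι) (t : Bits τ), Sum.elim x t ∘ (Equiv.sumComm ι τ).symm = Sum.elim t x := by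
    intro x t; funext i; rcases i with i | i <;> rfl
  simp only [UnclonableCrypto.onRight, Matrix.of_apply, restrict_equiv, h]
  rfl

/-- A state prepared from the classical input is appended. -/
lemma append {S : Bits χ → Op κ} {s : ℕ} (hS : QS S s) :
    QK (fun z (ρ : Op ι) => tensor ρ (S z)) s := by
  obtain ⟨A, hAc, hA⟩ := hS
  refine ⟨(QCirc.relabel (Equiv.sumComm ι κ)).comp (A.left ι), ?_, fun z ρ => ?_⟩
  · simpa only [QCirc.cost_comp, QCirc.cost_left, QCirc.cost_relabel, add_zero] using hAc
  · rw [QCirc.comp_run, QCirc.left_run, onLeft_tensor A.run_smul, QCirc.relabel_run, restrict_comm,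
      hA]

lemma onLeft_clas_id (ρ : Op (μ ⊕ ι)) :
    UnclonableCrypto.onLeft (clas fun x => x) ρ = ∑ m, tensor (basis m) (measL m ρ) := by
  ext w w'
  rw [onLeft_apply]
  simp only [clas, Matrix.sum_apply, Matrix.smul_apply, tensor, Matrix.of_apply, measL, smul_eq_mul,
    mul_comm]

/-- The register `μ` is measured, and the outcome is added to the classical control. -/
lemma meas {Ψ : Bits (χ ⊕ μ) → Op ι → Op κ} {s : ℕ} (hΨ : QK Ψ s) :
    QK (fun z (ρ : Op (μ ⊕ ι)) => ∑ m, Ψ (Sum.elim z m) (measL m ρ))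
      (2 * Fintype.card χ + 2 * Fintype.card μ + s) := by
  obtain ⟨A, hAc, hA⟩ := hΨ
  obtain ⟨F, hF⟩ := Cx.wires (fun i : χ ⊕ μ => i)
  refine ⟨A.comp ((F.toQCirc.left ι).comp (QCirc.relabel (Equiv.sumAssoc χ μ ι))), ?_,
    fun z ρ => ?_⟩
  · have h := F.cost_toQCirc
    simp only [QCirc.cost_comp, QCirc.cost_left, QCirc.cost_relabel, Fintype.card_sum] at *
    omega
  · have hF' : F.toQCirc.run = clas fun x => x := funext fun ρ => by
      rw [F.toQCirc_run]
      exact congrArg (fun f => clas f ρ) (funext hF)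
    rw [QCirc.comp_run, QCirc.comp_run, QCirc.left_run, hF', onLeft_clas_id, QCirc.run_sum,
      sum_bits_sum, Finset.sum_eq_single z]
    · refine Finset.sum_congr rfl fun m _ => ?_
      rw [← hA]
      congr 2
      ext y y'
      simp only [measL, Matrix.of_apply, QCirc.relabel_run, restrict_equiv]
      rw [tensor]
      have h : ∀ y : Bits ι, (Sum.elim (Sum.elim z m) y ∘ (Equiv.sumAssoc χ μ ι).symm) ∘ Sum.inl = z :=
        fun y => rfl
      have h' : ∀ y : Bits ι,
          (Sum.elim (Sum.elim z m) y ∘ (Equiv.sumAssoc χ μ ι).symm) ∘ Sum.inr = Sum.elim m y := by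
        intro y; funext i; rcases i with i | i <;> rfl
      simp only [Matrix.of_apply, h, h', basis, Matrix.single_apply, and_self, if_true, one_mul]
    · intro z' _ hz
      refine Finset.sum_eq_zero fun m _ => ?_
      have : measL (Sum.elim z' m) ((QCirc.relabel (Equiv.sumAssoc χ μ ι)).run (tensor (basis z) ρ))
          = 0 := by
        ext y y'
        simp only [measL, Matrix.of_apply, QCirc.relabel_run, restrict_equiv]
        rw [tensor]
        have h : ∀ y : Bits ι,
            (Sum.elim (Sum.elim z' m) y ∘ (Equiv.sumAssoc χ μ ι).symm) ∘ Sum.inl = z' :=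
          fun y => rfl
        simp [h, basis, Matrix.single_apply, hz.symm]
      rw [this, show tensor (basis (Sum.elim z' m)) (0 : Op ι) = (0 : ℂ) • 0 by ext; simp [tensor],
        QCirc.run_smul, zero_smul]
    · simp

/-- Measurement of all qubits, followed by a classical computation. -/
lemma clas {f : Bits (χ ⊕ ι) → Bits κ} {s : ℕ} (hf : Cx f s) :
    QK (fun z ρ => UnclonableCrypto.clas (fun x => f (Sum.elim z x)) ρ)
      (40 * s + 2 * Fintype.card κ) := by
  obtain ⟨c, hc⟩ := hf
  refine ⟨c.toQCirc, c.cost_toQCirc, fun z ρ => ?_⟩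
  rw [c.toQCirc_run, UnclonableCrypto.clas, sum_bits_sum, Finset.sum_eq_single z]
  · refine Finset.sum_congr rfl fun x _ => ?_
    rw [hc]
    simp [tensor, basis, Matrix.single_apply]
  · intro z' _ hz
    refine Finset.sum_eq_zero fun x _ => ?_
    simp [tensor, basis, Matrix.single_apply, hz.symm]
  · simp

end QK

lemma prob_clas (f : Bits ι → Bits κ) (ρ : Op ι) (y : Bits κ) :
    prob (clas f ρ) y = ∑ x, if f x = y then prob ρ x else 0 := by
  simp only [prob, clas, Matrix.sum_apply, Matrix.smul_apply, basis, Matrix.single_apply, and_self,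
    Complex.re_sum, smul_eq_mul, mul_ite, mul_one, mul_zero]
  exact Finset.sum_congr rfl fun x _ => by split_ifs <;> rfl

/-- Numbers `P z` that are the acceptance probabilities, on the classical inputs `z`, of a quantum
circuit of cost at most `s`. -/
def QP (P : Bits χ → ℝ) (s : ℕ) : Prop :=
  ∃ A : QCirc χ Unit, A.cost ≤ s ∧ ∀ z, prob (A.run (basis z)) (fun _ => true) = P z

namespace QP

lemma nonneg {P : Bits χ → ℝ} {s : ℕ} (h : QP P s) (z : Bits χ) : 0 ≤ P z := by
  obtain ⟨A, -, hA⟩ := h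
  exact hA z ▸ A.prob_nonneg _ _

lemma le_one {P : Bits χ → ℝ} {s : ℕ} (h : QP P s) (z : Bits χ) : P z ≤ 1 := by
  obtain ⟨A, -, hA⟩ := h
  exact hA z ▸ A.prob_le_one _ _

lemma pre {P : Bits χ' → ℝ} {f : Bits χ → Bits χ'} {s t : ℕ} (hP : QP P s) (hf : Cx f t) :
    QP (fun z => P (f z)) (40 * t + 2 * Fintype.card χ' + s) := by
  obtain ⟨A, hAc, hA⟩ := hP
  obtain ⟨B, hBc, hB⟩ := QS.pre (S := fun z => A.run (basis z)) ⟨A, hAc, fun _ => rfl⟩ hf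
  exact ⟨B, hBc, fun z => by rw [hB, hA]⟩

lemma of_state {S : Bits χ → Op κ} {f : Bits (χ ⊕ κ) → Bool} {s t : ℕ} (hS : QS S s)
    (hf : Cx (fun x (_ : Unit) => f x) t) :
    QP (fun z => ∑ x, if f (Sum.elim z x) then prob (S z) x else 0)
      (4 * Fintype.card χ + s + (40 * t + 2)) := by
  obtain ⟨A, hAc, hA⟩ := hS.bind (QK.clas hf)
  refine ⟨A, hAc, fun z => ?_⟩
  rw [hA, prob_clas]
  simp only [funext_iff, forall_const]

end QP

end

/-! ### Polynomial-size families of quantum circuits -/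

/-- The size of the index type is bounded by a polynomial. -/
class PolyCard (χ : ℕ → Type) [∀ l, Fintype (χ l)] : Prop where
  poly : PolyBdd fun l => Fintype.card (χ l)

namespace PolyCard

variable {χ κ : ℕ → Type} [∀ l, Fintype (χ l)] [∀ l, Fintype (κ l)]

lemma fin {n : ℕ → ℕ} (h : PolyBdd n) : PolyCard fun l => Fin (n l) := ⟨by simpa using h⟩

instance [PolyCard χ] [PolyCard κ] : PolyCard fun l => χ l ⊕ κ l :=
  ⟨by simpa using (poly (χ := χ)).add (poly (χ := κ))⟩

instance [PolyCard χ] [PolyCard κ] : PolyCard fun l => χ l × κ l :=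
  ⟨by simpa using (poly (χ := χ)).mul (poly (χ := κ))⟩

instance (T : Type) [Fintype T] : PolyCard fun _ => T := ⟨.const _⟩

instance [PolyCard χ] : PolyCard fun l => Fin (Fintype.card (χ l)) := fin poly

lemma desc [PolyCard χ] [PolyCard κ] {s : ℕ → ℕ} (hs : PolyBdd s) :
    PolyCard fun l => Desc (χ l) (κ l) (s l) := ⟨polyBdd_card_desc poly poly hs⟩

end PolyCard

lemma QPT.of_cost {χ κ : ℕ → Type} [∀ l, Fintype (χ l)] [∀ l, DecidableEq (χ l)]
    [∀ l, Fintype (κ l)] [PolyCard χ] [PolyCard κ] {A : ∀ l, QCirc (χ l) (κ l)} {p : ℕ → ℕ}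
    (hp : PolyBdd p) (h : ∀ l, (A l).cost ≤ p l) : QPT A := by
  refine ((hp.add (PolyCard.poly (χ := χ))).add (PolyCard.poly (χ := κ))).mono fun l => ?_
  have := h l
  simp only [QCirc.cost, QCirc.size] at *
  omega

lemma QPT.cost {χ κ : ℕ → Type} [∀ l, Fintype (χ l)] [∀ l, DecidableEq (χ l)]
    [∀ l, Fintype (κ l)] {A : ∀ l, QCirc (χ l) (κ l)} (h : QPT A) : PolyBdd fun l => (A l).cost :=
  PolyBdd.mono h fun l => by simp only [QCirc.cost, QCirc.size]; omega

lemma QPT.polyCard_out {χ κ : ℕ → Type} [∀ l, Fintype (χ l)] [∀ l, DecidableEq (χ l)]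
    [∀ l, Fintype (κ l)] {A : ∀ l, QCirc (χ l) (κ l)} (h : QPT A) : PolyCard κ :=
  ⟨PolyBdd.mono h fun l => by simp only [QCirc.size]; omega⟩

lemma PolyCard.left {χ κ : ℕ → Type} [∀ l, Fintype (χ l)] [∀ l, Fintype (κ l)]
    (h : PolyCard fun l => χ l ⊕ κ l) : PolyCard χ :=
  ⟨h.poly.mono fun l => by simp⟩

lemma PolyCard.right {χ κ : ℕ → Type} [∀ l, Fintype (χ l)] [∀ l, Fintype (κ l)]
    (h : PolyCard fun l => χ l ⊕ κ l) : PolyCard κ :=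
  ⟨h.poly.mono fun l => by simp⟩

section

variable {H H' : ℕ → Type} {χ χ' ι κ τ μ : ℕ → Type}
  [∀ l, Fintype (χ l)] [∀ l, DecidableEq (χ l)] [∀ l, Fintype (χ' l)] [∀ l, DecidableEq (χ' l)]
  [∀ l, Fintype (ι l)] [∀ l, DecidableEq (ι l)] [∀ l, Fintype (κ l)] [∀ l, DecidableEq (κ l)]
  [∀ l, Fintype (τ l)] [∀ l, DecidableEq (τ l)] [∀ l, Fintype (μ l)] [∀ l, DecidableEq (μ l)]

/-- States that are prepared from a classical input in polynomial time; `H` is a type of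
hardwired data. -/
def PS (S : ∀ l, H l → Bits (χ l) → Op (κ l)) : Prop :=
  ∃ p, PolyBdd p ∧ ∀ l h, QS (S l h) (p l)

/-- Channels with a classical control that are applied in polynomial time; `H` is a type of
hardwired data. -/
def PK (Ψ : ∀ l, H l → Bits (χ l) → Op (ι l) → Op (κ l)) : Prop :=
  ∃ p, PolyBdd p ∧ ∀ l h, QK (Ψ l h) (p l)

/-- Acceptance probabilities of polynomial-time quantum circuits on classical inputs; `H` is a type
of hardwired data. -/
def PP (P : ∀ l, H l → Bits (χ l) → ℝ) : Prop :=
  ∃ p, PolyBdd p ∧ ∀ l h, QP (P l h) (p l)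

namespace PS

variable {S : ∀ l, H l → Bits (χ l) → Op (κ l)}

lemma reparam (hS : PS S) (φ : ∀ l, H' l → H l) : PS fun l h => S l (φ l h) :=
  let ⟨p, hp, h⟩ := hS
  ⟨p, hp, fun l _ => h l _⟩

lemma of_qpt {A : ∀ l, QCirc (χ l) (κ l)} (hA : QPT A) :
    PS fun l (_ : H l) z => (A l).run (basis z) :=
  ⟨_, hA.cost, fun l _ => ⟨A l, le_rfl, fun _ => rfl⟩⟩

lemma of_pc [PolyCard κ] {f : ∀ l, H l → Bits (χ l) → Bits (κ l)} (hf : PC f) :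
    PS fun l h z => basis (f l h z) :=
  let ⟨_, hp, h⟩ := hf
  ⟨_, ((PolyBdd.const 40).mul hp).add ((PolyBdd.const 2).mul (PolyCard.poly (χ := κ))),
    fun l a => QS.of_cx (h l a)⟩

lemma bind [PolyCard χ] {S : ∀ l, H l → Bits (χ l) → Op (ι l)}
    {Ψ : ∀ l, H l → Bits (χ l) → Op (ι l) → Op (κ l)} (hS : PS S) (hΨ : PK Ψ) :
    PS fun l h z => Ψ l h z (S l h z) :=
  let ⟨_, hp, h⟩ := hS
  let ⟨_, hq, h'⟩ := hΨ
  ⟨_, (((PolyBdd.const 4).mul (PolyCard.poly (χ := χ))).add hp).add hq,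
    fun l a => (h l a).bind (h' l a)⟩

lemma pre [PolyCard χ] (hS : PS S) {f : ∀ l, H l → Bits (χ' l) → Bits (χ l)} (hf : PC f) :
    PS fun l h z => S l h (f l h z) :=
  let ⟨_, hp, h⟩ := hS
  let ⟨_, hq, h'⟩ := hf
  ⟨_, (((PolyBdd.const 40).mul hq).add ((PolyBdd.const 2).mul (PolyCard.poly (χ := χ)))).add hp,
    fun l a => (h l a).pre (h' l a)⟩

/-- Averaging over random bits. -/
lemma rand [PolyCard χ] [PolyCard μ] {S : ∀ l, H l → Bits (χ l ⊕ μ l) → Op (κ l)} (hS : PS S) :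
    PS fun l h z => ∑ y : Bits (μ l),
      ((2 : ℂ) ^ Fintype.card (μ l))⁻¹ • S l h (Sum.elim z y) := by
  obtain ⟨p, hp, h⟩ := hS.pre (χ' := fun l => χ l ⊕ Fin (Fintype.card (μ l)))
    (PC.wires fun l _ => Sum.map id (Fintype.equivFin (μ l)))
  refine ⟨_, ((PolyBdd.const 4).mul (PolyCard.poly (χ := μ))).add hp, fun l a => ?_⟩
  obtain ⟨A, hAc, hA⟩ := (h l a).rand
  refine ⟨A, hAc, fun z => (hA z).trans ?_⟩
  refine Fintype.sum_equiv ((Fintype.equivFin (μ l)).symm.arrowCongr (Equiv.refl Bool)) _ _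
    fun y => ?_
  refine congrArg (fun w => ((2 : ℂ) ^ Fintype.card (μ l))⁻¹ • S l a w) ?_
  funext i
  rcases i with i | i <;> rfl

/-- The circuits for one choice of the hardwired data. -/
lemma exists_qpt [PolyCard χ] [PolyCard κ] (hS : PS S) (a : ∀ l, H l) :
    ∃ A : ∀ l, QCirc (χ l) (κ l), QPT A ∧ ∀ l z, (A l).run (basis z) = S l (a l) z := by
  obtain ⟨p, hp, h⟩ := hS
  choose A hA hA' using fun l => h l (a l)
  exact ⟨A, QPT.of_cost hp hA, hA'⟩

end PS

namespace PK

variable {Ψ : ∀ l, H l → Bits (χ l) → Op (ι l) → Op (κ l)}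

lemma reparam (hΨ : PK Ψ) (φ : ∀ l, H' l → H l) : PK fun l h => Ψ l (φ l h) :=
  let ⟨p, hp, h⟩ := hΨ
  ⟨p, hp, fun l _ => h l _⟩

lemma of_qpt {A : ∀ l, QCirc (ι l) (κ l)} (hA : QPT A) :
    PK fun l (_ : H l) (_ : Bits (χ l)) => (A l).run :=
  ⟨_, hA.cost, fun l _ => QK.of_circ (A l)⟩

lemma of_ctrl {A : ∀ l, QCirc (χ l ⊕ ι l) (κ l)} (hA : QPT A) :
    PK fun l (_ : H l) (z : Bits (χ l)) ρ => (A l).run (tensor (basis z) ρ) :=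
  ⟨_, hA.cost, fun l _ => QK.of_ctrl (A l)⟩

lemma relabel (e : ∀ l, κ l ≃ ι l) :
    PK fun l (_ : H l) (_ : Bits (χ l)) => restrict (e l) :=
  ⟨_, .const 0, fun l _ => by
    have h := QK.of_circ (χ := χ l) (QCirc.relabel (e l))
    rwa [QCirc.cost_relabel, show (QCirc.relabel (e l)).run = restrict (e l) from
      funext (QCirc.relabel_run _)] at h⟩

lemma pre [PolyCard χ] (hΨ : PK Ψ) {f : ∀ l, H l → Bits (χ' l) → Bits (χ l)} (hf : PC f) :
    PK fun l h z => Ψ l h (f l h z) :=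
  let ⟨_, hp, h⟩ := hΨ
  let ⟨_, hq, h'⟩ := hf
  ⟨_, (((PolyBdd.const 40).mul hq).add ((PolyBdd.const 2).mul (PolyCard.poly (χ := χ)))).add hp,
    fun l a => (h l a).pre (h' l a)⟩

lemma comp [PolyCard χ] {Φ : ∀ l, H l → Bits (χ l) → Op (κ l) → Op (τ l)} (hΦ : PK Φ)
    (hΨ : PK Ψ) : PK fun l h z ρ => Φ l h z (Ψ l h z ρ) :=
  let ⟨_, hp, h⟩ := hΨ
  let ⟨_, hq, h'⟩ := hΦ
  ⟨_, (((PolyBdd.const 4).mul (PolyCard.poly (χ := χ))).add hp).add hq,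
    fun l a => (h' l a).comp (h l a)⟩

lemma onLeft (hΨ : PK Ψ) :
    PK fun l h z (ρ : Op (ι l ⊕ τ l)) => onLeft (Ψ l h z) ρ :=
  let ⟨_, hp, h⟩ := hΨ
  ⟨_, hp, fun l a => (h l a).onLeft⟩

lemma onRight [PolyCard χ] (hΨ : PK Ψ) :
    PK fun l h z (ρ : Op (τ l ⊕ ι l)) => onRight (Ψ l h z) ρ :=
  let ⟨_, hp, h⟩ := hΨ
  ⟨_, ((PolyBdd.const 8).mul (PolyCard.poly (χ := χ))).add hp, fun l a => (h l a).onRight⟩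

lemma append {S : ∀ l, H l → Bits (χ l) → Op (κ l)} (hS : PS S) :
    PK fun l h z (ρ : Op (ι l)) => tensor ρ (S l h z) :=
  let ⟨_, hp, h⟩ := hS
  ⟨_, hp, fun l a => QK.append (h l a)⟩

lemma prepend [PolyCard χ] {S : ∀ l, H l → Bits (χ l) → Op (κ l)} (hS : PS S) :
    PK fun l h z (ρ : Op (ι l)) => tensor (S l h z) ρ := by
  have h := (relabel (H := H) (χ := χ) fun l => Equiv.sumComm (κ l) (ι l)).comp
    (append (ι := ι) hS)
  simpa only [restrict_comm] using h

lemma meas [PolyCard χ] [PolyCard μ] {Ψ : ∀ l, H l → Bits (χ l ⊕ μ l) → Op (ι l) → Op (κ l)}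
    (hΨ : PK Ψ) :
    PK fun l h z (ρ : Op (μ l ⊕ ι l)) => ∑ m, Ψ l h (Sum.elim z m) (measL m ρ) :=
  let ⟨_, hp, h⟩ := hΨ
  ⟨_, (((PolyBdd.const 2).mul (PolyCard.poly (χ := χ))).add
    ((PolyBdd.const 2).mul (PolyCard.poly (χ := μ)))).add hp, fun l a => (h l a).meas⟩

lemma clas [PolyCard κ] {f : ∀ l, H l → Bits (χ l ⊕ ι l) → Bits (κ l)} (hf : PC f) :
    PK fun l h z ρ => UnclonableCrypto.clas (fun x => f l h (Sum.elim z x)) ρ :=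
  let ⟨_, hp, h⟩ := hf
  ⟨_, ((PolyBdd.const 40).mul hp).add ((PolyBdd.const 2).mul (PolyCard.poly (χ := κ))),
    fun l a => QK.clas (h l a)⟩

/-- The circuits for one choice of the hardwired data. -/
lemma exists_qpt [PolyCard χ] [PolyCard ι] [PolyCard κ] (hΨ : PK Ψ) (a : ∀ l, H l) :
    ∃ A : ∀ l, QCirc (χ l ⊕ ι l) (κ l), QPT A ∧
      ∀ l z ρ, (A l).run (tensor (basis z) ρ) = Ψ l (a l) z ρ := by
  obtain ⟨p, hp, h⟩ := hΨ
  choose A hA hA' using fun l => h l (a l)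
  exact ⟨A, QPT.of_cost hp hA, hA'⟩

end PK

namespace PP

variable {P : ∀ l, H l → Bits (χ l) → ℝ}

lemma nonneg (hP : PP P) (l : ℕ) (h : H l) (z : Bits (χ l)) : 0 ≤ P l h z :=
  let ⟨_, _, h'⟩ := hP
  (h' l h).nonneg z

lemma le_one (hP : PP P) (l : ℕ) (h : H l) (z : Bits (χ l)) : P l h z ≤ 1 :=
  let ⟨_, _, h'⟩ := hP
  (h' l h).le_one z

lemma congr {P' : ∀ l, H l → Bits (χ l) → ℝ} (hP : PP P) (h : ∀ l a z, P l a z = P' l a z) :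
    PP P' := by
  have : P = P' := by funext l a z; exact h l a z
  exact this ▸ hP

lemma reparam (hP : PP P) (φ : ∀ l, H' l → H l) : PP fun l h => P l (φ l h) :=
  let ⟨p, hp, h⟩ := hP
  ⟨p, hp, fun l _ => h l _⟩

lemma pre [PolyCard χ] (hP : PP P) {f : ∀ l, H l → Bits (χ' l) → Bits (χ l)} (hf : PC f) :
    PP fun l h z => P l h (f l h z) :=
  let ⟨_, hp, h⟩ := hP
  let ⟨_, hq, h'⟩ := hf
  ⟨_, (((PolyBdd.const 40).mul hq).add ((PolyBdd.const 2).mul (PolyCard.poly (χ := χ)))).add hp,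
    fun l a => (h l a).pre (h' l a)⟩

lemma of_state [PolyCard χ] {S : ∀ l, H l → Bits (χ l) → Op (κ l)}
    {f : ∀ l, H l → Bits (χ l ⊕ κ l) → Bool} (hS : PS S) (hf : PB f) :
    PP fun l h z => ∑ x, if f l h (Sum.elim z x) then prob (S l h z) x else 0 :=
  let ⟨_, hp, h⟩ := hS
  let ⟨_, hq, h'⟩ := hf
  ⟨_, (((PolyBdd.const 4).mul (PolyCard.poly (χ := χ))).add hp).add
    (((PolyBdd.const 40).mul hq).add (.const 2)), fun l a => QP.of_state (h l a) (h' l a)⟩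

/-- The distinguishers for one choice of the hardwired data. -/
lemma exists_qpt [PolyCard χ] (hP : PP P) (a : ∀ l, H l) :
    ∃ A : ∀ l, QCirc (χ l) Unit, QPT A ∧
      ∀ l z, prob ((A l).run (basis z)) (fun _ => true) = P l (a l) z := by
  obtain ⟨p, hp, h⟩ := hP
  choose A hA hA' using fun l => h l (a l)
  exact ⟨A, QPT.of_cost hp hA, hA'⟩

end PP

end

/-! ### Obfuscation of circuits with hardwired data -/

/-- An obfuscation scheme for the functions `f(d, ·)`, given by the data `d`. -/
structure DataObf {δ ι κ : ℕ → Type} (f : ∀ l, Bits (δ l ⊕ ι l) → Bits (κ l)) where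
  /-- number of random bits -/
  r : ℕ → ℕ
  /-- length of an obfuscation -/
  t : ℕ → ℕ
  r_poly : PolyBdd r
  t_poly : PolyBdd t
  obf : ∀ l, Bits (δ l ⊕ Fin (r l)) → Bits (Fin (t l))
  eval : ∀ l, Bits (Fin (t l) ⊕ ι l) → Bits (κ l)
  obf_pc : PC fun l (_ : Unit) => obf l
  eval_pc : PC fun l (_ : Unit) => eval l
  correct : ∀ l d ω x, eval l (Sum.elim (obf l (Sum.elim d ω)) x) = f l (Sum.elim d x)
  secure : ∀ (H : ℕ → Type) [∀ l, Nonempty (H l)] (P : ∀ l, H l → Bits (Fin (t l)) → ℝ), PP P →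
    ∃ ν : ℕ → ℝ, Negligible ν ∧ (∀ l, 0 ≤ ν l) ∧ ∀ l h d₀ d₁,
      (∀ x, f l (Sum.elim d₀ x) = f l (Sum.elim d₁ x)) →
      |(𝔼 ω : Bits (Fin (r l)), P l h (obf l (Sum.elim d₀ ω))) -
        𝔼 ω : Bits (Fin (r l)), P l h (obf l (Sum.elim d₁ ω))| ≤ ν l

lemma expect_nonneg_le_one {α : Type*} [Fintype α] [Nonempty α] {f : α → ℝ} (h0 : ∀ a, 0 ≤ f a)
    (h1 : ∀ a, f a ≤ 1) : 0 ≤ 𝔼 a, f a ∧ 𝔼 a, f a ≤ 1 :=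
  ⟨Finset.expect_nonneg fun a _ => h0 a,
    Finset.expect_le Finset.univ_nonempty fun a _ => h1 a⟩

lemma abs_sub_le_one {a b : ℝ} (ha : 0 ≤ a ∧ a ≤ 1) (hb : 0 ≤ b ∧ b ≤ 1) : |a - b| ≤ 1 := by
  rw [abs_le]; constructor <;> linarith [ha.1, ha.2, hb.1, hb.2]

/-- The circuits given to the obfuscation scheme are circuits for `f` with the data `d` hardwired; they
all have the same size. The bound is uniform in the distinguisher's hardwired data and in the pair of
data `d₀`, `d₁`. -/
lemma nonempty_dataObf (hObf : ExistsIndObf) {δ ι κ : ℕ → Type} [∀ l, Fintype (δ l)]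
    [∀ l, DecidableEq (δ l)] [∀ l, Fintype (ι l)] [∀ l, DecidableEq (ι l)] [∀ l, Fintype (κ l)]
    [∀ l, DecidableEq (κ l)] [PolyCard δ] [PolyCard ι] [PolyCard κ]
    {f : ∀ l, Bits (δ l ⊕ ι l) → Bits (κ l)} (hf : PC fun l (_ : Unit) => f l) :
    Nonempty (DataObf f) := by
  set n := fun l => Fintype.card (ι l) with hn
  set m := fun l => Fintype.card (κ l) with hm
  have hι : PolyBdd n := PolyCard.poly (χ := ι)
  have hκ : PolyBdd m := PolyCard.poly (χ := κ)
  have hδ := PolyCard.poly (χ := δ)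
  let eι : ∀ l, ι l ≃ Fin (n l) := fun l => Fintype.equivFin (ι l)
  let eκ : ∀ l, κ l ≃ Fin (m l) := fun l => Fintype.equivFin (κ l)
  obtain ⟨s, hs, hc⟩ := (hf.map_in (ι' := fun l => δ l ⊕ Fin (n l))
    fun l => Sum.map id (eι l)).map_out fun l => (eκ l).symm
  choose c hc using fun l => hc l ()
  set s' := fun l => Fintype.card (δ l) + 1 + s l with hs'
  have hs'p : PolyBdd s' := (hδ.add (.const 1)).add hs
  obtain ⟨O, hO, hsec⟩ := hObf n m s' hι hκ hs'p
  have hn' : PolyCard fun l => Fin (n l) := .fin hι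
  have hm' : PolyCard fun l => Fin (m l) := .fin hκ
  have hd : PolyCard fun l => Desc (Fin (n l)) (Fin (m l)) (s' l) := .desc hs'p
  have hr : PolyBdd O.r := PolyBdd.mono O.obf_pt fun l => by
    simp only [BAlg.size, Fintype.card_sum, Fintype.card_fin]; omega
  have ht : PolyBdd O.t := PolyBdd.mono O.obf_pt fun l => by
    simp only [BAlg.size, Fintype.card_sum, Fintype.card_fin]; omega
  have ht' : PolyCard fun l => Fin (O.t l) := .fin ht
  have hcd : ∀ l d x, ((c l).hard d).eval x = f l (Sum.elim d (x ∘ eι l)) ∘ (eκ l).symm := by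
    intro l d x
    rw [BCirc.hard_eval, hc]
    refine congrArg (fun w => f l w ∘ (eκ l).symm) ?_
    funext i
    rcases i with i | i <;> rfl
  refine ⟨⟨O.r, O.t, hr, ht,
    fun l z => (O.Obf l).eval (Sum.elim ((c l).hard (z ∘ Sum.inl)).encode (z ∘ Sum.inr)),
    fun l z => (O.Eval l).eval (Sum.elim (z ∘ Sum.inl) ((z ∘ Sum.inr) ∘ (eι l).symm)) ∘ eκ l,
    ?_, ?_, ?_, ?_⟩⟩
  · exact (PC.of_pt O.obf_pt).comp
      (((PC.hard_encode hn'.poly hm'.poly hδ hs c).map_in fun l => Sum.inl).pair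
        (PC.wires fun l _ => Sum.inr))
  · exact ((PC.of_pt O.eval_pt).comp ((PC.wires fun l _ => Sum.inl).pair
      (PC.wires fun l _ => Sum.inr ∘ (eι l).symm))).map_out fun l => eκ l
  · intro l d ω x
    simp only [Sum.elim_comp_inl, Sum.elim_comp_inr]
    rw [hO, hcd]
    simp [Function.comp_assoc]
  · intro H _ P hP
    let X : ℕ → Type := fun l => {p : H l × Bits (δ l) × Bits (δ l) //
      ∀ x, f l (Sum.elim p.2.1 x) = f l (Sum.elim p.2.2 x)}
    have : ∀ l, Nonempty (X l) := fun l =>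
      ⟨⟨(Classical.arbitrary _, fun _ => false, fun _ => false), fun _ => rfl⟩⟩
    let val : ∀ l, X l → ℝ := fun l p =>
      |(𝔼 ω : Bits (Fin (O.r l)), P l p.1.1
          ((O.Obf l).eval (Sum.elim ((c l).hard p.1.2.1).encode ω))) -
        𝔼 ω : Bits (Fin (O.r l)), P l p.1.1
          ((O.Obf l).eval (Sum.elim ((c l).hard p.1.2.2).encode ω))|
    obtain ⟨ν, hν, h0, h⟩ := exists_negligible_forall_le val
      (fun l p => abs_sub_le_one
        (expect_nonneg_le_one (fun _ => hP.nonneg _ _ _) fun _ => hP.le_one _ _ _)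
        (expect_nonneg_le_one (fun _ => hP.nonneg _ _ _) fun _ => hP.le_one _ _ _)) (by
      intro x
      obtain ⟨A, hA, hAP⟩ := (hP.pre (χ' := fun l => Fin (O.t l) ⊕
          (Desc (Fin (n l)) (Fin (m l)) (s' l) ⊕ Desc (Fin (n l)) (Fin (m l)) (s' l)))
        (PC.wires fun l _ => Sum.inl)).exists_qpt fun l => (x l).1.1
      obtain ⟨ν, hν, h⟩ := hsec A hA
      refine ⟨ν, hν, h.mono fun l hl => ?_⟩
      have := hl ((c l).hard (x l).1.2.1) ((c l).hard (x l).1.2.2) fun z => by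
        rw [hcd, hcd, (x l).2]
      simp only [ObfScheme.acceptProb, hAP, Sum.elim_comp_inl] at this
      exact this)
    refine ⟨ν, hν, h0, fun l a d₀ d₁ hd => ?_⟩
    simp only [Sum.elim_comp_inl, Sum.elim_comp_inr]
    exact h l ⟨(a, d₀, d₁), hd⟩

/-! ### Averages -/

section

variable {ι κ Y A B : Type*} [Fintype ι] [DecidableEq ι] [Fintype κ] [DecidableEq κ] [Fintype Y]
  [Fintype A] [Fintype B]

lemma expect_prod (g : A × B → ℝ) : 𝔼 p, g p = 𝔼 a, 𝔼 b, g (a, b) := by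
  rw [← Finset.univ_product_univ, Finset.expect_product]

lemma expect_comm (g : A → B → ℝ) : 𝔼 a, 𝔼 b, g a b = 𝔼 b, 𝔼 a, g a b := Finset.expect_comm _ _ _

/-- One coordinate can be resampled. -/
lemma expect_update (i : ι) (g : (ι → Y) → ℝ) :
    𝔼 u, g u = 𝔼 u, 𝔼 b, g (Function.update u i b) := by
  rcases isEmpty_or_nonempty Y with hY | hY
  · have : IsEmpty (ι → Y) := ⟨fun u => hY.elim (u i)⟩
    rw [Finset.univ_eq_empty, Finset.expect_empty, Finset.expect_empty]
  have h : ∀ g : (ι → Y) → ℝ, 𝔼 u, g u = 𝔼 v : {j // j ≠ i} → Y, 𝔼 b : Y,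
      g ((Equiv.funSplitAt i Y).symm (b, v)) := fun g => by
    rw [Fintype.expect_equiv (Equiv.funSplitAt i Y) g
      (fun p => g ((Equiv.funSplitAt i Y).symm p)) (fun u => by rw [Equiv.symm_apply_apply]),
      expect_prod, expect_comm]
  rw [h, h fun u => 𝔼 b, g (Function.update u i b)]
  refine Finset.expect_congr rfl fun v _ => ?_
  have h' : ∀ b b', Function.update ((Equiv.funSplitAt i Y).symm (b', v)) i b =
      (Equiv.funSplitAt i Y).symm (b, v) := by
    intro b b'
    funext j
    by_cases hj : j = i
    · subst hj; simp [Equiv.funSplitAt]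
    · simp [Equiv.funSplitAt, hj]
  simp only [h', Fintype.expect_const]

lemma expect_eval [Nonempty Y] (i : ι) (g : Y → ℝ) : 𝔼 u : ι → Y, g (u i) = 𝔼 b, g b := by
  rw [expect_update i]
  simp

/-- Two independent strings. -/
lemma expect_sum (g : (ι ⊕ κ → Y) → ℝ) :
    𝔼 u, g u = 𝔼 x : ι → Y, 𝔼 y : κ → Y, g (Sum.elim x y) := by
  rw [Fintype.expect_equiv (Equiv.sumArrowEquivProdArrow ι κ Y) g
    (fun p => g (Sum.elim p.1 p.2)) (fun u => by
      simp [Equiv.sumArrowEquivProdArrow, Sum.elim_comp_inl_inr]), expect_prod]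

lemma abs_expect_sub_le [Nonempty A] {f g : A → ℝ} {ε : ℝ} (h : ∀ a, |f a - g a| ≤ ε) :
    |𝔼 a, f a - 𝔼 a, g a| ≤ ε := by
  rw [← Finset.expect_sub_distrib]
  refine (Finset.abs_expect_le _ _).trans ?_
  exact Finset.expect_le Finset.univ_nonempty fun a _ => h a

end

/-! ### Pseudorandom functions with one output bit -/

/-- A puncturable pseudorandom function family with outputs of one bit. The keys are the random
bits of key generation and of puncturing, so that puncturing is deterministic. -/
structure BitPRF where
  n : ℕ → ℕ
  /-- key length -/
  r : ℕ → ℕ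
  /-- length of punctured keys -/
  κ : ℕ → ℕ
  n_poly : PolyBdd n
  r_poly : PolyBdd r
  κ_poly : PolyBdd κ
  n_large : Negligible fun l => ((2 : ℝ) ^ n l)⁻¹
  f : ∀ l, Bits (Fin (r l) ⊕ Fin (n l)) → Bool
  punct : ∀ l, Bits (Fin (r l) ⊕ Fin (n l)) → Bits (Fin (κ l))
  fp : ∀ l, Bits (Fin (κ l) ⊕ Fin (n l)) → Bool
  f_pb : PB fun l (_ : Unit) => f l
  punct_pc : PC fun l (_ : Unit) => punct l
  fp_pb : PB fun l (_ : Unit) => fp l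
  correct : ∀ l ω x x', x' ≠ x →
    fp l (Sum.elim (punct l (Sum.elim ω x)) x') = f l (Sum.elim ω x')
  secure : ∀ (H : ℕ → Type) [∀ l, Nonempty (H l)] (P : ∀ l, H l → Bits (Fin (κ l) ⊕ Unit) → ℝ),
    PP P → ∃ ν : ℕ → ℝ, Negligible ν ∧ (∀ l, 0 ≤ ν l) ∧ ∀ l h x,
      |(𝔼 ω, P l h (Sum.elim (punct l (Sum.elim ω x)) fun _ => f l (Sum.elim ω x))) -
        𝔼 ω, 𝔼 u : Bool, P l h (Sum.elim (punct l (Sum.elim ω x)) fun _ => u)| ≤ ν l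

lemma prepare_eq {κ : Type} [Fintype κ] (A : QCirc Empty κ) :
    A.prepare = A.run (basis Empty.elim) := by
  rw [QCirc.prepare]
  congr 1

lemma measL_basis {ι κ : Type} [Fintype ι] [DecidableEq ι] [Fintype κ] [DecidableEq κ]
    (a x : Bits ι) (y : Bits κ) :
    measL a (basis (Sum.elim x y)) = if a = x then basis y else 0 := by
  have h : ∀ z, Sum.elim x y = Sum.elim a z ↔ x = a ∧ y = z := fun z => by
    rw [Sum.elim_eq_iff]
  ext z z'
  simp only [measL, Matrix.of_apply, basis, Matrix.single_apply, h]
  by_cases hx : x = a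
  · simp [hx, Matrix.single_apply]
  · simp [hx, Ne.symm hx]

lemma tensor_zero_left {ι κ : Type} (σ : Op κ) : tensor (0 : Op ι) σ = 0 := by
  ext; simp [tensor]

lemma QCirc.run_zero {ι κ : Type} [Fintype ι] [DecidableEq ι] [Fintype κ] [DecidableEq κ] (A : QCirc ι κ) :
    A.run 0 = 0 := by
  have h := A.run_smul 0 0
  rwa [smul_zero, zero_smul] at h

/-- The first bit, or `false` if there is none. -/
def headBit {n : ℕ} (y : Bits (Fin n)) : Bool := if h : 0 < n then y ⟨0, h⟩ else false

lemma headBit_pb {H : ℕ → Type*} {n : ℕ → ℕ} :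
    PB fun l (_ : H l) (y : Bits (Fin (n l))) => headBit y := by
  refine ⟨_, .const 3, fun l _ => ?_⟩
  by_cases h : 0 < n l
  · simp only [headBit, h, dif_pos]
    exact (Cx.wires fun _ : Unit => (⟨0, h⟩ : Fin (n l))).mono (by omega)
  · simp only [headBit, h, dif_neg, not_false_eq_true]
    exact Cx.const _

lemma expect_headBit {n : ℕ} (hn : 0 < n) (g : Bool → ℝ) :
    𝔼 u : Bits (Fin n), g (headBit u) = 𝔼 b, g b := by
  simp only [headBit, hn, dif_pos]
  exact expect_eval (⟨0, hn⟩ : Fin n) g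

lemma expect_finSum {a b : ℕ} (g : Bits (Fin (a + b)) → ℝ) :
    𝔼 ω, g ω = 𝔼 x : Bits (Fin a), 𝔼 y : Bits (Fin b), g (Sum.elim x y ∘ finSumFinEquiv.symm) := by
  rw [← expect_sum fun w : Bits (Fin a ⊕ Fin b) => g (w ∘ finSumFinEquiv.symm)]
  refine Fintype.expect_equiv (finSumFinEquiv.symm.arrowCongr (Equiv.refl Bool)) _ _ fun u => ?_
  congr 1
  funext i
  simp [Equiv.arrowCongr]

/-- The first output bit of the given function family is used, and keys are punctured at the same
point twice. The adversary sends a hardwired point, which yields a bound uniform in the point. -/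
lemma nonempty_bitPRF (hPRF : ExistsPunctPRF) : Nonempty BitPRF := by
  obtain ⟨F, hneg, hcor, hsec⟩ := hPRF
  have hn : PolyBdd F.n := PolyBdd.mono F.eval_pt fun l => by
    simp only [BAlg.size, Fintype.card_sum, Fintype.card_fin]; omega
  have hκp : PolyBdd F.κp := PolyBdd.mono F.evalPunct_pt fun l => by
    simp only [BAlg.size, Fintype.card_sum, Fintype.card_fin]; omega
  have hrg : PolyBdd F.rg := PolyBdd.mono F.gen_pt fun l => by
    simp only [BAlg.size, Fintype.card_fin]; omega
  have hrp : PolyBdd F.rp := PolyBdd.mono F.puncture_pt fun l => by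
    simp only [BAlg.size, Fintype.card_sum, Fintype.card_fin]; omega
  -- the key of the function, from the random bits
  let key : ∀ l, Bits (Fin (F.rg l + F.rp l)) → Bits (Fin (F.κ l)) := fun l ω =>
    (F.Gen l).eval (ω ∘ fun i => finSumFinEquiv (Sum.inl i))
  let pk : ∀ l, Bits (Fin (F.rg l + F.rp l)) → Bits (Fin (F.n l)) → Bits (Fin (F.κp l)) :=
    fun l ω x => F.punctKey l (key l ω) x x (ω ∘ fun i => finSumFinEquiv (Sum.inr i))
  have hkey : PC fun l (_ : Unit) (z : Bits (Fin (F.rg l + F.rp l) ⊕ Fin (F.n l))) =>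
      key l (z ∘ Sum.inl) :=
    (PC.of_pt F.gen_pt).comp (PC.wires fun l _ i => Sum.inl (finSumFinEquiv (Sum.inl i)))
  have hcn : PolyCard fun l => Fin (F.n l) := .fin hn
  have hcκ : PolyCard fun l => Fin (F.κp l) := .fin hκp
  refine ⟨⟨F.n, fun l => F.rg l + F.rp l, F.κp, hn, hrg.add hrp, hκp, hneg,
    fun l z => headBit (F.fn l (key l (z ∘ Sum.inl)) (z ∘ Sum.inr)),
    fun l z => pk l (z ∘ Sum.inl) (z ∘ Sum.inr),
    fun l z => headBit ((F.EvalPunct l).eval z), ?_, ?_, ?_, ?_, ?_⟩⟩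
  · exact headBit_pb.comp ((PC.of_pt F.eval_pt).comp (hkey.pair (PC.wires fun l _ => Sum.inr)))
  · exact (PC.of_pt F.puncture_pt).comp ((hkey.pair ((PC.wires fun l _ => Sum.inr).pair
      (PC.wires fun l _ => Sum.inr))).pair
        (PC.wires fun l _ i => Sum.inl (finSumFinEquiv (Sum.inr i))))
  · exact headBit_pb.comp (PC.of_pt F.evalPunct_pt)
  · intro l ω x x' hx
    simp only [Sum.elim_comp_inl, Sum.elim_comp_inr]
    exact congrArg headBit (hcor l _ _ x x x' hx hx)
  · intro H _ P hP
    simp only [Sum.elim_comp_inl, Sum.elim_comp_inr]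
    let val : ∀ l, H l × Bits (Fin (F.n l)) → ℝ := fun l p =>
      |(𝔼 ω, P l p.1 (Sum.elim (pk l ω p.2) fun _ => headBit (F.fn l (key l ω) p.2))) -
        𝔼 ω, 𝔼 u : Bool, P l p.1 (Sum.elim (pk l ω p.2) fun _ => u)|
    obtain ⟨ν, hν, h0, h⟩ := exists_negligible_forall_le val
      (fun l p => abs_sub_le_one
        (expect_nonneg_le_one (fun _ => hP.nonneg _ _ _) fun _ => hP.le_one _ _ _)
        (expect_nonneg_le_one
          (fun _ => (expect_nonneg_le_one (fun _ => hP.nonneg _ _ _) fun _ => hP.le_one _ _ _).1)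
          fun _ => (expect_nonneg_le_one (fun _ => hP.nonneg _ _ _)
            fun _ => hP.le_one _ _ _).2)) (by
      intro a
      obtain ⟨A₁, hA₁, hA₁S⟩ := PS.exists_qpt (H := fun l => H l × Bits (Fin (F.n l)))
        (χ := fun _ => Empty) (κ := fun l => (Fin (F.n l) ⊕ Fin (F.n l)) ⊕ Fin 0)
        (PS.of_pc (PC.const fun l h => Sum.elim (Sum.elim h.2 h.2) Fin.elim0)) a
      obtain ⟨A₂, hA₂, hA₂P⟩ := (hP.pre (χ' := fun l => Fin 0 ⊕ ((Fin (F.n l) ⊕ Fin (F.n l)) ⊕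
          (Fin (F.κp l) ⊕ (Fin (F.n l) ⊕ Fin (F.n l)))))
        ((PC.wires fun l _ i => Sum.inr (Sum.inr (Sum.inl i))).pair
          (headBit_pb.comp (PC.wires fun l _ i => Sum.inr (Sum.inr (Sum.inr (Sum.inl i))))))).exists_qpt
        fun l => (a l).1
      obtain ⟨ν, hν, h⟩ := hsec ⟨fun _ => 0, A₁, A₂, hA₁, hA₂⟩
      refine ⟨ν, hν, ?_⟩
      -- outputs of length zero have no first bit
      have hpos : ∀ᶠ l in Filter.atTop, 0 < F.n l := by
        filter_upwards [hneg.eventually_lt_one] with l hl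
        rcases Nat.eq_zero_or_pos (F.n l) with h0 | h0
        · rw [h0] at hl; norm_num at hl
        · exact h0
      filter_upwards [hpos] with l hl
      refine le_trans (le_of_eq ?_) (h l)
      -- only the hardwired points contribute to the sums over the messages of the adversary
      have hacc : ∀ x₁ x₂ kp y₁ y₂, PunctPRF.Adversary.acceptProb (F := F)
          ⟨fun _ => 0, A₁, A₂, hA₁, hA₂⟩ l x₁ x₂ kp y₁ y₂ =
          if x₁ = (a l).2 ∧ x₂ = (a l).2 then
            P l (a l).1 (Sum.elim kp fun _ => headBit y₁) else 0 := by
        intro x₁ x₂ kp y₁ y₂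
        have hx : Sum.elim x₁ x₂ = Sum.elim (a l).2 (a l).2 ↔ x₁ = (a l).2 ∧ x₂ = (a l).2 := by
          rw [Sum.elim_eq_iff]
        rw [PunctPRF.Adversary.acceptProb, prepare_eq, hA₁S, measL_basis]
        simp only [hx]
        split_ifs
        · rw [tensor_basis, hA₂P]
          rfl
        · rw [tensor_zero_left, QCirc.run_zero]
          simp [prob]
      have hsum : ∀ (g : Bits (Fin (F.n l)) → Bits (Fin (F.n l)) → ℝ),
          (∀ x₁ x₂, ¬(x₁ = (a l).2 ∧ x₂ = (a l).2) → g x₁ x₂ = 0) →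
          ∑ x₁, ∑ x₂, g x₁ x₂ = g (a l).2 (a l).2 := by
        intro g hg
        rw [Finset.sum_eq_single (a l).2, Finset.sum_eq_single (a l).2]
        · exact fun b _ hb => hg _ _ fun h => hb h.2
        · simp
        · exact fun b _ hb => Finset.sum_eq_zero fun c _ => hg _ _ fun h => hb h.1
        · simp
      simp only [val, PunctPRF.Adversary.realProb, PunctPRF.Adversary.idealProb, hacc]
      rw [hsum, hsum]
      · congr 2
        · rw [expect_finSum]
          simp only [and_self, if_true]
          refine Finset.expect_congr rfl fun ωg _ => Finset.expect_congr rfl fun ωp _ => ?_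
          simp [pk, key, Function.comp_def]
        · rw [expect_finSum]
          simp only [and_self, if_true, Fintype.expect_const]
          refine Finset.expect_congr rfl fun ωg _ => Finset.expect_congr rfl fun ωp _ => ?_
          rw [expect_headBit hl fun b => P l (a l).1 (Sum.elim _ fun _ => b)]
          simp [pk, key, Function.comp_def]
      · intro x₁ x₂ hx; simp [hx]
      · intro x₁ x₂ hx; simp [hx])
    exact ⟨ν, hν, h0, fun l a x => h l (a, x)⟩

/-! ### Hybrid arguments -/

/-- If one coordinate at a time can be replaced at a cost of `ε`, then all of them can. -/
lemma abs_expect_comp_sub_le {ι A B Y : Type*} [Fintype ι] [DecidableEq ι] [Fintype A] [Nonempty A]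
    [Fintype B] [Nonempty B] (g₀ : A → Y) (g₁ : B → Y) (Φ : (ι → Y) → ℝ) {ε : ℝ}
    (h : ∀ i w, |(𝔼 a, Φ (Function.update w i (g₀ a))) -
      𝔼 b, Φ (Function.update w i (g₁ b))| ≤ ε) :
    |(𝔼 a : ι → A, Φ fun i => g₀ (a i)) - 𝔼 b : ι → B, Φ fun i => g₁ (b i)| ≤
      Fintype.card ι * ε := by
  let mix : Finset ι → (ι → A) → (ι → B) → ι → Y := fun S a b i =>
    if i ∈ S then g₁ (b i) else g₀ (a i)
  have key : ∀ S : Finset ι, |(𝔼 a, 𝔼 b, Φ (mix ∅ a b)) - 𝔼 a, 𝔼 b, Φ (mix S a b)| ≤ S.card * ε := by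
    intro S
    induction S using Finset.induction_on with
    | empty => simp
    | insert i S hi ih =>
      have h0 : ∀ a b a', mix S (Function.update a i a') b =
          Function.update (mix S a b) i (g₀ a') := by
        intro a b a'
        funext j
        by_cases hj : j = i
        · subst hj; simp [mix, hi]
        · simp [mix, hj]
      have h1 : ∀ a b b', mix (insert i S) a (Function.update b i b') =
          Function.update (mix S a b) i (g₁ b') := by
        intro a b b'
        funext j
        by_cases hj : j = i
        · subst hj; simp [mix]
        · simp [mix, hj]
      have e0 : 𝔼 a, 𝔼 b, Φ (mix S a b) =
          𝔼 a, 𝔼 b, 𝔼 a', Φ (Function.update (mix S a b) i (g₀ a')) := by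
        rw [expect_update i]
        refine Finset.expect_congr rfl fun a _ => ?_
        rw [expect_comm]
        simp only [h0]
      have e1 : 𝔼 a, 𝔼 b, Φ (mix (insert i S) a b) =
          𝔼 a, 𝔼 b, 𝔼 b', Φ (Function.update (mix S a b) i (g₁ b')) := by
        refine Finset.expect_congr rfl fun a _ => ?_
        rw [expect_update i]
        simp only [h1]
      have hstep : |(𝔼 a, 𝔼 b, Φ (mix S a b)) - 𝔼 a, 𝔼 b, Φ (mix (insert i S) a b)| ≤ ε := by
        rw [e0, e1]
        exact abs_expect_sub_le fun a => abs_expect_sub_le fun b => h i _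
      rw [Finset.card_insert_of_notMem hi]
      push_cast
      calc _ ≤ _ := abs_sub_le _ (𝔼 a, 𝔼 b, Φ (mix S a b)) _
        _ ≤ _ := by linarith
  simpa [mix] using key Finset.univ

lemma expect_arrow_prod {ι A B : Type*} [Fintype ι] [DecidableEq ι] [Fintype A] [Fintype B]
    (g : (ι → A × B) → ℝ) : 𝔼 p, g p = 𝔼 a : ι → A, 𝔼 b : ι → B, g fun i => (a i, b i) := by
  rw [Fintype.expect_equiv (Equiv.arrowProdEquivProdArrow ι (fun _ => A) fun _ => B) g
    (fun p => g fun i => (p.1 i, p.2 i)) fun u => rfl, expect_prod]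

/-- A function each of whose bits is constant or a bit of the input. -/
lemma PC.of_bits {H : ℕ → Type*} {ι κ : ℕ → Type} [∀ l, Fintype (κ l)] [PolyCard κ]
    {f : ∀ l, H l → Bits (ι l) → Bits (κ l)}
    (hf : ∀ l h q, (∃ b, ∀ z, f l h z q = b) ∨ ∃ i, ∀ z, f l h z q = z i) : PC f := by
  refine PC.pi PolyCard.poly ⟨_, .const 3, fun l h => ?_⟩
  rcases hf l h.1 h.2 with ⟨b, hb⟩ | ⟨i, hi⟩
  · simp only [hb]
    exact Cx.const _
  · simp only [hi]
    exact (Cx.wires fun _ : Unit => i).mono (by omega)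

namespace BitPRF

variable (F : BitPRF)

instance : PolyCard fun l => Fin (F.n l) := .fin F.n_poly
instance : PolyCard fun l => Fin (F.r l) := .fin F.r_poly
instance : PolyCard fun l => Fin (F.κ l) := .fin F.κ_poly

/-- The keys `K i` punctured at `x`, together with the bits `u i`. -/
def punctAll {I : ℕ → Type} {l : ℕ} (K : I l → Bits (Fin (F.r l))) (x : Bits (Fin (F.n l)))
    (u : Bits (I l)) : Bits ((I l × Fin (F.κ l)) ⊕ I l) :=
  Sum.elim (fun p => F.punct l (Sum.elim (K p.1) x) p.2) u

/-- Pseudorandomness at a punctured point, for several independent keys. -/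
lemma secure_pi {I : ℕ → Type} [∀ l, Fintype (I l)] [∀ l, DecidableEq (I l)] [PolyCard I]
    (H : ℕ → Type) [∀ l, Nonempty (H l)]
    (P : ∀ l, H l → Bits ((I l × Fin (F.κ l)) ⊕ I l) → ℝ) (hP : PP P) :
    ∃ ν : ℕ → ℝ, Negligible ν ∧ (∀ l, 0 ≤ ν l) ∧ ∀ l h x,
      |(𝔼 K, P l h (F.punctAll K x fun i => F.f l (Sum.elim (K i) x))) -
        𝔼 K, 𝔼 u, P l h (F.punctAll K x u)| ≤ ν l := by
  obtain ⟨ν, hν, h0, h⟩ := F.secure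
    (fun l => H l × (I l → Bool) × (I l → Bits (Fin (F.κ l)) × Bool))
    (fun l h z => P l h.1 (Sum.elim
      (fun p => bif h.2.1 p.1 then z (Sum.inl p.2) else (h.2.2 p.1).1 p.2)
      fun i => bif h.2.1 i then z (Sum.inr ()) else (h.2.2 i).2)) (by
    refine PP.pre (hP.reparam fun l (h : H l × (I l → Bool) × _) => h.1) (PC.of_bits ?_)
    rintro l ⟨h, s, w⟩ (⟨i, j⟩ | i)
    · cases hs : s i
      · exact .inl ⟨(w i).1 j, fun z => by simp [hs]⟩
      · exact .inr ⟨Sum.inl j, fun z => by simp [hs]⟩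
    · cases hs : s i
      · exact .inl ⟨(w i).2, fun z => by simp [hs]⟩
      · exact .inr ⟨Sum.inr (), fun z => by simp [hs]⟩)
  refine ⟨fun l => (Fintype.card (I l) : ℕ) * ν l, .poly_mul PolyCard.poly hν,
    fun l => mul_nonneg (Nat.cast_nonneg _) (h0 l), fun l a x => ?_⟩
  have hy := abs_expect_comp_sub_le (ι := I l) (ε := ν l)
    (fun ω : Bits (Fin (F.r l)) => (F.punct l (Sum.elim ω x), F.f l (Sum.elim ω x)))
    (fun ω : Bits (Fin (F.r l)) × Bool => (F.punct l (Sum.elim ω.1 x), ω.2))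
    (fun y => P l a (Sum.elim (fun p => (y p.1).1 p.2) fun i => (y i).2)) (fun i w => by
      have hw := h l (a, fun j => decide (j = i), w) x
      have e : ∀ (kp : Bits (Fin (F.κ l))) (b : Bool),
          (Sum.elim (fun p => bif decide (p.1 = i) then kp p.2 else (w p.1).1 p.2)
            fun j => bif decide (j = i) then b else (w j).2 : Bits ((I l × Fin (F.κ l)) ⊕ I l)) =
          Sum.elim (fun p => (Function.update w i (kp, b) p.1).1 p.2)
            fun j => (Function.update w i (kp, b) j).2 := by
        intro kp b
        funext q
        rcases q with ⟨j, k⟩ | j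
        · by_cases hj : j = i
          · subst hj; simp
          · simp [hj]
        · by_cases hj : j = i
          · subst hj; simp
          · simp [hj]
      simp only [Sum.elim_inl, Sum.elim_inr, e] at hw
      rw [expect_prod]
      exact hw)
  rw [expect_arrow_prod] at hy
  exact hy

/-! ### A pseudorandom generator -/

/-- Output length of the generator. -/
def N (l : ℕ) : ℕ := F.r l + l

lemma N_poly : PolyBdd F.N := F.r_poly.add .id

instance : PolyCard fun l => Fin (F.N l) := .fin F.N_poly

/-- The points at which the generator evaluates the function; they are distinct if there are enough
points. -/
def pt (l : ℕ) : Fin (F.N l) → Bits (Fin (F.n l)) :=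
  open Classical in
  if h : Nonempty (Fin (F.N l) ↪ Bits (Fin (F.n l))) then ⇑(Classical.choice h)
  else fun _ _ => false

lemma eventually_pt_injective : ∀ᶠ l in Filter.atTop, Function.Injective (F.pt l) := by
  filter_upwards [(Negligible.poly_mul F.N_poly F.n_large).eventually_lt_one] with l hl
  have hN : F.N l ≤ 2 ^ F.n l := by
    have h2 : (0 : ℝ) < 2 ^ F.n l := by positivity
    rw [← div_eq_mul_inv, div_lt_one h2] at hl
    exact_mod_cast hl.le
  have hne : Nonempty (Fin (F.N l) ↪ Bits (Fin (F.n l))) :=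
    Function.Embedding.nonempty_of_card_le (by simpa using hN)
  rw [pt, dif_pos hne]
  exact Function.Embedding.injective _

/-- A length-extending pseudorandom generator. -/
def G (l : ℕ) (ω : Bits (Fin (F.r l))) : Bits (Fin (F.N l)) :=
  fun j => F.f l (Sum.elim ω (F.pt l j))

lemma G_pc {H : ℕ → Type} : PC fun l (_ : H l) => F.G l :=
  PC.pi PolyCard.poly
    ((F.f_pb.reparam fun _ _ => ()).comp (PC.id.pair (PC.const fun l (h : H l × Fin (F.N l)) => F.pt l h.2)))

/-- Puncturing at the points one after the other makes the outputs uniform: the values at the other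
points can be computed from a punctured key. -/
lemma G_secure (H : ℕ → Type) [∀ l, Nonempty (H l)] (P : ∀ l, H l → Bits (Fin (F.N l)) → ℝ)
    (hP : PP P) : ∃ ν : ℕ → ℝ, Negligible ν ∧ (∀ l, 0 ≤ ν l) ∧ ∀ l h,
      |(𝔼 ω, P l h (F.G l ω)) - 𝔼 u, P l h u| ≤ ν l := by
  obtain ⟨ν, hν, h0, h⟩ := F.secure (fun l => H l × ℕ × Bits (Fin (F.N l)))
    (fun l h z => P l h.1 fun i => bif decide ((i : ℕ) < h.2.1) then h.2.2 i else
      bif decide ((i : ℕ) = h.2.1) then z (Sum.inr ()) else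
        F.fp l (Sum.elim (z ∘ Sum.inl) (F.pt l i))) (by
    refine PP.pre (hP.reparam fun l (h : H l × ℕ × Bits (Fin (F.N l))) => h.1)
      (PC.pi PolyCard.poly ?_)
    refine PB.cond
      (PB.const fun l (h : (H l × ℕ × Bits (Fin (F.N l))) × Fin (F.N l)) => decide ((h.2 : ℕ) < h.1.2.1))
      (PB.const _)
      (PB.cond
        (PB.const fun l (h : (H l × ℕ × Bits (Fin (F.N l))) × Fin (F.N l)) =>
          decide ((h.2 : ℕ) = h.1.2.1)) (PB.var fun _ _ => Sum.inr ())
      ((F.fp_pb.reparam fun _ _ => ()).comp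
        ((PC.wires fun _ _ => Sum.inl).pair
          (PC.const fun l (h : (H l × ℕ × Bits (Fin (F.N l))) × Fin (F.N l)) => F.pt l h.2)))))
  -- without enough points the trivial bound is used
  refine ⟨fun l => open Classical in if Function.Injective (F.pt l) then F.N l * ν l else 1,
    (Negligible.poly_mul F.N_poly hν).congr_eventually (F.eventually_pt_injective.mono
      fun l hl => by simp [hl]), fun l => ?_, fun l a => ?_⟩
  · dsimp only
    split_ifs
    · exact mul_nonneg (Nat.cast_nonneg _) (h0 l)
    · exact zero_le_one
  dsimp only
  split_ifs with hinj
  swap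
  · exact abs_sub_le_one (expect_nonneg_le_one (fun _ => hP.nonneg _ _ _) fun _ => hP.le_one _ _ _)
      (expect_nonneg_le_one (fun _ => hP.nonneg _ _ _) fun _ => hP.le_one _ _ _)
  let mix : ℕ → Bits (Fin (F.N l)) → Bits (Fin (F.r l)) → Bits (Fin (F.N l)) := fun j u ω i =>
    bif decide ((i : ℕ) < j) then u i else F.G l ω i
  have key : ∀ j ≤ F.N l,
      |(𝔼 u, 𝔼 ω, P l a (mix 0 u ω)) - 𝔼 u, 𝔼 ω, P l a (mix j u ω)| ≤ j * ν l := by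
    intro j hj
    induction j with
    | zero => simp
    | succ j ih =>
      have hstep : |(𝔼 u, 𝔼 ω, P l a (mix j u ω)) - 𝔼 u, 𝔼 ω, P l a (mix (j + 1) u ω)| ≤ ν l := by
        rw [expect_update ⟨j, hj⟩ fun u => 𝔼 ω, P l a (mix (j + 1) u ω)]
        refine abs_expect_sub_le fun u => ?_
        rw [expect_comm]
        convert h l (a, j, u) (F.pt l ⟨j, hj⟩) using 4 with ω _ ω _
        · congr 1
          funext i
          simp only [mix, G, Sum.elim_comp_inl, Sum.elim_inr]
          by_cases hi : (i : ℕ) = j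
          · have : i = ⟨j, hj⟩ := Fin.ext hi
            subst this
            simp
          · have hne : F.pt l i ≠ F.pt l ⟨j, hj⟩ := fun e => hi (congrArg Fin.val (hinj e))
            simp [hi, F.correct _ _ _ _ hne]
        · refine Finset.expect_congr rfl fun b _ => ?_
          congr 1
          funext i
          simp only [mix, G, Sum.elim_comp_inl, Sum.elim_inr]
          by_cases hi : (i : ℕ) = j
          · have : i = ⟨j, hj⟩ := Fin.ext hi
            subst this
            simp
          · have hne : F.pt l i ≠ F.pt l ⟨j, hj⟩ := fun e => hi (congrArg Fin.val (hinj e))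
            have hi' : i ≠ ⟨j, hj⟩ := fun e => hi (congrArg Fin.val e)
            by_cases hlt : (i : ℕ) < j
            · simp [hi', hlt, Nat.lt_succ_of_lt hlt]
            · have : ¬ (i : ℕ) < j + 1 := by omega
              simp [hi, hlt, this, F.correct _ _ _ _ hne]
      have := ih (by omega)
      push_cast
      calc _ ≤ _ := abs_sub_le _ (𝔼 u, 𝔼 ω, P l a (mix j u ω)) _
        _ ≤ _ := by linarith
  have := key _ le_rfl
  simpa [mix] using this

/-- The generator applied to several seeds. -/
def GAll {I : ℕ → Type} {l : ℕ} (s : I l → Bits (Fin (F.r l))) : Bits (I l × Fin (F.N l)) :=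
  fun p => F.G l (s p.1) p.2

lemma GAll_secure {I : ℕ → Type} [∀ l, Fintype (I l)] [∀ l, DecidableEq (I l)] [PolyCard I]
    (H : ℕ → Type) [∀ l, Nonempty (H l)]
    (P : ∀ l, H l → Bits (I l × Fin (F.N l)) → ℝ) (hP : PP P) :
    ∃ ν : ℕ → ℝ, Negligible ν ∧ (∀ l, 0 ≤ ν l) ∧ ∀ l h,
      |(𝔼 s, P l h (F.GAll s)) -
        𝔼 u : I l → Bits (Fin (F.N l)), P l h fun p => u p.1 p.2| ≤ ν l := by
  obtain ⟨ν, hν, h0, h⟩ := F.G_secure (fun l => H l × (I l → Bool) × (I l → Bits (Fin (F.N l))))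
    (fun l h z => P l h.1 fun p => bif h.2.1 p.1 then z p.2 else h.2.2 p.1 p.2) (by
    refine PP.pre (hP.reparam fun l (h : H l × (I l → Bool) × _) => h.1) (PC.of_bits ?_)
    rintro l ⟨h, s, w⟩ ⟨i, j⟩
    cases hs : s i
    · exact .inl ⟨w i j, fun z => by simp [hs]⟩
    · exact .inr ⟨j, fun z => by simp [hs]⟩)
  refine ⟨fun l => (Fintype.card (I l) : ℕ) * ν l, .poly_mul PolyCard.poly hν,
    fun l => mul_nonneg (Nat.cast_nonneg _) (h0 l), fun l a => ?_⟩
  refine abs_expect_comp_sub_le (ι := I l) (F.G l) (fun u => u)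
    (fun y => P l a fun p => y p.1 p.2) (fun i w => ?_)
  have hw := h l (a, fun j => decide (j = i), w)
  have e : ∀ y : Bits (Fin (F.N l)), (fun p : I l × Fin (F.N l) =>
      bif decide (p.1 = i) then y p.2 else w p.1 p.2) = fun p => Function.update w i y p.1 p.2 := by
    intro y
    funext p
    by_cases hj : p.1 = i
    · simp [hj]
    · simp [hj]
  simp only [e] at hw
  exact hw

end BitPRF

namespace BitPRF

variable (F : BitPRF) {W : ℕ → Type} [∀ l, Fintype (W l)] [∀ l, DecidableEq (W l)]

/-! ### Locks and lossy public keys -/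

/-- The bits of a public key: two outputs of the generator for each index in `W`. -/
abbrev PKey (W : ℕ → Type) (l : ℕ) : Type := (W l × Bool) × Fin (F.N l)

/-- The bits of a secret key: a string `v` and a seed for each index in `W`. -/
abbrev SKey (W : ℕ → Type) (l : ℕ) : Type := W l ⊕ (W l × Fin (F.r l))

/-- The data of a lock: a public key, a string and a flag. -/
abbrev LockData (W : ℕ → Type) (l : ℕ) : Type := F.PKey W l ⊕ (W l ⊕ Unit)

/-- The lock with public key `pk`, string `y` and flag `a`. If the input is a valid secret key
`(v, s)`, that is, if the seeds `s` expand to the parts of `pk` selected by `v`, then the output is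
`y`, or `y ⊕ v` if the flag is set; otherwise it is zero. -/
def lock (l : ℕ) (z : Bits (F.LockData W l ⊕ F.SKey W l)) : Bits (W l) := fun w =>
  bif decide (∀ p : W l × Fin (F.N l), (F.G l (fun j => z (Sum.inr (Sum.inr (p.1, j)))) p.2 ==
      bif z (Sum.inr (Sum.inl p.1)) then z (Sum.inl (Sum.inl ((p.1, true), p.2)))
        else z (Sum.inl (Sum.inl ((p.1, false), p.2)))) = true)
  then Bool.xor (z (Sum.inl (Sum.inr (Sum.inl w))))
    (z (Sum.inl (Sum.inr (Sum.inr ()))) && z (Sum.inr (Sum.inl w)))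
  else false

lemma lock_pc [PolyCard W] : PC fun l (_ : Unit) => F.lock (W := W) l := by
  refine PC.pi PolyCard.poly (PB.cond (PB.all PolyCard.poly (PB.beq ?_ (PB.cond (PB.var _)
    (PB.var _) (PB.var _)))) (PB.xor (PB.var _) (PB.and (PB.var _) (PB.var _))) (PB.const _))
  exact PB.apply (F.G_pc.comp (PC.wires
    fun l (h : (Unit × W l) × (W l × Fin (F.N l))) j => Sum.inr (Sum.inr (h.2.1, j))))
    fun l h => h.2.2

variable {F}

/-- The public key with the seeds `s`. -/
def pkOf {l : ℕ} (s : W l → Bool → Bits (Fin (F.r l))) : Bits (F.PKey W l) :=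
  fun p => F.G l (s p.1.1 p.1.2) p.2

/-- The secret key that consists of `v` and the seeds selected by `v`. -/
def skOf {l : ℕ} (s : W l → Bool → Bits (Fin (F.r l))) (v : Bits (W l)) : Bits (F.SKey W l) :=
  Sum.elim v fun p => s p.1 (v p.1) p.2

lemma lock_eq {l : ℕ} (pk : Bits (F.PKey W l)) (y v : Bits (W l)) (a : Bool)
    (s : W l → Bits (Fin (F.r l))) (w : W l) :
    F.lock l (Sum.elim (Sum.elim pk (Sum.elim y fun _ => a)) (Sum.elim v fun p => s p.1 p.2)) w =
      bif decide (∀ i, F.G l (s i) = fun j => pk ((i, v i), j)) then Bool.xor (y w) (a && v w)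
      else false := by
  refine congrArg (fun c => bif c then Bool.xor (y w) (a && v w) else false)
    (decide_eq_decide.2 ?_)
  simp only [Sum.elim_inr, Sum.elim_inl]
  constructor
  · intro h i
    funext j
    have := h (i, j)
    cases hv : v i <;> simpa [hv] using this
  · rintro h ⟨i, j⟩
    have := congrFun (h i) j
    cases hv : v i <;> simpa [hv] using this

lemma lock_correct {l : ℕ} (s : W l → Bool → Bits (Fin (F.r l))) (y v : Bits (W l)) :
    F.lock l (Sum.elim (Sum.elim (pkOf s) (Sum.elim y fun _ => false)) (skOf s v)) = y := by
  funext w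
  have h := lock_eq (pkOf s) y v false (fun i => s i (v i)) w
  rw [skOf, h]
  simp [pkOf]

/-- The public key in which the parts not selected by `v` are replaced by `U`. -/
def pkMix {l : ℕ} (v : Bits (W l)) (a : W l → Bits (Fin (F.r l)))
    (U : Bits (W l × Fin (F.N l))) : Bits (F.PKey W l) :=
  fun p => if p.1.2 = v p.1.1 then F.G l (a p.1.1) p.2 else U (p.1.1, p.2)

/-- For a public key whose parts not selected by `v` are outside of the image of the generator, the
only valid `v` is the right one. -/
lemma lock_pkMix {l : ℕ} (v y : Bits (W l)) (a : W l → Bits (Fin (F.r l)))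
    (U : W l → Bits (Fin (F.N l))) (hU : ∀ i b, F.G l b ≠ U i) (x : Bits (F.SKey W l)) :
    F.lock l (Sum.elim (Sum.elim (pkMix v a fun p => U p.1 p.2) (Sum.elim y fun _ => false)) x) =
      F.lock l (Sum.elim (Sum.elim (pkMix v a fun p => U p.1 p.2)
        (Sum.elim (fun i => Bool.xor (y i) (v i)) fun _ => true)) x) := by
  funext w
  obtain ⟨v', s', rfl⟩ : ∃ (v' : Bits (W l)) (s' : W l → Bits (Fin (F.r l))),
      x = Sum.elim v' fun p => s' p.1 p.2 :=
    ⟨x ∘ Sum.inl, fun i j => x (Sum.inr (i, j)), by funext i; rcases i with i | i <;> rfl⟩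
  rw [lock_eq, lock_eq]
  by_cases h : ∀ i, F.G l (s' i) =
      fun j => (pkMix v a (fun p => U p.1 p.2) : Bits (F.PKey W l)) ((i, v' i), j)
  · have hv : v' = v := by
      funext i
      by_contra hi
      refine hU i (s' i) ((h i).trans ?_)
      funext j
      simp [pkMix, hi]
    rw [hv] at h ⊢
    rw [decide_eq_true h]
    simp
  · rw [decide_eq_false h]
    rfl

/-- The seeds selected by `v` and the other ones are independent. -/
lemma expect_seeds {I Y : Type*} [Fintype I] [DecidableEq I] [Fintype Y] (v : I → Bool)
    (g : (I → Bool → Y) → ℝ) :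
    𝔼 s, g s = 𝔼 a : I → Y, 𝔼 b : I → Y, g fun i β => if β = v i then a i else b i := by
  rw [← expect_prod fun p : (I → Y) × (I → Y) => g fun i β => if β = v i then p.1 i else p.2 i]
  refine Fintype.expect_equiv
    ⟨fun s => (fun i => s i (v i), fun i => s i (!v i)),
      fun p i β => if β = v i then p.1 i else p.2 i, fun s => ?_, fun p => ?_⟩ _ _ fun s => ?_
  · funext i β
    cases hv : v i <;> cases β <;> simp [hv]
  · ext i <;> simp
  · congr 1
    funext i β
    cases hv : v i <;> cases β <;> simp [hv]

/-- A uniform string is in the image of the generator with probability at most `2 ^ (-l)`. -/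
lemma expect_bad_le {l : ℕ} :
    𝔼 U : W l → Bits (Fin (F.N l)),
      (if ∃ i b, F.G l b = U i then (1 : ℝ) else 0) ≤ Fintype.card (W l) * ((2 : ℝ) ^ l)⁻¹ := by
  have h1 : ∀ U : W l → Bits (Fin (F.N l)), (if ∃ i b, F.G l b = U i then (1 : ℝ) else 0) ≤
      ∑ i, ∑ b, if F.G l b = U i then (1 : ℝ) else 0 := by
    intro U
    have hn : ∀ i, 0 ≤ ∑ b, if F.G l b = U i then (1 : ℝ) else 0 := fun i =>
      Finset.sum_nonneg fun b _ => by split_ifs <;> norm_num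
    split_ifs with h
    · obtain ⟨i, b, h⟩ := h
      refine le_trans ?_ (Finset.single_le_sum (fun i _ => hn i) (Finset.mem_univ i))
      refine le_trans ?_ (Finset.single_le_sum (fun b _ => ?_) (Finset.mem_univ b))
      · rw [if_pos h]
      · split_ifs <;> norm_num
    · exact Finset.sum_nonneg fun i _ => hn i
  refine (Finset.expect_le_expect fun U _ => h1 U).trans (le_of_eq ?_)
  rw [Finset.expect_sum_comm]
  have h2 : ∀ i : W l, 𝔼 U : W l → Bits (Fin (F.N l)),
      ∑ b, (if F.G l b = U i then (1 : ℝ) else 0) = ((2 : ℝ) ^ l)⁻¹ := by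
    intro i
    rw [Finset.expect_sum_comm]
    have h3 : ∀ b : Bits (Fin (F.r l)), 𝔼 U : W l → Bits (Fin (F.N l)),
        (if F.G l b = U i then (1 : ℝ) else 0) = ((2 : ℝ) ^ F.N l)⁻¹ := by
      intro b
      rw [expect_eval i fun u => if F.G l b = u then (1 : ℝ) else 0,
        Fintype.expect_eq_sum_div_card]
      simp [div_eq_inv_mul]
    rw [Finset.sum_congr rfl fun b _ => h3 b]
    simp only [Finset.sum_const, Finset.card_univ, Fintype.card_fun, Fintype.card_bool,
      Fintype.card_fin, nsmul_eq_mul, N, pow_add, mul_inv]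
    push_cast
    field_simp
  rw [Finset.sum_congr rfl fun i _ => h2 i]
  simp

/-- A lock with string `y` and flag `0` cannot be distinguished from the lock with string `y ⊕ v` and
flag `1`, even given the secret key. The parts of the public key not selected by `v` can be replaced
by uniform strings, which makes the two locks equivalent. -/
lemma lock_secure [PolyCard W] (O : DataObf (F.lock (W := W))) (H : ℕ → Type)
    [∀ l, Nonempty (H l)]
    (T : ∀ l, H l → Bits (F.PKey W l ⊕ (F.SKey W l ⊕ Fin (O.t l))) → ℝ) (hT : PP T) :
    ∃ ν : ℕ → ℝ, Negligible ν ∧ ∀ l h v y,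
      |(𝔼 s, 𝔼 ω, T l h (Sum.elim (pkOf s) (Sum.elim (skOf s v)
          (O.obf l (Sum.elim (Sum.elim (pkOf s) (Sum.elim y fun _ => false)) ω))))) -
        𝔼 s, 𝔼 ω, T l h (Sum.elim (pkOf s) (Sum.elim (skOf s v)
          (O.obf l (Sum.elim (Sum.elim (pkOf s)
            (Sum.elim (fun i => Bool.xor (y i) (v i)) fun _ => true)) ω))))| ≤ ν l := by
  have hct : PolyCard fun l => Fin (O.t l) := .fin O.t_poly
  have hcr : PolyCard fun l => Fin (O.r l) := .fin O.r_poly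
  -- the secret key is given by `v` and the selected seeds
  let sk : ∀ l, Bits (W l) → (W l → Bits (Fin (F.r l))) → Bits (F.SKey W l) := fun l v a =>
    Sum.elim v fun p => a p.1 p.2
  let val : ∀ l, H l → Bits (W l) → Bits (W l) → Bool → (W l → Bits (Fin (F.r l))) →
      Bits (Fin (O.r l)) → Bits (W l × Fin (F.N l)) → ℝ := fun l h v y c a ω U =>
    T l h (Sum.elim (pkMix v a U) (Sum.elim (sk l v a)
      (O.obf l (Sum.elim (Sum.elim (pkMix v a U) (Sum.elim y fun _ => c)) ω))))
  obtain ⟨ν₁, hν₁, h0₁, h₁⟩ := F.GAll_secure (I := W)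
    (fun l => H l × Bits (W l) × Bits (W l) × Bool × (W l → Bits (Fin (F.r l))) ×
      Bits (Fin (O.r l)))
    (fun l h U => val l h.1 h.2.1 h.2.2.1 h.2.2.2.1 h.2.2.2.2.1 h.2.2.2.2.2 U) (by
      have hpk : PC (H := fun l => H l × Bits (W l) × Bits (W l) × Bool ×
          (W l → Bits (Fin (F.r l))) × Bits (Fin (O.r l))) fun l h U =>
          (pkMix h.2.1 h.2.2.2.2.1 U : Bits (F.PKey W l)) := by
        refine PC.of_bits ?_
        rintro l ⟨h, v, y, c, a, ω⟩ ⟨⟨i, β⟩, j⟩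
        by_cases hβ : β = v i
        · exact .inl ⟨F.G l (a i) j, fun z => by simp [pkMix, hβ]⟩
        · exact .inr ⟨(i, j), fun z => by simp [pkMix, hβ]⟩
      exact PP.pre (hT.reparam fun l (h : H l × Bits (W l) × Bits (W l) × Bool ×
        (W l → Bits (Fin (F.r l))) × Bits (Fin (O.r l))) => h.1)
        (hpk.pair ((PC.const fun l h => sk l h.2.1 h.2.2.2.2.1).pair
          ((O.obf_pc.reparam fun _ _ => ()).comp
            ((hpk.pair (PC.const fun l h => Sum.elim h.2.2.1 fun _ => h.2.2.2.1)).pair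
              (PC.const fun l h => h.2.2.2.2.2))))))
  obtain ⟨ν₂, hν₂, h0₂, h₂⟩ := O.secure (fun l => H l × Bits (F.PKey W l) × Bits (F.SKey W l))
    (fun l h z => T l h.1 (Sum.elim h.2.1 (Sum.elim h.2.2 z)))
    (PP.pre (hT.reparam fun l (h : H l × Bits (F.PKey W l) × Bits (F.SKey W l)) => h.1)
      ((PC.const fun l (h : H l × Bits (F.PKey W l) × Bits (F.SKey W l)) => h.2.1).pair
        ((PC.const fun l (h : H l × Bits (F.PKey W l) × Bits (F.SKey W l)) => h.2.2).pair .id)))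
  refine ⟨fun l => ν₁ l + (ν₂ l + (Fintype.card (W l) : ℕ) * ((2 : ℝ) ^ l)⁻¹) + ν₁ l,
    (hν₁.add (hν₂.add (.poly_mul PolyCard.poly .two_pow_inv))).add hν₁, fun l h v y => ?_⟩
  have hreal : ∀ (y : Bits (W l)) (c : Bool),
      𝔼 s, 𝔼 ω, T l h (Sum.elim (pkOf s) (Sum.elim (skOf s v)
        (O.obf l (Sum.elim (Sum.elim (pkOf s) (Sum.elim y fun _ => c)) ω)))) =
      𝔼 a, 𝔼 ω, 𝔼 b, val l h v y c a ω (F.GAll b) := by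
    intro y c
    rw [expect_seeds v]
    refine Finset.expect_congr rfl fun a _ => ?_
    rw [expect_comm]
    refine Finset.expect_congr rfl fun ω _ => Finset.expect_congr rfl fun b _ => ?_
    have e1 : pkOf (F := F) (W := W) (l := l) (fun i β => if β = v i then a i else b i) =
        pkMix v a (F.GAll b) := by
      funext p
      simp only [pkOf, pkMix, GAll]
      split_ifs <;> rfl
    have e2 : skOf (F := F) (W := W) (l := l) (fun i β => if β = v i then a i else b i) v =
        sk l v a := by
      simp [skOf, sk]
    rw [e1, e2]
  have hprg : ∀ (y : Bits (W l)) (c : Bool),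
      |(𝔼 a, 𝔼 ω, 𝔼 b, val l h v y c a ω (F.GAll b)) -
        𝔼 a, 𝔼 ω, 𝔼 U : W l → Bits (Fin (F.N l)), val l h v y c a ω fun p => U p.1 p.2| ≤ ν₁ l :=
    fun y c => abs_expect_sub_le fun a => abs_expect_sub_le fun ω => h₁ l (h, v, y, c, a, ω)
  have hmid : |(𝔼 a, 𝔼 ω, 𝔼 U : W l → Bits (Fin (F.N l)),
        val l h v y false a ω fun p => U p.1 p.2) -
      𝔼 a, 𝔼 ω, 𝔼 U : W l → Bits (Fin (F.N l)),
        val l h v (fun i => Bool.xor (y i) (v i)) true a ω fun p => U p.1 p.2| ≤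
      ν₂ l + Fintype.card (W l) * ((2 : ℝ) ^ l)⁻¹ := by
    refine abs_expect_sub_le fun a => ?_
    rw [expect_comm, expect_comm (fun ω (U : W l → Bits (Fin (F.N l))) => val l h v _ true a ω _),
      ← Finset.expect_sub_distrib]
    refine (Finset.abs_expect_le _ _).trans ?_
    have hU : ∀ U : W l → Bits (Fin (F.N l)),
        |(𝔼 ω, val l h v y false a ω fun p => U p.1 p.2) -
          𝔼 ω, val l h v (fun i => Bool.xor (y i) (v i)) true a ω fun p => U p.1 p.2| ≤
        ν₂ l + if ∃ i b, F.G l b = U i then (1 : ℝ) else 0 := by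
      intro U
      split_ifs with hbad
      · refine (abs_sub_le_one
          (expect_nonneg_le_one (fun _ => hT.nonneg _ _ _) fun _ => hT.le_one _ _ _)
          (expect_nonneg_le_one (fun _ => hT.nonneg _ _ _) fun _ => hT.le_one _ _ _)).trans ?_
        linarith [h0₂ l]
      · push Not at hbad
        rw [add_zero]
        exact h₂ l (h, pkMix v a fun p => U p.1 p.2, sk l v a) _ _ (lock_pkMix v y a U hbad)
    refine (Finset.expect_le_expect fun U _ => hU U).trans ?_
    rw [Finset.expect_add_distrib, Fintype.expect_const]
    exact add_le_add le_rfl expect_bad_le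
  rw [hreal, hreal]
  have h3 := hprg y false
  have h4 := hprg (fun i => Bool.xor (y i) (v i)) true
  rw [abs_le] at *
  constructor <;> linarith [h3.1, h3.2, h4.1, h4.2, hmid.1, hmid.2]

end BitPRF

namespace BitPRF

variable (F : BitPRF) {I : ℕ → Type} [∀ l, Fintype (I l)] [∀ l, DecidableEq (I l)]

/-! ### Programs for punctured functions -/

/-- The data of a program: keys and punctured keys for all indices in `I`, two flags, two points and
two values. -/
abbrev ProgData (I : ℕ → Type) (l : ℕ) : Type :=
  ((I l × Fin (F.r l)) ⊕ (I l × Fin (F.κ l))) ⊕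
    ((Unit ⊕ Unit) ⊕ ((Fin (F.n l) ⊕ Fin (F.n l)) ⊕ (I l ⊕ I l)))

variable {F}

/-- The data of a program. -/
def progData {l : ℕ} (K : Bits (I l × Fin (F.r l))) (Kp : Bits (I l × Fin (F.κ l))) (a₁ a₂ : Bool)
    (xB xC : Bits (Fin (F.n l))) (yB yC : Bits (I l)) : Bits (F.ProgData I l) :=
  Sum.elim (Sum.elim K Kp) (Sum.elim (Sum.elim (fun _ => a₁) fun _ => a₂)
    (Sum.elim (Sum.elim xB xC) (Sum.elim yB yC)))

variable (F)

/-- The program: if the first flag is set, then the two points are mapped to the two values.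
Elsewhere the functions are evaluated, with the punctured keys if the second flag is set. -/
def prog (l : ℕ) (z : Bits (F.ProgData I l ⊕ Fin (F.n l))) : Bits (I l) := fun i =>
  bif z (Sum.inl (Sum.inr (Sum.inl (Sum.inl ())))) &&
      decide (∀ j, (z (Sum.inr j) ==
        z (Sum.inl (Sum.inr (Sum.inr (Sum.inl (Sum.inl j)))))) = true) then
    z (Sum.inl (Sum.inr (Sum.inr (Sum.inr (Sum.inl i)))))
  else bif z (Sum.inl (Sum.inr (Sum.inl (Sum.inl ())))) &&
      decide (∀ j, (z (Sum.inr j) ==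
        z (Sum.inl (Sum.inr (Sum.inr (Sum.inl (Sum.inr j)))))) = true) then
    z (Sum.inl (Sum.inr (Sum.inr (Sum.inr (Sum.inr i)))))
  else bif z (Sum.inl (Sum.inr (Sum.inl (Sum.inr ())))) then
    F.fp l (Sum.elim (fun j => z (Sum.inl (Sum.inl (Sum.inr (i, j))))) fun j => z (Sum.inr j))
  else F.f l (Sum.elim (fun j => z (Sum.inl (Sum.inl (Sum.inl (i, j))))) fun j => z (Sum.inr j))

lemma prog_pc [PolyCard I] : PC fun l (_ : Unit) => F.prog (I := I) l := by
  refine PC.pi PolyCard.poly (PB.cond ?_ (PB.var _) (PB.cond ?_ (PB.var _) (PB.cond (PB.var _)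
    ?_ ?_)))
  · exact PB.and (PB.var _) (PB.all PolyCard.poly (PB.beq (PB.var _) (PB.var _)))
  · exact PB.and (PB.var _) (PB.all PolyCard.poly (PB.beq (PB.var _) (PB.var _)))
  · exact (F.fp_pb.reparam fun _ _ => ()).comp ((PC.wires fun l (h : Unit × I l) j =>
      Sum.inl (Sum.inl (Sum.inr (h.2, j)))).pair (PC.wires fun l _ j => Sum.inr j))
  · exact (F.f_pb.reparam fun _ _ => ()).comp ((PC.wires fun l (h : Unit × I l) j =>
      Sum.inl (Sum.inl (Sum.inl (h.2, j)))).pair (PC.wires fun l _ j => Sum.inr j))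

lemma prog_progData {l : ℕ} (K : Bits (I l × Fin (F.r l))) (Kp : Bits (I l × Fin (F.κ l)))
    (a₁ a₂ : Bool) (xB xC : Bits (Fin (F.n l))) (yB yC : Bits (I l)) (x : Bits (Fin (F.n l)))
    (i : I l) :
    F.prog l (Sum.elim (progData K Kp a₁ a₂ xB xC yB yC) x) i =
      if a₁ ∧ x = xB then yB i else if a₁ ∧ x = xC then yC i
      else if a₂ then F.fp l (Sum.elim (fun j => Kp (i, j)) x)
      else F.f l (Sum.elim (fun j => K (i, j)) x) := by
  have h : ∀ y : Bits (Fin (F.n l)), decide (∀ j, (x j == y j) = true) = decide (x = y) := fun y =>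
    decide_eq_decide.2 (by simp [funext_iff])
  have hd : F.prog l (Sum.elim (progData K Kp a₁ a₂ xB xC yB yC) x) i =
      bif a₁ && decide (∀ j, (x j == xB j) = true) then yB i else
      bif a₁ && decide (∀ j, (x j == xC j) = true) then yC i else
      bif a₂ then F.fp l (Sum.elim (fun j => Kp (i, j)) x)
      else F.f l (Sum.elim (fun j => K (i, j)) x) := rfl
  rw [hd, h, h]
  cases a₁ <;> cases a₂ <;> by_cases h1 : x = xB <;> by_cases h2 : x = xC <;> simp [h1, h2]

/-- The values at `x` of the functions with keys `K i`. -/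
def fAll {l : ℕ} (K : Bits (I l × Fin (F.r l))) (x : Bits (Fin (F.n l))) : Bits (I l) :=
  fun i => F.f l (Sum.elim (fun j => K (i, j)) x)

lemma fAll_pc [PolyCard I] : PC fun l (_ : Unit) (z : Bits ((I l × Fin (F.r l)) ⊕ Fin (F.n l))) =>
    F.fAll (I := I) (fun p => z (Sum.inl p)) fun j => z (Sum.inr j) :=
  PC.pi PolyCard.poly ((F.f_pb.reparam fun _ _ => ()).comp ((PC.wires fun l (h : Unit × I l) j =>
      Sum.inl (h.2, j)).pair (PC.wires fun _ _ j => Sum.inr j)))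

/-- The data of the program for the functions themselves. -/
def plainData {l : ℕ} (K : Bits (I l × Fin (F.r l))) : Bits (F.ProgData I l) :=
  progData K (fun _ => false) false false (fun _ => false) (fun _ => false) (fun _ => false)
    fun _ => false

/-- The data of the program that maps `x` to `y`. -/
def pointData {l : ℕ} (K : Bits (I l × Fin (F.r l))) (x : Bits (Fin (F.n l))) (y : Bits (I l)) :
    Bits (F.ProgData I l) :=
  progData K (fun _ => false) true false x x y y

/-- Given an obfuscation of the program for the functions with the value at `x` replaced by
`F_K(x) ⊕ R`, the string `F_K(x)` cannot be distinguished from a uniform string. -/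
lemma prog_secure [PolyCard I] (O : DataObf (F.prog (I := I))) (H : ℕ → Type)
    [∀ l, Nonempty (H l)] (Θ : ∀ l, H l → Bits (I l ⊕ Fin (O.t l)) → ℝ) (hΘ : PP Θ) :
    ∃ ν : ℕ → ℝ, Negligible ν ∧ ∀ l h x (R : Bits (I l)),
      |(𝔼 K, 𝔼 ω, Θ l h (Sum.elim (F.fAll K x) (O.obf l (Sum.elim
          (F.pointData K x fun i => Bool.xor (F.fAll K x i) (R i)) ω)))) -
        𝔼 K, 𝔼 u, 𝔼 ω, Θ l h (Sum.elim u (O.obf l (Sum.elim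
          (F.pointData K x fun i => Bool.xor (u i) (R i)) ω)))| ≤ ν l := by
  have hct : PolyCard fun l => Fin (O.t l) := .fin O.t_poly
  have hcr : PolyCard fun l => Fin (O.r l) := .fin O.r_poly
  obtain ⟨ν₁, hν₁, h0₁, h₁⟩ := O.secure (fun l => H l × Bits (I l))
    (fun l h z => Θ l h.1 (Sum.elim h.2 z))
    (PP.pre (hΘ.reparam fun l (h : H l × Bits (I l)) => h.1)
      ((PC.const fun l (h : H l × Bits (I l)) => h.2).pair .id))
  let pd : ∀ l, Bits (I l × Fin (F.κ l)) → Bits (Fin (F.n l)) → Bits (I l) →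
      Bits (F.ProgData I l) := fun l Kp x y => progData (fun _ => false) Kp true true x x y y
  obtain ⟨ν₂, hν₂, h0₂, h₂⟩ := F.secure_pi (I := I)
    (fun l => H l × Bits (Fin (F.n l)) × Bits (I l) × Bits (Fin (O.r l)))
    (fun l h z => Θ l h.1 (Sum.elim (fun i => z (Sum.inr i)) (O.obf l (Sum.elim
      (pd l (fun p => z (Sum.inl p)) h.2.1 fun i => Bool.xor (z (Sum.inr i)) (h.2.2.1 i))
        h.2.2.2)))) (by
    have hx : PC fun l (h : H l × Bits (Fin (F.n l)) × Bits (I l) × Bits (Fin (O.r l)))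
        (z : Bits ((I l × Fin (F.κ l)) ⊕ I l)) i => Bool.xor (z (Sum.inr i)) (h.2.2.1 i) :=
      PC.pi PolyCard.poly (PB.xor (PB.var _) (PB.const fun l (h : (H l × Bits (Fin (F.n l)) ×
        Bits (I l) × Bits (Fin (O.r l))) × I l) => h.1.2.2.1 h.2))
    refine PP.pre (hΘ.reparam fun l (h : H l × Bits (Fin (F.n l)) × Bits (I l) ×
      Bits (Fin (O.r l))) => h.1) ((PC.wires fun l _ i => Sum.inr i).pair
        ((O.obf_pc.reparam fun _ _ => ()).comp (PC.pair ?_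
          (PC.const fun l (h : H l × Bits (Fin (F.n l)) × Bits (I l) × Bits (Fin (O.r l))) =>
            h.2.2.2))))
    exact (((PC.const fun _ _ _ => false).pair (PC.wires fun _ _ i => Sum.inl i)).pair
      (((PC.const fun _ _ _ => true).pair (PC.const fun _ _ _ => true)).pair
        (((PC.const fun l h => h.2.1).pair (PC.const fun l h => h.2.1)).pair (hx.pair hx)))))
  -- the values are used at `x` only, so the keys can be punctured
  have hpunct : ∀ l h (K : I l → Bits (Fin (F.r l))) x (u y : Bits (I l)),
      |(𝔼 ω, Θ l h (Sum.elim u (O.obf l (Sum.elim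
          (F.pointData (fun p => K p.1 p.2) x y) ω)))) -
        𝔼 ω, Θ l h (Sum.elim u (O.obf l (Sum.elim
          (pd l (fun p => F.punct l (Sum.elim (K p.1) x) p.2) x y) ω)))| ≤ ν₁ l := by
    intro l h K x u y
    refine h₁ l (h, u) _ _ fun z => ?_
    funext i
    rw [pointData, prog_progData, prog_progData]
    by_cases hz : z = x
    · simp [hz]
    · have : F.fp l (Sum.elim (F.punct l (Sum.elim (K i) x)) z) = F.f l (Sum.elim (K i) z) :=
        F.correct l _ _ _ hz
      simp [hz, this]
  refine ⟨fun l => ν₁ l + ν₂ l + ν₁ l, (hν₁.add hν₂).add hν₁, fun l h x R => ?_⟩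
  have hcurry : ∀ g : Bits (I l × Fin (F.r l)) → ℝ,
      𝔼 K, g K = 𝔼 K : I l → Bits (Fin (F.r l)), g fun p => K p.1 p.2 := fun g =>
    Fintype.expect_equiv (Equiv.curry (I l) (Fin (F.r l)) Bool) _ _ fun K => rfl
  rw [hcurry, hcurry]
  have e1 : |(𝔼 K : I l → Bits (Fin (F.r l)), 𝔼 ω, Θ l h (Sum.elim (F.fAll (fun p => K p.1 p.2) x)
        (O.obf l (Sum.elim (F.pointData (fun p => K p.1 p.2) x fun i =>
          Bool.xor (F.fAll (fun p => K p.1 p.2) x i) (R i)) ω)))) -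
      𝔼 K : I l → Bits (Fin (F.r l)), 𝔼 ω, Θ l h (Sum.elim (F.fAll (fun p => K p.1 p.2) x)
        (O.obf l (Sum.elim (pd l (fun p => F.punct l (Sum.elim (K p.1) x) p.2) x fun i =>
          Bool.xor (F.fAll (fun p => K p.1 p.2) x i) (R i)) ω)))| ≤ ν₁ l :=
    abs_expect_sub_le fun K => hpunct l h K x _ _
  have e3 : |(𝔼 K : I l → Bits (Fin (F.r l)), 𝔼 u, 𝔼 ω, Θ l h (Sum.elim u
        (O.obf l (Sum.elim (F.pointData (fun p => K p.1 p.2) x fun i =>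
          Bool.xor (u i) (R i)) ω)))) -
      𝔼 K : I l → Bits (Fin (F.r l)), 𝔼 u, 𝔼 ω, Θ l h (Sum.elim u
        (O.obf l (Sum.elim (pd l (fun p => F.punct l (Sum.elim (K p.1) x) p.2) x fun i =>
          Bool.xor (u i) (R i)) ω)))| ≤ ν₁ l :=
    abs_expect_sub_le fun K => abs_expect_sub_le fun u => hpunct l h K x _ _
  have e2 : |(𝔼 K : I l → Bits (Fin (F.r l)), 𝔼 ω, Θ l h (Sum.elim (F.fAll (fun p => K p.1 p.2) x)
        (O.obf l (Sum.elim (pd l (fun p => F.punct l (Sum.elim (K p.1) x) p.2) x fun i =>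
          Bool.xor (F.fAll (fun p => K p.1 p.2) x i) (R i)) ω)))) -
      𝔼 K : I l → Bits (Fin (F.r l)), 𝔼 u, 𝔼 ω, Θ l h (Sum.elim u
        (O.obf l (Sum.elim (pd l (fun p => F.punct l (Sum.elim (K p.1) x) p.2) x fun i =>
          Bool.xor (u i) (R i)) ω)))| ≤ ν₂ l := by
    rw [expect_comm]
    have hu : ∀ K : I l → Bits (Fin (F.r l)), 𝔼 u, 𝔼 ω, Θ l h (Sum.elim u
        (O.obf l (Sum.elim (pd l (fun p => F.punct l (Sum.elim (K p.1) x) p.2) x fun i =>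
          Bool.xor (u i) (R i)) ω))) = 𝔼 ω, 𝔼 u, Θ l h (Sum.elim u
        (O.obf l (Sum.elim (pd l (fun p => F.punct l (Sum.elim (K p.1) x) p.2) x fun i =>
          Bool.xor (u i) (R i)) ω))) := fun K => expect_comm _
    simp only [hu]
    rw [expect_comm (fun (K : I l → Bits (Fin (F.r l))) ω => 𝔼 u, Θ l h (Sum.elim u
        (O.obf l (Sum.elim (pd l (fun p => F.punct l (Sum.elim (K p.1) x) p.2) x fun i =>
          Bool.xor (u i) (R i)) ω))))]
    exact abs_expect_sub_le fun ω => h₂ l (h, x, R, ω) x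
  rw [abs_le] at *
  constructor <;> linarith [e1.1, e1.2, e2.1, e2.2, e3.1, e3.2]

end BitPRF

/-! ### Guessing games with a measured register -/

section

variable {χ ι κ μ β γ β' γ' ν : Type} [Fintype χ] [DecidableEq χ]
  [Fintype ι] [DecidableEq ι] [Fintype κ] [DecidableEq κ]
  [Fintype μ] [DecidableEq μ] [Fintype β] [DecidableEq β] [Fintype γ] [DecidableEq γ]
  [Fintype β'] [DecidableEq β'] [Fintype γ'] [DecidableEq γ']

/-- The register `μ` is measured; depending on the outcome `m`, the channels `ΨB m` and `ΨC m` are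
applied to the other two registers. This is the probability that both yield the bit `b`. -/
def guessSum (ΨB : Bits μ → Op β → Op Unit) (ΨC : Bits μ → Op γ → Op Unit)
    (ρ : Op (μ ⊕ (β ⊕ γ))) (b : Bool) : ℝ :=
  ∑ m, prob (onRight (ΨC m) (onLeft (ΨB m) (measL m ρ))) fun _ => b

lemma QK.map_zero {Ψ : Bits χ → Op ι → Op κ} {s : ℕ} (hΨ : QK Ψ s) (z : Bits χ) : Ψ z 0 = 0 := by
  obtain ⟨A, -, hA⟩ := hΨ
  rw [← hA, ← A.run_zero]
  congr 1
  ext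
  simp [tensor]

/-- Two copies of the outcome of a measurement of `μ` are added to the two other registers. -/
def copyMeas (ρ : Op (μ ⊕ (β ⊕ γ))) : Op ((μ ⊕ β) ⊕ (μ ⊕ γ)) :=
  ∑ m, restrict (Equiv.sumSumSumComm μ β μ γ) (tensor (basis (Sum.elim m m)) (measL m ρ))

lemma copyMeas_apply (ρ : Op (μ ⊕ (β ⊕ γ))) (m₁ m₂ m₁' m₂' : Bits μ) (x x' : Bits β)
    (y y' : Bits γ) :
    copyMeas ρ (Sum.elim (Sum.elim m₁ x) (Sum.elim m₂ y))
        (Sum.elim (Sum.elim m₁' x') (Sum.elim m₂' y')) =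
      if m₁ = m₂ ∧ m₁' = m₂ ∧ m₂' = m₂ then
        measL m₂ ρ (Sum.elim x y) (Sum.elim x' y') else 0 := by
  have h1 : ∀ (m₁ m₂ : Bits μ) (x : Bits β) (y : Bits γ),
      (Sum.elim (Sum.elim m₁ x) (Sum.elim m₂ y) ∘ (Equiv.sumSumSumComm μ β μ γ).symm) ∘ Sum.inl =
        Sum.elim m₁ m₂ := by
    intro m₁ m₂ x y; funext i; rcases i with i | i <;> rfl
  have h2 : ∀ (m₁ m₂ : Bits μ) (x : Bits β) (y : Bits γ),
      (Sum.elim (Sum.elim m₁ x) (Sum.elim m₂ y) ∘ (Equiv.sumSumSumComm μ β μ γ).symm) ∘ Sum.inr =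
        Sum.elim x y := by
    intro m₁ m₂ x y; funext i; rcases i with i | i <;> rfl
  rw [copyMeas, Matrix.sum_apply]
  simp only [restrict_equiv, tensor, Matrix.of_apply, h1, h2, basis, Matrix.single_apply,
    Sum.elim_eq_iff]
  rw [Finset.sum_eq_single m₂]
  · by_cases h : m₁ = m₂ ∧ m₁' = m₂ ∧ m₂' = m₂
    · obtain ⟨rfl, rfl, rfl⟩ := h
      simp
    · rw [if_neg h, if_neg, zero_mul]
      rintro ⟨⟨a, b⟩, c, d⟩
      exact h ⟨a.symm, c.symm, d.symm⟩
  · intro m _ hm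
    rw [if_neg fun h => hm h.1.2, zero_mul]
  · simp

/-- Each of two parties can measure its own copy. -/
lemma prob_copyMeas (ΨB : Bits μ → Op β → Op Unit) (ΨC : Bits μ → Op γ → Op Unit)
    (hB : ∀ m, ΨB m 0 = 0) (ρ : Op (μ ⊕ (β ⊕ γ))) (b : Bool) :
    prob (onRight (fun σ => ∑ m, ΨC m (measL m σ)) (onLeft (fun σ => ∑ m, ΨB m (measL m σ))
      (copyMeas ρ))) (fun _ => b) = guessSum ΨB ΨC ρ b := by
  have hL : ∀ (m₂ : Bits μ) (y y' : Bits γ) (w w' : Bits Unit),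
      (∑ m, ΨB m (measL m (Matrix.of fun x x' =>
        copyMeas ρ (Sum.elim x (Sum.elim m₂ y)) (Sum.elim x' (Sum.elim m₂ y'))))) w w' =
      ΨB m₂ (Matrix.of fun x x' => measL m₂ ρ (Sum.elim x y) (Sum.elim x' y')) w w' := by
    intro m₂ y y' w w'
    rw [Finset.sum_eq_single m₂]
    · congr 2
      ext x x'
      simp [measL, copyMeas_apply]
    · intro m _ hm
      rw [← hB m]
      congr 1
      ext x x'
      simp [measL, copyMeas_apply, hm]
    · simp
  rw [guessSum, prob]
  simp only [onRight, Matrix.of_apply, Matrix.sum_apply, Complex.re_sum, prob]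
  refine Finset.sum_congr rfl fun m _ => ?_
  refine congrArg (fun M => (ΨC m M _ _).re) ?_
  ext y y'
  simp only [measL, onLeft, Matrix.of_apply, Sum.elim_comp_inr, Sum.elim_comp_inl]
  exact hL m y y' _ _

lemma onRight_onLeft_restrict (eB : β' ≃ β) (eC : γ' ≃ γ) (Φ : Op β → Op Unit)
    (Φ' : Op γ → Op Unit) (X : Op (β ⊕ γ)) :
    onRight (fun ρ => Φ' (restrict eC.symm ρ)) (onLeft (fun ρ => Φ (restrict eB.symm ρ))
      (restrict (Equiv.sumCongr eB eC) X)) = onRight Φ' (onLeft Φ X) := by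
  have h : ∀ (x : Bits β) (y : Bits γ'),
      Sum.elim (x ∘ eB) y ∘ (Equiv.sumCongr eB eC).symm = Sum.elim x (y ∘ eC.symm) := by
    intro x y
    funext i
    rcases i with i | i <;> simp
  ext w w'
  simp only [onRight, onLeft, Matrix.of_apply, Sum.elim_comp_inr, Sum.elim_comp_inl]
  congr 1
  ext y y'
  simp only [restrict_equiv, Matrix.of_apply, Equiv.symm_symm]
  congr 1
  ext x x'
  simp only [restrict_equiv, Matrix.of_apply, Equiv.symm_symm, h]
  congr 2 <;> simp [Function.comp_assoc]

end

section

variable {H : ℕ → Type} {χ ι κ μ β γ : ℕ → Type}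
  [∀ l, Fintype (χ l)] [∀ l, DecidableEq (χ l)] [∀ l, Fintype (ι l)] [∀ l, DecidableEq (ι l)]
  [∀ l, Fintype (κ l)] [∀ l, DecidableEq (κ l)] [∀ l, Fintype (μ l)] [∀ l, DecidableEq (μ l)]
  [∀ l, Fintype (β l)] [∀ l, DecidableEq (β l)] [∀ l, Fintype (γ l)] [∀ l, DecidableEq (γ l)]

lemma PK.map_zero {Ψ : ∀ l, H l → Bits (χ l) → Op (ι l) → Op (κ l)} (hΨ : PK Ψ) (l : ℕ) (h : H l)
    (z : Bits (χ l)) : Ψ l h z 0 = 0 :=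
  let ⟨_, _, h'⟩ := hΨ
  (h' l h).map_zero z

lemma PK.copyMeas [PolyCard χ] [PolyCard μ] :
    PK fun l (_ : H l) (_ : Bits (χ l)) (ρ : Op (μ l ⊕ (β l ⊕ γ l))) => copyMeas ρ :=
  PK.meas ((PK.relabel (χ := fun l => χ l ⊕ μ l)
    fun l => Equiv.sumSumSumComm (μ l) (β l) (μ l) (γ l)).comp
      (PK.prepend (ι := fun l => β l ⊕ γ l) (PS.of_pc
        ((PC.wires fun _ _ i => Sum.inr i).pair (PC.wires fun _ _ i => Sum.inr i)))))

/-- The success probability of efficient channels in a guessing game is an acceptance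
probability. -/
lemma PP.guessSum [PolyCard χ] [PolyCard μ]
    {S : ∀ l, H l → Bits (χ l) → Op (μ l ⊕ (β l ⊕ γ l))} (hS : PS S)
    {ΨB : ∀ l, H l → Bits (χ l ⊕ μ l) → Op (β l) → Op Unit} (hB : PK ΨB)
    {ΨC : ∀ l, H l → Bits (χ l ⊕ μ l) → Op (γ l) → Op Unit} (hC : PK ΨC)
    {b : ∀ l, H l → Bits (χ l) → Bool} (hb : PB b) :
    PP fun l h z => guessSum (fun m => ΨB l h (Sum.elim z m)) (fun m => ΨC l h (Sum.elim z m))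
      (S l h z) (b l h z) := by
  have h1 := (hS.bind (PK.meas ((hC.onRight (τ := fun _ => Unit)).comp
    (hB.onLeft (τ := γ)))))
  have hb' : PB fun l h (z : Bits (χ l ⊕ (Unit ⊕ Unit))) => b l h (fun i => z (Sum.inl i)) :=
    hb.comp (PC.wires fun l _ i => Sum.inl i)
  refine (PP.of_state h1 (((PB.var fun _ _ => Sum.inr (Sum.inl ())).beq hb').and
    ((PB.var fun _ _ => Sum.inr (Sum.inr ())).beq hb'))).congr fun l h z => ?_
  rw [Finset.sum_eq_single fun _ => b l h z]
  · simp [UnclonableCrypto.guessSum, prob, Matrix.sum_apply]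
  · intro w _ hw
    rw [if_neg]
    simp only [Sum.elim_inr, Sum.elim_inl, Bool.and_eq_true, beq_iff_eq]
    rintro ⟨h1, h2⟩
    apply hw
    funext i
    rcases i with ⟨⟩ | ⟨⟩
    · exact h1
    · exact h2
  · simp

end

/-! ### Unclonable obfuscation of circuits given by codes -/

/-- Codes of length `t` for functions from `n` bits to `κ`: the function with code `d` is
`eval d`. There is a code for each key, and a code for each key with the values at two points
replaced. -/
structure PunctCode (n : ℕ → ℕ) (κ : ℕ → Type) where
  t : ℕ → ℕ
  /-- bits of a key -/
  key : ℕ → Type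
  fkey : ∀ l, Fintype (key l)
  key_poly : PolyCard key
  t_poly : PolyBdd t
  eval : ∀ l, Bits (Fin (t l) ⊕ Fin (n l)) → Bits (κ l)
  code : ∀ l, Bits (key l) → Bits (Fin (t l))
  pcode : ∀ l, Bits (key l ⊕ ((Fin (n l) ⊕ Fin (n l)) ⊕ (κ l ⊕ κ l))) → Bits (Fin (t l))
  eval_pc : PC fun l (_ : Unit) => eval l
  code_pc : PC fun l (_ : Unit) => code l
  pcode_pc : PC fun l (_ : Unit) => pcode l
  eval_pcode : ∀ l k xB xC yB yC x,
    eval l (Sum.elim (pcode l (Sum.elim k (Sum.elim (Sum.elim xB xC) (Sum.elim yB yC)))) x) =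
      if x = xB then yB else if x = xC then yC else eval l (Sum.elim (code l k) x)

attribute [instance] PunctCode.fkey PunctCode.key_poly

/-- An unclonable obfuscation scheme for the functions given by codes. -/
structure CodeUPO {n : ℕ → ℕ} {κ : ℕ → Type} [∀ l, Fintype (κ l)] [∀ l, DecidableEq (κ l)]
    (P : PunctCode n κ) where
  /-- number of qubits of an obfuscation -/
  q : ℕ → ℕ
  q_poly : PolyBdd q
  obf : ∀ l, Bits (Fin (P.t l)) → Op (Fin (q l))
  dec : ∀ l, Bits (Fin (n l)) → Op (Fin (q l)) → Op (κ l)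
  obf_ps : PS fun l (_ : Unit) => obf l
  dec_pk : PK fun l (_ : Unit) => dec l
  correct : ∃ δ : ℕ → ℝ, Negligible δ ∧ ∀ l k x,
    1 - δ l ≤ prob (dec l x (obf l (P.code l k))) (P.eval l (Sum.elim (P.code l k) x))
  secure : ∀ (H : ℕ → Type) [∀ l, Nonempty (H l)] (μ β γ : ℕ → Type) [∀ l, Fintype (μ l)]
    [∀ l, DecidableEq (μ l)] [∀ l, Fintype (β l)] [∀ l, DecidableEq (β l)] [∀ l, Fintype (γ l)]
    [∀ l, DecidableEq (γ l)] [PolyCard μ] [PolyCard β] [PolyCard γ]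
    (k : ∀ l, H l → Bits (P.key l)) (y : ∀ l, H l → Bits (Fin (n l)) → Bits (κ l)) (_ : PC y)
    (Ψ : ∀ l, H l → Op (Fin (q l)) → Op (μ l ⊕ (β l ⊕ γ l)))
    (_ : PK fun l h (_ : Bits Empty) => Ψ l h)
    (ΨB : ∀ l, H l → Bits (Fin (n l) ⊕ μ l) → Op (β l) → Op Unit) (_ : PK ΨB)
    (ΨC : ∀ l, H l → Bits (Fin (n l) ⊕ μ l) → Op (γ l) → Op Unit) (_ : PK ΨC),
    ∃ ν : ℕ → ℝ, Negligible ν ∧ ∀ l h,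
      𝔼 x, 𝔼 b : Bool, guessSum (fun m => ΨB l h (Sum.elim x m)) (fun m => ΨC l h (Sum.elim x m))
        (Ψ l h (obf l (if b then P.pcode l (Sum.elim (k l h) (Sum.elim (Sum.elim x x)
          (Sum.elim (y l h x) (y l h x)))) else P.code l (k l h)))) b ≤ 1 / 2 + ν l

section

variable {n : ℕ → ℕ} {κ : ℕ → Type} [∀ l, Fintype (κ l)] [∀ l, DecidableEq (κ l)]
  (P : PunctCode n κ)

lemma comp_equiv_symm {α β : Type} (e : α ≃ β) (x : Bits β) : (x ∘ e) ∘ e.symm = x := by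
  funext i; simp

variable [PolyCard κ]

/-- The circuit class of a family of codes: the circuits evaluate a hardwired code. -/
lemma PunctCode.exists_class (hn : PolyBdd n) :
    ∃ (𝔠 : GenPunctClass) (hcn : 𝔠.n = n) (C : ∀ l, Bits (Fin (P.t l)) →
      BCirc (Fin (𝔠.n l)) (Fin (𝔠.m l)) (𝔠.size l)) (eκ : ∀ l, κ l ≃ Fin (𝔠.m l))
      (ek : ∀ l, P.key l ≃ Fin (𝔠.κ l)),
      PC (fun l (_ : Unit) d => (C l d).encode) ∧
      (∀ l d x, (C l d).eval x =
        P.eval l (Sum.elim d fun i => x (Fin.cast (congrFun hcn l).symm i)) ∘ (eκ l).symm) ∧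
      (∀ l, 𝔠.keys l = Finset.univ) ∧
      (∀ l k, 𝔠.circ l k = C l (P.code l (k ∘ ek l))) ∧
      ∀ l s k (μ : BCirc (Fin (𝔠.n l)) (Fin (𝔠.m l)) s) x, 𝔠.genPuncture l s k μ μ x x =
        C l (P.pcode l (Sum.elim (k ∘ ek l)
          (Sum.elim (Sum.elim (fun i => x (Fin.cast (congrFun hcn l).symm i))
            fun i => x (Fin.cast (congrFun hcn l).symm i))
            (Sum.elim (μ.eval x ∘ eκ l) (μ.eval x ∘ eκ l))))) := by
  set m := fun l => Fintype.card (κ l) with hm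
  set kl := fun l => Fintype.card (P.key l) with hkl
  let eκ : ∀ l, κ l ≃ Fin (m l) := fun l => Fintype.equivFin (κ l)
  let ek : ∀ l, P.key l ≃ Fin (kl l) := fun l => Fintype.equivFin (P.key l)
  have hcn : PolyCard fun l => Fin (n l) := .fin hn
  have hm' : PolyBdd m := PolyCard.poly (χ := κ)
  have hkl' : PolyBdd kl := PolyCard.poly (χ := P.key)
  have hcm : PolyCard fun l => Fin (m l) := .fin hm'
  have hck : PolyCard fun l => Fin (kl l) := .fin hkl'
  have hct : PolyCard fun l => Fin (P.t l) := .fin P.t_poly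
  obtain ⟨s, hs, hc⟩ := P.eval_pc.map_out fun l => (eκ l).symm
  choose c hc using fun l => hc l ()
  set size := fun l => Fintype.card (Fin (P.t l)) + 1 + s l with hsize
  have hsize' : PolyBdd size := (hct.poly.add (.const 1)).add hs
  let C : ∀ l, Bits (Fin (P.t l)) → BCirc (Fin (n l)) (Fin (m l)) (size l) := fun l d => (c l).hard d
  have hCe : PC fun l (_ : Unit) d => (C l d).encode :=
    PC.hard_encode hcn.poly hcm.poly hct.poly hs c
  have hCev : ∀ l d x, (C l d).eval x = P.eval l (Sum.elim d x) ∘ (eκ l).symm := fun l d x => by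
    rw [BCirc.hard_eval, hc]
  have hcd : PolyCard fun l => Desc (Fin (n l)) (Fin (m l)) (size l) := .desc hsize'
  have hp1 := PC.exists_pt hck.poly hcd.poly (hCe.comp (P.code_pc.comp (PC.wires fun l _ => ek l)))
  refine ⟨⟨n, m, size, kl, hn, hm', hsize', hkl', fun l => Finset.univ,
    fun l k => C l (P.code l (k ∘ ek l)), ?_,
    fun l s k μB μC xB xC => C l (P.pcode l (Sum.elim (k ∘ ek l) (Sum.elim (Sum.elim xB xC)
      (Sum.elim (μB.eval xB ∘ eκ l) (μC.eval xC ∘ eκ l))))), ?_, ?_⟩, rfl, C, eκ, ek, hCe,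
    hCev, fun l => rfl, fun l k => rfl, fun l s k μ x => rfl⟩
  · obtain ⟨A, hA, hA'⟩ := hp1
    exact ⟨A, hA, fun l k _ => hA' l k⟩
  · intro l s k _ μB μC xB xC x
    simp only [hCev, P.eval_pcode]
    split_ifs
    · rw [comp_equiv_symm]
    · rw [comp_equiv_symm]
    · rfl
  · intro s hs
    have hcd' : PolyCard fun l => Desc (Fin (n l)) (Fin (m l)) (s l) := .desc hs
    have hu := fun φ => (PC.univEval (H := fun _ => Unit) (ι := fun l => Fin (n l))
      (κ := fun l => Fin (m l)) hcn.poly hcm.poly hs).comp (PC.wires (ι := fun l =>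
        Fin (kl l) ⊕ ((Desc (Fin (n l)) (Fin (m l)) (s l) ⊕ Desc (Fin (n l)) (Fin (m l)) (s l)) ⊕
          (Fin (n l) ⊕ Fin (n l)))) φ)
    obtain ⟨A, hA, hA'⟩ := PC.exists_pt
      (PolyCard.poly (χ := fun l => Fin (kl l) ⊕ ((Desc (Fin (n l)) (Fin (m l)) (s l) ⊕
        Desc (Fin (n l)) (Fin (m l)) (s l)) ⊕ (Fin (n l) ⊕ Fin (n l))))) hcd.poly
      (hCe.comp (P.pcode_pc.comp ((PC.wires fun l _ i => Sum.inl (ek l i)).pair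
        ((PC.wires fun l _ i => Sum.inr (Sum.inr i)).pair
          (((hu fun l _ => Sum.elim (fun i => Sum.inr (Sum.inl (Sum.inl i)))
              fun i => Sum.inr (Sum.inr (Sum.inl i))).map_out fun l => eκ l).pair
            ((hu fun l _ => Sum.elim (fun i => Sum.inr (Sum.inl (Sum.inr i)))
              fun i => Sum.inr (Sum.inr (Sum.inr i))).map_out fun l => eκ l))))))
    refine ⟨A, hA, fun l k _ μB μC xB xC => (hA' l _).trans ?_⟩
    have e : ∀ (μ : BCirc (Fin (n l)) (Fin (m l)) (s l)) x (z : Bits (Fin (kl l) ⊕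
        ((Desc (Fin (n l)) (Fin (m l)) (s l) ⊕ Desc (Fin (n l)) (Fin (m l)) (s l)) ⊕
          (Fin (n l) ⊕ Fin (n l))))) f, z ∘ f = Sum.elim μ.encode x →
        univEval (z ∘ f) = μ.eval x := fun μ x z f h => by rw [h, univEval_encode]
    rw [e μB xB, e μC xC]
    · rfl
    · funext i; rcases i with i | i <;> rfl
    · funext i; rcases i with i | i <;> rfl

end

lemma prob_clas_inr {ι κ κ' : Type} [Fintype ι] [DecidableEq ι] [Fintype κ] [DecidableEq κ]
    [Fintype κ'] [DecidableEq κ'] (e : κ' ≃ κ) (ρ : Op (ι ⊕ κ)) (y : Bits κ) :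
    prob (clas (fun w => (w ∘ Sum.inr) ∘ e) ρ) (y ∘ e) = prob (traceL ρ) y := by
  rw [prob_clas, sum_bits_sum, prob, traceL, Matrix.sum_apply, Complex.re_sum]
  refine Finset.sum_congr rfl fun x _ => ?_
  rw [Finset.sum_eq_single y]
  · simp [prob, measL]
  · intro z _ hz
    rw [if_neg]
    intro h
    apply hz
    funext i
    simpa using congrFun h (e.symm i)
  · simp

lemma guessProb_zero {χ β γ : Type} [Fintype χ] [DecidableEq χ] [Fintype β] [DecidableEq β]
    [Fintype γ] [DecidableEq γ] (B : QCirc (χ ⊕ β) Unit) (C : QCirc (χ ⊕ γ) Unit)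
    (x : Bits χ) (b : Bool) : guessProb B C x 0 b = 0 := by
  have h : ∀ {ι : Type} [Fintype ι] [DecidableEq ι] (A : QCirc (χ ⊕ ι) Unit),
      A.run (tensor (basis x) 0) = 0 := fun A => by
    rw [← A.run_zero]
    congr 1
    ext
    simp [tensor]
  have h1 : onLeft (fun ρ => B.run (tensor (basis x) ρ)) (0 : Op (β ⊕ γ)) = 0 := by
    ext w w'
    rw [onLeft_apply]
    have : (Matrix.of fun x x' => (0 : Op (β ⊕ γ)) (Sum.elim x (w ∘ Sum.inr))
        (Sum.elim x' (w' ∘ Sum.inr))) = (0 : Op β) := rfl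
    rw [this, h]
    rfl
  have h2 : onRight (fun ρ => C.run (tensor (basis x) ρ)) (0 : Op (Unit ⊕ γ)) = 0 := by
    ext w w'
    simp only [onRight, Matrix.of_apply]
    have : (Matrix.of fun x x' => (0 : Op (Unit ⊕ γ)) (Sum.elim (w ∘ Sum.inl) x)
        (Sum.elim (w' ∘ Sum.inl) x')) = (0 : Op γ) := rfl
    rw [this, h]
    rfl
  rw [guessProb, h1, h2]
  simp [prob]

/-- The circuits with a hardwired code form a generalized puncturable class. An adversary of the game
sends the hardwired key and a circuit for the values `y`, and passes on copies of the outcome of the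
measured register to the two other parties. -/
lemma nonempty_codeUPO (hUPO : ExistsIdenticalGenUPO) {n : ℕ → ℕ} {κ : ℕ → Type}
    [∀ l, Fintype (κ l)] [∀ l, DecidableEq (κ l)] [PolyCard κ] (P : PunctCode n κ)
    (hn : PolyBdd n) (hneg : Negligible fun l => ((2 : ℝ) ^ n l)⁻¹) : Nonempty (CodeUPO P) := by
  obtain ⟨𝔠, rfl, C, eκ, ek, hC, hCev, hkeys, hcirc, hpunct⟩ := P.exists_class hn
  simp only [Fin.cast_eq_self] at hCev hpunct
  obtain ⟨U, hcor, hsec⟩ := hUPO 𝔠 hneg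
  have hcn : PolyCard fun l => Fin (𝔠.n l) := .fin hn
  have hcm : PolyCard fun l => Fin (𝔠.m l) := .fin 𝔠.m_poly
  have hck : PolyCard fun l => Fin (𝔠.κ l) := .fin 𝔠.κ_poly
  have hcq : PolyCard fun l => Fin (U.q l) := U.obf_qpt.polyCard_out
  have hcd : PolyCard fun l => Desc (Fin (𝔠.n l)) (Fin (𝔠.m l)) (𝔠.size l) := .desc 𝔠.size_poly
  refine ⟨⟨U.q, by simpa using hcq.poly, fun l d => (U.Obf l).run (basis (C l d).encode),
    fun l x ρ => clas (fun w => (w ∘ Sum.inr) ∘ eκ l) ((U.Eval l).run (tensor ρ (basis x))),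
    (PS.of_qpt U.obf_qpt).pre hC, ?_, ?_, ?_⟩⟩
  · exact (PK.clas (PC.wires fun l _ i => Sum.inr (Sum.inr (eκ l i)))).comp
      ((PK.of_qpt U.eval_qpt).comp (PK.append (PS.of_pc .id)))
  · obtain ⟨δ, hδ, h⟩ := hcor
    refine ⟨δ, hδ, fun l k x => ?_⟩
    have hk := h l (k ∘ (ek l).symm) (by simp [hkeys]) x
    have e1 : (k ∘ (ek l).symm) ∘ ek l = k := by funext i; simp
    rw [hcirc, e1] at hk
    refine hk.trans (le_of_eq ?_)
    rw [← prob_clas_inr (eκ l), hCev]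
    congr 1
    funext i
    simp
  · intro H _ μ β γ _ _ _ _ _ _ _ _ _ k y hy Ψ hΨ ΨB hB ΨC hC'
    -- the success probability in the game, as an acceptance probability
    let val : ∀ l, H l → ℝ := fun l h => (𝔼 x, 𝔼 b : Bool,
      guessSum (fun m => ΨB l h (Sum.elim x m)) (fun m => ΨC l h (Sum.elim x m))
        (Ψ l h ((U.Obf l).run (basis (C l (if b then P.pcode l (Sum.elim (k l h)
          (Sum.elim (Sum.elim x x) (Sum.elim (y l h x) (y l h x))))
            else P.code l (k l h))).encode))) b) - 1 / 2
    have hPP : PP fun l h (z : Bits ((Fin (𝔠.n l) ⊕ Unit) ⊕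
        Desc (Fin (𝔠.n l)) (Fin (𝔠.m l)) (𝔠.size l))) =>
        guessSum (fun m => ΨB l h (Sum.elim (fun i => z (Sum.inl (Sum.inl i))) m))
          (fun m => ΨC l h (Sum.elim (fun i => z (Sum.inl (Sum.inl i))) m))
          (Ψ l h ((U.Obf l).run (basis fun i => z (Sum.inr i)))) (z (Sum.inl (Sum.inr ()))) := by
      have hw : PC fun l (_ : H l) (z : Bits (((Fin (𝔠.n l) ⊕ Unit) ⊕
          Desc (Fin (𝔠.n l)) (Fin (𝔠.m l)) (𝔠.size l)) ⊕ μ l)) =>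
          Sum.elim (fun i => z (Sum.inl (Sum.inl (Sum.inl i)))) fun i => z (Sum.inr i) :=
        (PC.wires fun l _ i => Sum.inl (Sum.inl (Sum.inl i))).pair (PC.wires fun l _ i => Sum.inr i)
      exact PP.guessSum
        (((PS.of_qpt U.obf_qpt).pre (PC.wires fun l _ i => Sum.inr i)).bind
          (hΨ.pre (PC.wires fun l _ i => i.elim)))
        (hB.pre hw) (hC'.pre hw) (PB.var fun _ _ => Sum.inl (Sum.inr ()))
    obtain ⟨ν, hν, -, h⟩ := exists_negligible_forall_le val (fun l h => by
      have h1 := (expect_nonneg_le_one (f := fun x : Bits (Fin (𝔠.n l)) => 𝔼 b : Bool,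
        guessSum (fun m => ΨB l h (Sum.elim x m)) (fun m => ΨC l h (Sum.elim x m))
        (Ψ l h ((U.Obf l).run (basis (C l (if b then P.pcode l (Sum.elim (k l h)
          (Sum.elim (Sum.elim x x) (Sum.elim (y l h x) (y l h x))))
            else P.code l (k l h))).encode))) b)
        (fun x => (expect_nonneg_le_one (fun b => hPP.nonneg l h (Sum.elim (Sum.elim x fun _ => b) _))
          fun b => hPP.le_one l h (Sum.elim (Sum.elim x fun _ => b) _)).1)
        (fun x => (expect_nonneg_le_one (fun b => hPP.nonneg l h (Sum.elim (Sum.elim x fun _ => b) _))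
          fun b => hPP.le_one l h (Sum.elim (Sum.elim x fun _ => b) _)).2)).2
      simp only [val]
      linarith) (by
      intro a
      obtain ⟨p, hp, hc⟩ := hy
      choose c hc using fun l => (hc l (a l)).map_out (eκ l).symm
      have hcp : PolyCard fun l => Desc (Fin (𝔠.n l)) (Fin (𝔠.m l)) (p l) := .desc hp
      obtain ⟨A₁, hA₁, hA₁S⟩ := PS.exists_qpt (H := H) (χ := fun _ => Empty)
        (κ := fun l => (Fin (𝔠.κ l) ⊕ (Desc (Fin (𝔠.n l)) (Fin (𝔠.m l)) (p l) ⊕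
          Desc (Fin (𝔠.n l)) (Fin (𝔠.m l)) (p l))) ⊕ Fin 0)
        (PS.of_pc (PC.const fun l h => Sum.elim (Sum.elim (k l h ∘ (ek l).symm)
          (Sum.elim (c l).encode (c l).encode)) Fin.elim0)) a
      let eB : ∀ l, Fin (Fintype.card (μ l ⊕ β l)) ≃ μ l ⊕ β l := fun l =>
        (Fintype.equivFin _).symm
      let eC : ∀ l, Fin (Fintype.card (μ l ⊕ γ l)) ≃ μ l ⊕ γ l := fun l =>
        (Fintype.equivFin _).symm
      obtain ⟨A₂, hA₂, hA₂S⟩ := ((PK.relabel fun l => Equiv.sumCongr (eB l) (eC l)).comp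
        (PK.copyMeas.comp (hΨ.pre (χ' := fun _ => Fin 0)
          (PC.wires fun l _ i => i.elim)))).exists_qpt a
      obtain ⟨B, hBq, hBS⟩ := ((PK.meas hB).comp
        (PK.relabel fun l => (eB l).symm)).exists_qpt a
      obtain ⟨D, hDq, hDS⟩ := ((PK.meas hC').comp
        (PK.relabel fun l => (eC l).symm)).exists_qpt a
      let A : U.Adversary := ⟨p, fun _ => 0, _, _, A₁, A₂, B, D, hp, hA₁, hA₂, hBq, hDq⟩
      obtain ⟨ν, hν, h⟩ := hsec A
      refine ⟨ν, hν, .of_forall fun l => ?_⟩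
      have hl := h l
      suffices hs : A.winProb l = val l (a l) + 1 / 2 by linarith
      -- only the hardwired message of the adversary contributes
      have hz : ∀ k' (μB μC : BCirc (Fin (𝔠.n l)) (Fin (𝔠.m l)) (p l)),
          ¬(k' = k l (a l) ∘ (ek l).symm ∧ μB = c l ∧ μC = c l) → ∀ σ x b,
          guessProb (B l) (D l) x ((A₂ l).run (tensor
            (measL (Sum.elim k' (Sum.elim μB.encode μC.encode)) (A₁ l).prepare) σ)) b = 0 := by
        intro k' μB μC hne σ x b
        rw [prepare_eq, hA₁S, measL_basis, if_neg, tensor_zero_left, QCirc.run_zero,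
          guessProb_zero]
        simpa only [Sum.elim_eq_iff, BCirc.encode_injective.eq_iff] using! hne
      rw [UPOScheme.Adversary.winProb, hkeys, Finset.sum_eq_single (k l (a l) ∘ (ek l).symm),
        Finset.sum_eq_single (c l), Finset.sum_eq_single (c l)]
      · simp only [val, sub_add_cancel]
        refine Finset.expect_congr rfl fun x _ => Finset.expect_congr rfl fun b _ => ?_
        have e1 : (k l (a l) ∘ (ek l).symm) ∘ ek l = k l (a l) := by funext i; simp
        have e2 : (c l).eval x ∘ eκ l = y l (a l) x := by
          rw [hc]; funext i; simp
        have e3 : (if b then 𝔠.genPuncture l (p l) (k l (a l) ∘ (ek l).symm) (c l) (c l) x x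
            else 𝔠.circ l (k l (a l) ∘ (ek l).symm)) =
            C l (if b then P.pcode l (Sum.elim (k l (a l)) (Sum.elim (Sum.elim x x)
              (Sum.elim (y l (a l) x) (y l (a l) x)))) else P.code l (k l (a l))) := by
          cases b
          · simp [hcirc, e1]
          · simp only [if_true, hpunct, e1, e2]
        have e4 : measL (Sum.elim (k l (a l) ∘ (ek l).symm)
            (Sum.elim (c l).encode (c l).encode)) (A₁ l).prepare = basis Fin.elim0 := by
          rw [prepare_eq, hA₁S, measL_basis, if_pos rfl]
        change guessProb (B l) (D l) x ((A₂ l).run (tensor (measL (Sum.elim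
          (k l (a l) ∘ (ek l).symm) (Sum.elim (c l).encode (c l).encode)) (A₁ l).prepare)
          ((U.Obf l).run (basis (BCirc.encode (if b then 𝔠.genPuncture l (p l)
            (k l (a l) ∘ (ek l).symm) (c l) (c l) x x
            else 𝔠.circ l (k l (a l) ∘ (ek l).symm))))))) b = _
        rw [e3, e4, hA₂S, guessProb]
        simp only [hBS, hDS]
        rw [onRight_onLeft_restrict (eB l) (eC l)
          (fun ρ => ∑ m, ΨB l (a l) (Sum.elim x m) (measL m ρ))
          (fun ρ => ∑ m, ΨC l (a l) (Sum.elim x m) (measL m ρ)),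
          prob_copyMeas (fun m => ΨB l (a l) (Sum.elim x m)) (fun m => ΨC l (a l) (Sum.elim x m))
            fun m => hB.map_zero l (a l) _]
      · intro μC _ hne
        exact Finset.expect_eq_zero fun x _ => Finset.expect_eq_zero fun b _ =>
          hz _ _ _ (fun h => hne h.2.2) _ _ _
      · simp
      · intro μB _ hne
        exact Finset.sum_eq_zero fun μC _ => Finset.expect_eq_zero fun x _ =>
          Finset.expect_eq_zero fun b _ => hz _ _ _ (fun h => hne h.2.1) _ _ _
      · simp
      · intro k' _ hne
        exact Finset.sum_eq_zero fun μB _ => Finset.sum_eq_zero fun μC _ =>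
          Finset.expect_eq_zero fun x _ => Finset.expect_eq_zero fun b _ =>
            hz _ _ _ (fun h => hne h.1) _ _ _
      · simp)
    exact ⟨ν, hν, fun l h' => by have := h l h'; simp only [val] at this; linarith⟩

/-! ### Attacks on ciphertexts with a classical and a quantum part -/

section

variable {μ α ι κ β γ : Type} [Fintype μ] [DecidableEq μ] [Fintype α] [DecidableEq α]
  [Fintype ι] [DecidableEq ι] [Fintype κ] [DecidableEq κ]
  [Fintype β] [DecidableEq β] [Fintype γ] [DecidableEq γ]

/-- The register `μ` of the state `A` is measured; depending on the outcome `m`, which is kept, the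
channel `Λ m` is applied to the rest of `A` and to `S`. -/
def attack (A : Op (μ ⊕ α)) (Λ : Bits μ → Op (α ⊕ ι) → Op κ) (S : Op ι) : Op (μ ⊕ κ) :=
  ∑ m, tensor (basis m) (Λ m (tensor (measL m A) S))

lemma measL_attack (A : Op (μ ⊕ α)) (Λ : Bits μ → Op (α ⊕ ι) → Op κ) (S : Op ι) (m : Bits μ) :
    measL m (attack A Λ S) = Λ m (tensor (measL m A) S) := by
  ext z z'
  have h : ∀ z : Bits κ, (Sum.elim m z : Bits (μ ⊕ κ)) ∘ Sum.inl = m := fun z => rfl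
  have h' : ∀ z : Bits κ, (Sum.elim m z : Bits (μ ⊕ κ)) ∘ Sum.inr = z := fun z => rfl
  simp only [measL, attack, Matrix.of_apply, Matrix.sum_apply]
  rw [Finset.sum_eq_single m]
  · simp only [tensor, Matrix.of_apply, h, h', basis, Matrix.single_apply, and_self, if_true, one_mul]
  · intro m' _ hm
    simp only [tensor, Matrix.of_apply, h, basis, Matrix.single_apply, hm, false_and, if_false,
      zero_mul]
  · simp

end

section

variable {H : ℕ → Type} {χ μ α ι κ : ℕ → Type}
  [∀ l, Fintype (χ l)] [∀ l, DecidableEq (χ l)] [∀ l, Fintype (ι l)] [∀ l, DecidableEq (ι l)]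
  [∀ l, Fintype (κ l)] [∀ l, DecidableEq (κ l)] [∀ l, Fintype (μ l)] [∀ l, DecidableEq (μ l)]
  [∀ l, Fintype (α l)] [∀ l, DecidableEq (α l)]

lemma PK.attack [PolyCard χ] [PolyCard μ] {A : ∀ l, H l → Bits (χ l) → Op (μ l ⊕ α l)} (hA : PS A)
    {Λ : ∀ l, H l → Bits (χ l ⊕ μ l) → Op (α l ⊕ ι l) → Op (κ l)} (hΛ : PK Λ) :
    PK fun l h z (S : Op (ι l)) => attack (A l h z) (fun m => Λ l h (Sum.elim z m)) S := by
  have h1 := (PK.meas (PK.comp (PK.prepend (PS.of_pc (κ := μ) (PC.wires fun l _ i => Sum.inr i)))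
    hΛ)).comp ((PK.relabel fun l => (Equiv.sumAssoc (μ l) (α l) (ι l)).symm).comp
      (PK.prepend hA))
  have h2 : ∀ l h z (S : Op (ι l)) m, measL m (restrict (Equiv.sumAssoc (μ l) (α l) (ι l)).symm
      (tensor (A l h z) S)) = tensor (measL m (A l h z)) S := by
    intro l h z S m
    ext w w'
    have e : ∀ w : Bits (α l ⊕ ι l), (Sum.elim m w ∘ (Equiv.sumAssoc (μ l) (α l) (ι l)).symm.symm) ∘
        Sum.inl = Sum.elim m (w ∘ Sum.inl) := by
      intro w; funext i; rcases i with i | i <;> rfl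
    simp only [measL, Matrix.of_apply, restrict_equiv, tensor, e]
    rfl
  simp only [h2] at h1
  exact h1

end

/-! ### Linearity -/

section

variable {ι κ τ : Type} [Fintype ι] [DecidableEq ι] [Fintype κ] [DecidableEq κ] [Fintype τ]
  [DecidableEq τ]

lemma QCirc.isLinearMap (A : QCirc ι κ) : IsLinearMap ℂ A.run :=
  ⟨A.run_add, fun c ρ => A.run_smul c ρ⟩

lemma isLinearMap_tensor_right (ρ : Op ι) : IsLinearMap ℂ fun σ : Op κ => tensor ρ σ :=
  ⟨fun σ σ' => by ext; simp [tensor, mul_add], fun c σ => by ext; simp [tensor, mul_left_comm]⟩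

lemma isLinearMap_onLeft {Φ : Op ι → Op κ} (h : IsLinearMap ℂ Φ) :
    IsLinearMap ℂ fun ρ : Op (ι ⊕ τ) => onLeft Φ ρ :=
  ⟨fun ρ ρ' => by
    ext w w'
    rw [Matrix.add_apply, onLeft_apply, onLeft_apply, onLeft_apply, ← Matrix.add_apply,
      ← h.map_add]
    rfl,
  fun c ρ => by
    ext w w'
    simp only [onLeft_apply, Matrix.smul_apply]
    rw [← Matrix.smul_apply, ← h.map_smul]
    rfl⟩

lemma isLinearMap_onRight {Φ : Op ι → Op κ} (h : IsLinearMap ℂ Φ) :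
    IsLinearMap ℂ fun ρ : Op (τ ⊕ ι) => onRight Φ ρ :=
  ⟨fun ρ ρ' => by
    ext w w'
    simp only [UnclonableCrypto.onRight, Matrix.of_apply, Matrix.add_apply]
    rw [← Matrix.add_apply, ← h.map_add]
    rfl,
  fun c ρ => by
    ext w w'
    simp only [UnclonableCrypto.onRight, Matrix.of_apply, Matrix.smul_apply]
    rw [← Matrix.smul_apply, ← h.map_smul]
    rfl⟩

lemma isLinearMap_comp {M N P : Type*} [AddCommMonoid M] [AddCommMonoid N] [AddCommMonoid P]
    [Module ℂ M] [Module ℂ N] [Module ℂ P] {g : N → P} {f : M → N} (hg : IsLinearMap ℂ g)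
    (hf : IsLinearMap ℂ f) : IsLinearMap ℂ fun x => g (f x) :=
  ⟨fun x y => by rw [hf.map_add, hg.map_add], fun c x => by rw [hf.map_smul, hg.map_smul]⟩

/-- The outcome probabilities of a mixture of states are averages. -/
lemma prob_mixture {μ : Type} [Fintype μ] [DecidableEq μ] {Φ : Op ι → Op κ} (h : IsLinearMap ℂ Φ)
    (S : Bits μ → Op ι) (y : Bits κ) :
    prob (Φ (∑ r, ((2 : ℂ) ^ Fintype.card μ)⁻¹ • S r)) y = 𝔼 r, prob (Φ (S r)) y := by
  have h1 : Φ (∑ r, ((2 : ℂ) ^ Fintype.card μ)⁻¹ • S r) =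
      ∑ r, ((2 : ℂ) ^ Fintype.card μ)⁻¹ • Φ (S r) := by
    refine (map_sum (h.mk' Φ) (fun r => ((2 : ℂ) ^ Fintype.card μ)⁻¹ • S r) Finset.univ).trans ?_
    exact Finset.sum_congr rfl fun r _ => h.map_smul _ _
  rw [h1, prob, Matrix.sum_apply, Complex.re_sum, Fintype.expect_eq_sum_div_card, Finset.sum_div]
  refine Finset.sum_congr rfl fun r _ => ?_
  rw [prob, Matrix.smul_apply, Fintype.card_fun, Fintype.card_bool, smul_eq_mul, div_eq_inv_mul,
    show ((2 : ℂ) ^ Fintype.card μ)⁻¹ = ((((2 : ℝ) ^ Fintype.card μ)⁻¹ : ℝ) : ℂ) by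
      push_cast; rfl, Complex.re_ofReal_mul]
  push_cast
  rfl

lemma sum_prob_mixture_mul {μ : Type} [Fintype μ] [DecidableEq μ] (f : Bits μ → Bits ι)
    (g : Bits ι → ℝ) :
    ∑ y, prob (∑ r, ((2 : ℂ) ^ Fintype.card μ)⁻¹ • basis (f r)) y * g y = 𝔼 r, g (f r) := by
  have h : ∀ y, prob (∑ r, ((2 : ℂ) ^ Fintype.card μ)⁻¹ • basis (f r)) y =
      𝔼 r, if f r = y then 1 else 0 := by
    intro y
    refine (prob_mixture (Φ := fun ρ => ρ) ⟨fun _ _ => rfl, fun _ _ => rfl⟩ _ _).trans ?_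
    refine Finset.expect_congr rfl fun r _ => ?_
    simp only [prob, basis, Matrix.single_apply, and_self]
    split_ifs <;> rfl
  simp only [h, Finset.expect_mul]
  rw [← Finset.expect_sum_comm]
  simp

end

/-! ### Encryption schemes from classical and quantum components -/

section

variable {len : ℕ → ℕ} {κP κS GR ER CC : ℕ → Type}
  [∀ l, Fintype (κP l)] [∀ l, DecidableEq (κP l)] [∀ l, Fintype (κS l)] [∀ l, DecidableEq (κS l)]
  [∀ l, Fintype (GR l)] [∀ l, DecidableEq (GR l)] [∀ l, Fintype (ER l)] [∀ l, DecidableEq (ER l)]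
  [∀ l, Fintype (CC l)] [∀ l, DecidableEq (CC l)]

/-- Reordering of the registers of an adversary and of a ciphertext. -/
def attackEquiv (α κ ι ε : Type) (e : ε ≃ κ ⊕ ι) : α ⊕ ε ≃ κ ⊕ (α ⊕ ι) :=
  ((Equiv.sumCongr (Equiv.refl α) e).trans (Equiv.sumAssoc α κ ι).symm).trans
    ((Equiv.sumCongr (Equiv.sumComm α κ) (Equiv.refl ι)).trans (Equiv.sumAssoc κ α ι))

lemma restrict_attackEquiv {α κ ι ε : Type} [Fintype α] [DecidableEq α] [Fintype κ] [DecidableEq κ]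
    [Fintype ι] [DecidableEq ι] [Fintype ε] [DecidableEq ε] (e : ε ≃ κ ⊕ ι) (ρ : Op α) (σ : Op κ)
    (ω : Op ι) :
    restrict (attackEquiv α κ ι ε e) (tensor σ (tensor ρ ω)) =
      tensor ρ (restrict e (tensor σ ω)) := by
  ext w w'
  simp only [restrict_equiv, tensor, Matrix.of_apply]
  rw [mul_left_comm]
  rfl

lemma measL_restrict_symm {κ ι ε : Type} [Fintype κ] [DecidableEq κ] [Fintype ι] [DecidableEq ι]
    [Fintype ε] [DecidableEq ε] (e : ε ≃ κ ⊕ ι) (m c : Bits κ) (ρ : Op ι) :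
    measL m (restrict e.symm (restrict e (tensor (basis c) ρ))) = if m = c then ρ else 0 := by
  have h0 : restrict e.symm (restrict e (tensor (basis c) ρ)) = tensor (basis c) ρ := by
    ext w w'
    simp [restrict_equiv, Function.comp_assoc]
  rw [h0]
  ext z z'
  have h : ∀ z : Bits ι, (Sum.elim m z : Bits (κ ⊕ ι)) ∘ Sum.inl = m := fun z => rfl
  have h' : ∀ z : Bits ι, (Sum.elim m z : Bits (κ ⊕ ι)) ∘ Sum.inr = z := fun z => rfl
  simp only [measL, Matrix.of_apply, tensor, h, h', basis, Matrix.single_apply, and_self,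
    eq_comm (a := c)]
  split_ifs <;> simp

/-- An encryption scheme is given by classical algorithms for the keys and for the classical part of
the ciphertext, a quantum algorithm for the rest of the ciphertext, and a quantum algorithm for
decryption, all on arbitrary registers. -/
lemma exists_pkue [PolyCard κP] [PolyCard κS] [PolyCard GR] [PolyCard ER] [PolyCard CC]
    (hlen : PolyBdd len) {q : ℕ → ℕ} (hq : PolyBdd q)
    (genP : ∀ l, Bits (GR l) → Bits (κP l)) (hgenP : PC fun l (_ : Unit) => genP l)
    (genS : ∀ l, Bits (GR l) → Bits (κS l)) (hgenS : PC fun l (_ : Unit) => genS l)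
    (encC : ∀ l, Bits ((κP l ⊕ Fin (len l)) ⊕ ER l) → Bits (CC l))
    (hencC : PC fun l (_ : Unit) => encC l)
    (encQ : ∀ l, Bits (ER l) → Op (Fin (q l))) (hencQ : PS fun l (_ : Unit) => encQ l)
    (dec : ∀ l, Bits (κS l ⊕ CC l) → Op (Fin (q l)) → Op (Fin (len l)))
    (hdec : PK fun l (_ : Unit) => dec l)
    (hcor : ∃ δ : ℕ → ℝ, Negligible δ ∧ ∀ l g r msg, 1 - δ l ≤ prob (dec l (Sum.elim (genS l g)
      (encC l (Sum.elim (Sum.elim (genP l g) msg) r))) (encQ l r)) msg)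
    (hsec : ∀ (α β γ : ℕ → ℕ), PolyBdd α → PolyBdd β → PolyBdd γ →
      ∀ (A : ∀ l, Bits (κP l) → Op ((Fin (len l) ⊕ Fin (len l)) ⊕ Fin (α l)))
        (_ : PS fun l (_ : Unit) => A l)
        (Λ : ∀ l, Bits (CC l) → Op (Fin (α l) ⊕ Fin (q l)) → Op (Fin (β l) ⊕ Fin (γ l)))
        (_ : PK fun l (_ : Unit) => Λ l)
        (ΨB : ∀ l, Bits (κS l) → Op (Fin (β l)) → Op Unit)
        (_ : PK fun l (_ : Unit) => ΨB l)
        (ΨC : ∀ l, Bits (κS l) → Op (Fin (γ l)) → Op Unit)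
        (_ : PK fun l (_ : Unit) => ΨC l),
        ∃ ν : ℕ → ℝ, Negligible ν ∧ ∀ l, 𝔼 g, 𝔼 r, 𝔼 b : Bool,
          guessSum (fun _ => ΨB l (genS l g)) (fun _ => ΨC l (genS l g))
            (attack (A l (genP l g)) (fun m => Λ l (encC l (Sum.elim (Sum.elim (genP l g)
              fun i => m (if b then Sum.inr i else Sum.inl i)) r))) (encQ l r)) b ≤ 1 / 2 + ν l) :
    ∃ E : PKUE len, E.Correct ∧ E.Secure := by
  have hcl : PolyCard fun l => Fin (len l) := .fin hlen
  have hcq : PolyCard fun l => Fin (q l) := .fin hq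
  let eP : ∀ l, κP l ≃ Fin (Fintype.card (κP l)) := fun l => Fintype.equivFin _
  let eS : ∀ l, κS l ≃ Fin (Fintype.card (κS l)) := fun l => Fintype.equivFin _
  let eE : ∀ l, Fin (Fintype.card (CC l ⊕ Fin (q l))) ≃ CC l ⊕ Fin (q l) := fun l =>
    (Fintype.equivFin _).symm
  -- the ciphertext for fixed random bits
  let ctR : ∀ l, Bits (κP l) → Bits (Fin (len l)) → Bits (ER l) →
      Op (Fin (Fintype.card (CC l ⊕ Fin (q l)))) := fun l pk msg r =>
    restrict (eE l) (tensor (basis (encC l (Sum.elim (Sum.elim pk msg) r))) (encQ l r))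
  obtain ⟨Gen, hGen, hGenS⟩ := (PS.rand (H := fun _ => Unit) (χ := fun _ => Empty) (μ := GR)
    (κ := fun l => Fin (Fintype.card (κP l)) ⊕ Fin (Fintype.card (κS l)))
    (PS.of_pc (((hgenP.comp (PC.wires fun l _ i => Sum.inr i)).map_out fun l => (eP l).symm).pair
      ((hgenS.comp (PC.wires fun l _ i => Sum.inr i)).map_out fun l => (eS l).symm)))).exists_qpt
        fun _ => ()
  have hEncR : PS fun l (_ : Unit) (z : Bits ((Fin (Fintype.card (κP l)) ⊕ Fin (len l)) ⊕ ER l)) =>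
      ctR l (fun i => z (Sum.inl (Sum.inl (eP l i)))) (fun i => z (Sum.inl (Sum.inr i)))
        fun i => z (Sum.inr i) :=
    ((hencQ.pre (PC.wires fun l _ i => Sum.inr i)).bind (PK.prepend (PS.of_pc
      (hencC.comp (((PC.wires fun l _ i => Sum.inl (Sum.inl (eP l i))).pair
        (PC.wires fun l _ i => Sum.inl (Sum.inr i))).pair
          (PC.wires fun l _ i => Sum.inr i)))))).bind (PK.relabel fun l => eE l)
  obtain ⟨Enc, hEnc, hEncS⟩ := (PS.rand hEncR).exists_qpt fun _ => ()
  obtain ⟨Dec, hDec, hDecS⟩ := PK.exists_qpt (H := fun _ => Unit)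
    (χ := fun l => Fin (Fintype.card (κS l))) (ι := fun l => Fin (Fintype.card (CC l ⊕ Fin (q l))))
    (κ := fun l => Fin (len l))
    ((PK.meas (hdec.pre ((PC.wires fun l _ i => Sum.inl (eS l i)).pair
      (PC.wires fun l _ i => Sum.inr i)))).comp (PK.relabel fun l => (eE l).symm)) fun _ => ()
  let E : PKUE len := ⟨_, _, _, Gen, Enc, Dec, hGen, hEnc, hDec⟩
  have hkey : ∀ l (G : Bits (Fin (Fintype.card (κP l))) → Bits (Fin (Fintype.card (κS l))) → ℝ),
      ∑ pk, ∑ sk, E.keyProb l pk sk * G pk sk =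
        𝔼 g, G (genP l g ∘ (eP l).symm) (genS l g ∘ (eS l).symm) := by
    intro l G
    have h := sum_prob_mixture_mul (fun g : Bits (GR l) =>
      Sum.elim (genP l g ∘ (eP l).symm) (genS l g ∘ (eS l).symm))
      fun w => G (w ∘ Sum.inl) (w ∘ Sum.inr)
    rw [sum_bits_sum] at h
    simp only [Sum.elim_comp_inl, Sum.elim_comp_inr] at h
    rw [← h]
    refine Finset.sum_congr rfl fun pk _ => Finset.sum_congr rfl fun sk _ => ?_
    rw [PKUE.keyProb, prepare_eq, hGenS]
    rfl
  have hct : ∀ l pk msg, E.ct l (pk ∘ (eP l).symm) msg =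
      ∑ r, ((2 : ℂ) ^ Fintype.card (ER l))⁻¹ • ctR l pk msg r := by
    intro l pk msg
    rw [PKUE.ct, hEncS]
    refine Finset.sum_congr rfl fun r _ => ?_
    have e : (fun i => (pk ∘ (eP l).symm) (eP l i)) = pk := by funext i; simp
    change _ • ctR l (fun i => (pk ∘ (eP l).symm) (eP l i)) msg r = _
    rw [e]
  have hS : ∀ l g, (fun i => (genS l g ∘ (eS l).symm) (eS l i)) = genS l g := by
    intro l g; funext i; simp
  refine ⟨E, ?_, ?_⟩
  · obtain ⟨δ, hδ, h⟩ := hcor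
    refine ⟨δ, hδ, fun l msg => ?_⟩
    rw [hkey]
    refine Finset.le_expect Finset.univ_nonempty fun g _ => ?_
    rw [hct, prob_mixture (Φ := fun ρ => (Dec l).run (tensor (basis (genS l g ∘ (eS l).symm)) ρ))
      (isLinearMap_comp (Dec l).isLinearMap (isLinearMap_tensor_right _))]
    refine Finset.le_expect Finset.univ_nonempty fun r _ => (h l g r msg).trans (le_of_eq ?_)
    rw [hDecS, Finset.sum_eq_single (encC l (Sum.elim (Sum.elim (genP l g) msg) r))]
    · rw [measL_restrict_symm, if_pos rfl]
      change _ = prob (dec l (Sum.elim (fun i => (genS l g ∘ (eS l).symm) (eS l i)) _) _) _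
      rw [hS]
      rfl
    · intro m _ hm
      rw [measL_restrict_symm, if_neg hm]
      exact hdec.map_zero l () _
    · simp
  · intro A
    have hα := A.qptA₁.polyCard_out.right
    have hβ := A.qptA₂.polyCard_out.left
    have hγ := A.qptA₂.polyCard_out.right
    obtain ⟨ν, hν, h⟩ := hsec A.a A.β A.γ (by simpa using hα.poly) (by simpa using hβ.poly)
      (by simpa using hγ.poly)
      (fun l pk => (A.A₁ l).run (basis (pk ∘ (eP l).symm)))
      ((PS.of_qpt A.qptA₁).pre (PC.wires fun l _ => (eP l).symm))
      (fun l cc ρ => (A.A₂ l).run (restrict (attackEquiv _ _ _ _ (eE l)) (tensor (basis cc) ρ)))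
      ((PK.of_qpt A.qptA₂).comp ((PK.relabel fun l => attackEquiv _ _ _ _ (eE l)).comp
        (PK.prepend (PS.of_pc .id))))
      (fun l sk ρ => (A.B l).run (tensor (basis (sk ∘ (eS l).symm)) ρ))
      ((PK.of_ctrl A.qptB).pre (PC.wires fun l _ => (eS l).symm))
      (fun l sk ρ => (A.C l).run (tensor (basis (sk ∘ (eS l).symm)) ρ))
      ((PK.of_ctrl A.qptC).pre (PC.wires fun l _ => (eS l).symm))
    refine ⟨ν, hν, fun l => le_trans (le_of_eq ?_) (h l)⟩
    rw [PKUE.Adversary.winProb, hkey]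
    refine Finset.expect_congr rfl fun g _ => ?_
    have hr : ∀ m₀ m₁ b, guessProb (A.B l) (A.C l) (genS l g ∘ (eS l).symm)
        ((A.A₂ l).run (tensor (measL (Sum.elim m₀ m₁) ((A.A₁ l).run
          (basis (genP l g ∘ (eP l).symm))))
            (E.ct l (genP l g ∘ (eP l).symm) (if b then m₁ else m₀)))) b =
        𝔼 r, guessProb (A.B l) (A.C l) (genS l g ∘ (eS l).symm)
          ((A.A₂ l).run (tensor (measL (Sum.elim m₀ m₁) ((A.A₁ l).run
            (basis (genP l g ∘ (eP l).symm))))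
              (ctR l (genP l g) (if b then m₁ else m₀) r))) b := by
      intro m₀ m₁ b
      rw [hct]
      exact prob_mixture (Φ := fun σ => onRight
        (fun ρ => (A.C l).run (tensor (basis (genS l g ∘ (eS l).symm)) ρ))
        (onLeft (fun ρ => (A.B l).run (tensor (basis (genS l g ∘ (eS l).symm)) ρ))
          ((A.A₂ l).run (tensor (measL (Sum.elim m₀ m₁) ((A.A₁ l).run
            (basis (genP l g ∘ (eP l).symm)))) σ))))
        (isLinearMap_comp (isLinearMap_onRight (isLinearMap_comp (A.C l).isLinearMap
            (isLinearMap_tensor_right _)))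
          (isLinearMap_comp (isLinearMap_onLeft (isLinearMap_comp (A.B l).isLinearMap
              (isLinearMap_tensor_right _)))
            (isLinearMap_comp (A.A₂ l).isLinearMap (isLinearMap_tensor_right _)))) _ _
    simp only [hr, guessSum, sum_bits_sum, measL_attack, restrict_attackEquiv]
    rw [expect_comm (fun r (b : Bool) => _)]
    simp only [Finset.expect_sum_comm]
    refine Finset.sum_congr rfl fun m₀ _ => Finset.sum_congr rfl fun m₁ _ =>
      Finset.expect_congr rfl fun b _ => Finset.expect_congr rfl fun r _ => ?_
    cases b <;> rfl

end

section

/-! ### The encryption scheme -/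

/-- The index type of the outputs of the punctured function: two bits for each bit of the
message. -/
abbrev Idx (L : ℕ → ℕ) (l : ℕ) : Type := Fin (L l) × Bool

/-- The index type of the string `(x, c)` that a lock hides. -/
abbrev Wd (F : BitPRF) (L : ℕ → ℕ) (l : ℕ) : Type := Fin (F.n l) ⊕ Fin (L l)

variable {F : BitPRF} {L : ℕ → ℕ}

instance [PolyCard fun l => Fin (L l)] : PolyCard (Idx L) :=
  inferInstanceAs (PolyCard fun l => Fin (L l) × Bool)

instance [PolyCard fun l => Fin (L l)] : PolyCard (Wd F L) :=
  inferInstanceAs (PolyCard fun l => Fin (F.n l) ⊕ Fin (L l))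

instance [PolyCard fun l => Fin (L l)] : PolyCard (F.PKey (Wd F L)) :=
  inferInstanceAs (PolyCard fun l => (Wd F L l × Bool) × Fin (F.N l))

instance [PolyCard fun l => Fin (L l)] : PolyCard (F.SKey (Wd F L)) :=
  inferInstanceAs (PolyCard fun l => Wd F L l ⊕ (Wd F L l × Fin (F.r l)))

instance {δ ι κ : ℕ → Type} {f : ∀ l, Bits (δ l ⊕ ι l) → Bits (κ l)} (O : DataObf f) :
    PolyCard fun l => Fin (O.t l) := .fin O.t_poly

instance {δ ι κ : ℕ → Type} {f : ∀ l, Bits (δ l ⊕ ι l) → Bits (κ l)} (O : DataObf f) :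
    PolyCard fun l => Fin (O.r l) := .fin O.r_poly

/-- The codes are obfuscated programs; a key consists of the keys of the pseudorandom function and of
the random bits of the obfuscation. -/
def punctCode [PolyCard fun l => Fin (L l)] (O : DataObf (F.prog (I := Idx L))) :
    PunctCode F.n (Idx L) where
  t := O.t
  key l := (Idx L l × Fin (F.r l)) ⊕ Fin (O.r l)
  fkey _ := inferInstance
  key_poly := inferInstanceAs (PolyCard fun l => ((Idx L l) × Fin (F.r l)) ⊕ Fin (O.r l))
  t_poly := O.t_poly
  eval := O.eval
  code l k := O.obf l (Sum.elim (F.plainData fun p => k (Sum.inl p)) fun i => k (Sum.inr i))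
  pcode l z := O.obf l (Sum.elim (BitPRF.progData (fun p => z (Sum.inl (Sum.inl p)))
    (fun _ => false) true false (fun i => z (Sum.inr (Sum.inl (Sum.inl i))))
    (fun i => z (Sum.inr (Sum.inl (Sum.inr i)))) (fun i => z (Sum.inr (Sum.inr (Sum.inl i))))
    (fun i => z (Sum.inr (Sum.inr (Sum.inr i))))) fun i => z (Sum.inl (Sum.inr i)))
  eval_pc := O.eval_pc
  code_pc := O.obf_pc.comp ((((PC.wires fun _ _ p => Sum.inl p).pair (PC.const fun _ _ _ => false)).pair
    (PC.const fun _ _ => Sum.elim (Sum.elim (fun _ => false) fun _ => false)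
      (Sum.elim (Sum.elim (fun _ => false) fun _ => false)
        (Sum.elim (fun _ => false) fun _ => false)))).pair (PC.wires fun _ _ i => Sum.inr i))
  pcode_pc := O.obf_pc.comp ((((PC.wires fun _ _ p => Sum.inl (Sum.inl p)).pair
    (PC.const fun _ _ _ => false)).pair ((PC.const fun _ _ => Sum.elim (fun _ => true)
      fun _ => false).pair (((PC.wires fun _ _ i => Sum.inr (Sum.inl (Sum.inl i))).pair
        (PC.wires fun _ _ i => Sum.inr (Sum.inl (Sum.inr i)))).pair
          ((PC.wires fun _ _ i => Sum.inr (Sum.inr (Sum.inl i))).pair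
            (PC.wires fun _ _ i => Sum.inr (Sum.inr (Sum.inr i))))))).pair
              (PC.wires fun _ _ i => Sum.inl (Sum.inr i)))
  eval_pcode l k xB xC yB yC x := by
    rw [O.correct, O.correct]
    funext i
    simp only [Sum.elim_inl, Sum.elim_inr, BitPRF.plainData]
    rw [BitPRF.prog_progData]
    by_cases h1 : x = xB
    · simp [h1]
    · by_cases h2 : x = xC
      · subst h2; simp [h1]
      · simp only [h1, h2, if_false, and_false]
        rw [BitPRF.prog_progData]
        simp

/-- The bits of `y` selected by `σ`. -/
def sel {l : ℕ} (y : Bits (Idx L l)) (σ : Bits (Fin (L l))) : Bits (Fin (L l)) :=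
  fun i => y (i, σ i)

lemma sel_eq {l : ℕ} (y : Bits (Idx L l)) (σ : Bits (Fin (L l))) (i : Fin (L l)) :
    sel y σ i = bif σ i then y (i, true) else y (i, false) := by
  rw [sel]; cases σ i <;> rfl

variable [PolyCard fun l => Fin (L l)] (O₁ : DataObf (F.prog (I := Idx L)))
  (O₂ : DataObf (F.lock (W := Wd F L)))

/-- The random bits of key generation: the string `v` and the seeds. -/
abbrev GenR (F : BitPRF) (L : ℕ → ℕ) (l : ℕ) : Type :=
  Wd F L l ⊕ ((Wd F L l × Bool) × Fin (F.r l))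

/-- The random bits of encryption: the string `(x, c)`, the key of the punctured program, the string
`σ`, and the random bits of the obfuscation of the lock. -/
abbrev EncR (l : ℕ) : Type :=
  (Wd F L l ⊕ (((Idx L l × Fin (F.r l)) ⊕ Fin (O₁.r l)) ⊕ Fin (L l))) ⊕ Fin (O₂.r l)

/-- The classical part of a ciphertext: the obfuscated lock, `σ`, and the masked message. -/
abbrev CtC (l : ℕ) : Type := Fin (O₂.t l) ⊕ (Fin (L l) ⊕ Fin (L l))

instance : PolyCard (GenR F L) :=
  inferInstanceAs (PolyCard fun l => Wd F L l ⊕ ((Wd F L l × Bool) × Fin (F.r l)))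

instance : PolyCard (EncR O₁ O₂) :=
  inferInstanceAs (PolyCard fun l =>
    (Wd F L l ⊕ (((Idx L l × Fin (F.r l)) ⊕ Fin (O₁.r l)) ⊕ Fin (L l))) ⊕ Fin (O₂.r l))

instance : PolyCard (CtC O₂) :=
  inferInstanceAs (PolyCard fun l => Fin (O₂.t l) ⊕ (Fin (L l) ⊕ Fin (L l)))

/-- The seeds among the random bits of key generation. -/
def seeds {l : ℕ} (g : Bits (GenR F L l)) : Wd F L l → Bool → Bits (Fin (F.r l)) :=
  fun i b j => g (Sum.inr ((i, b), j))

/-- The classical part of a ciphertext; the message is masked with `c` and with the bits of `F_K(x)`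
selected by `σ`. -/
def encC (l : ℕ) (z : Bits ((F.PKey (Wd F L) l ⊕ Fin (L l)) ⊕ EncR O₁ O₂ l)) :
    Bits (CtC O₂ l) :=
  Sum.elim
    (O₂.obf l (Sum.elim (Sum.elim (fun p => z (Sum.inl (Sum.inl p)))
      (Sum.elim (fun w => z (Sum.inr (Sum.inl (Sum.inl w)))) fun _ => false))
      fun i => z (Sum.inr (Sum.inr i))))
    (Sum.elim (fun i => z (Sum.inr (Sum.inl (Sum.inr (Sum.inr i)))))
      fun i => Bool.xor (z (Sum.inl (Sum.inr i))) (Bool.xor (z (Sum.inr (Sum.inl (Sum.inl (Sum.inr i)))))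
        (sel (F.fAll (fun p => z (Sum.inr (Sum.inl (Sum.inr (Sum.inl (Sum.inl p))))))
          fun j => z (Sum.inr (Sum.inl (Sum.inl (Sum.inl j)))))
          (fun i => z (Sum.inr (Sum.inl (Sum.inr (Sum.inr i))))) i)))

lemma encC_pc : PC fun l (_ : Unit) => encC O₁ O₂ l := by
  refine (O₂.obf_pc.comp (((PC.wires fun _ _ p => Sum.inl (Sum.inl p)).pair
    ((PC.wires fun _ _ w => Sum.inr (Sum.inl (Sum.inl w))).pair (PC.const fun _ _ _ => false))).pair
      (PC.wires fun _ _ i => Sum.inr (Sum.inr i)))).pair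
    ((PC.wires fun _ _ i => Sum.inr (Sum.inl (Sum.inr (Sum.inr i)))).pair
      (PC.pi PolyCard.poly (PB.xor (PB.var _) (PB.xor (PB.var _) ?_))))
  have hf : PC fun l (_ : Unit × Fin (L l))
      (z : Bits ((F.PKey (Wd F L) l ⊕ Fin (L l)) ⊕ EncR O₁ O₂ l)) =>
      F.fAll (I := Idx L) (fun p => z (Sum.inr (Sum.inl (Sum.inr (Sum.inl (Sum.inl p))))))
        fun j => z (Sum.inr (Sum.inl (Sum.inl (Sum.inl j)))) :=
    (F.fAll_pc.reparam fun _ _ => ()).comp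
      ((PC.wires fun _ _ p => Sum.inr (Sum.inl (Sum.inr (Sum.inl (Sum.inl p))))).pair
        (PC.wires fun _ _ j => Sum.inr (Sum.inl (Sum.inl (Sum.inl j)))))
  simp only [sel_eq]
  exact PB.cond (PB.var fun l (h : Unit × Fin (L l)) => Sum.inr (Sum.inl (Sum.inr (Sum.inr h.2))))
    (PB.apply hf fun l (h : Unit × Fin (L l)) => (h.2, true))
    (PB.apply hf fun l (h : Unit × Fin (L l)) => (h.2, false))

variable (U : CodeUPO (punctCode O₁))

/-- The quantum part of a ciphertext. -/
def encQ (l : ℕ) (r : Bits (EncR O₁ O₂ l)) : Op (Fin (U.q l)) :=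
  U.obf l ((punctCode O₁).code l fun i => r (Sum.inl (Sum.inr (Sum.inl i))))

/-- Decryption: the lock yields `(x, c)`, evaluation at `x` yields `F_K(x)`, and the two masks are
removed. -/
def decr (l : ℕ) (z : Bits (F.SKey (Wd F L) l ⊕ CtC O₂ l)) (ρ : Op (Fin (U.q l))) :
    Op (Fin (L l)) :=
  clas (fun y i => Bool.xor (z (Sum.inr (Sum.inr (Sum.inr i))))
    (Bool.xor (O₂.eval l (Sum.elim (fun j => z (Sum.inr (Sum.inl j))) fun j => z (Sum.inl j))
      (Sum.inr i)) (sel y (fun j => z (Sum.inr (Sum.inr (Sum.inl j)))) i)))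
    (U.dec l (fun i => O₂.eval l (Sum.elim (fun j => z (Sum.inr (Sum.inl j)))
      fun j => z (Sum.inl j)) (Sum.inl i)) ρ)

lemma decr_pk : PK fun l (_ : Unit) => decr O₁ O₂ U l := by
  have ho : ∀ {H : ℕ → Type}, PC fun l (_ : H l) (z : Bits (F.SKey (Wd F L) l ⊕ CtC O₂ l)) =>
      O₂.eval l (Sum.elim (fun j => z (Sum.inr (Sum.inl j))) fun j => z (Sum.inl j)) :=
    (O₂.eval_pc.reparam fun _ _ => ()).comp ((PC.wires fun _ _ j => Sum.inr (Sum.inl j)).pair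
      (PC.wires fun _ _ j => Sum.inl j))
  have hcl : PC fun l (_ : Unit) (z : Bits ((F.SKey (Wd F L) l ⊕ CtC O₂ l) ⊕ Idx L l)) i =>
      Bool.xor (z (Sum.inl (Sum.inr (Sum.inr (Sum.inr i)))))
        (Bool.xor (O₂.eval l (Sum.elim (fun j => z (Sum.inl (Sum.inr (Sum.inl j))))
          fun j => z (Sum.inl (Sum.inl j))) (Sum.inr i))
          (sel (fun j => z (Sum.inr j)) (fun j => z (Sum.inl (Sum.inr (Sum.inr (Sum.inl j))))) i)) := by
    refine PC.pi PolyCard.poly (PB.xor (PB.var _) (PB.xor ?_ ?_))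
    · exact PB.apply ((ho (H := fun l => Unit × Fin (L l))).comp (PC.wires fun _ _ j => Sum.inl j))
        fun l (h : Unit × Fin (L l)) => Sum.inr h.2
    · simp only [sel_eq]
      exact PB.cond (PB.var _) (PB.var fun l (h : Unit × Fin (L l)) => Sum.inr (h.2, true))
        (PB.var fun l (h : Unit × Fin (L l)) => Sum.inr (h.2, false))
  exact (PK.clas hcl).comp (U.dec_pk.pre (ho.map_out fun _ i => Sum.inl i))

lemma decr_correct {l : ℕ} (g : Bits (GenR F L l)) (r : Bits (EncR O₁ O₂ l))
    (msg : Bits (Fin (L l))) (δ : ℝ)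
    (hδ : ∀ k x, 1 - δ ≤ prob (U.dec l x (U.obf l ((punctCode O₁).code l k)))
      ((punctCode O₁).eval l (Sum.elim ((punctCode O₁).code l k) x))) :
    1 - δ ≤ prob (decr O₁ O₂ U l (Sum.elim (BitPRF.skOf (seeds g) fun w => g (Sum.inl w))
      (encC O₁ O₂ l (Sum.elim (Sum.elim (BitPRF.pkOf (seeds g)) msg) r))) (encQ O₁ O₂ U l r)) msg := by
  set z := Sum.elim (BitPRF.skOf (seeds g) fun w => g (Sum.inl w))
    (encC O₁ O₂ l (Sum.elim (Sum.elim (BitPRF.pkOf (seeds g)) msg) r)) with hz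
  -- the lock opens
  have ho : O₂.eval l (Sum.elim (fun j => z (Sum.inr (Sum.inl j))) fun j => z (Sum.inl j)) =
      fun w => r (Sum.inl (Sum.inl w)) :=
    (O₂.correct l _ _ _).trans (BitPRF.lock_correct (seeds g) _ _)
  set k : Bits ((Idx L l × Fin (F.r l)) ⊕ Fin (O₁.r l)) := fun i => r (Sum.inl (Sum.inr (Sum.inl i)))
    with hk
  set x : Bits (Fin (F.n l)) := fun j => r (Sum.inl (Sum.inl (Sum.inl j))) with hx
  have hv : (punctCode O₁).eval l (Sum.elim ((punctCode O₁).code l k) x) =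
      F.fAll (fun p => k (Sum.inl p)) x := by
    refine (O₁.correct l _ _ _).trans ?_
    funext i
    rw [BitPRF.plainData, BitPRF.prog_progData]
    simp [BitPRF.fAll]
  refine (hδ k x).trans ?_
  rw [hv, decr, ho, prob_clas]
  have hn : ∀ y, 0 ≤ prob (U.dec l x (U.obf l ((punctCode O₁).code l k))) y := fun y => by
    have hct : PolyCard fun l => Fin ((punctCode O₁).t l) := .fin (punctCode O₁).t_poly
    obtain ⟨_, -, h⟩ := (U.obf_ps.pre (PC.wires (ι := fun l => Fin (F.n l) ⊕
      Fin ((punctCode O₁).t l)) fun _ _ j => Sum.inr j)).bind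
        (U.dec_pk.pre (PC.wires fun _ _ j => Sum.inl j))
    obtain ⟨A, -, hA⟩ := h l ()
    have h := A.prob_nonneg (Sum.elim x ((punctCode O₁).code l k)) y
    rwa [hA] at h
  refine le_trans ?_ (Finset.single_le_sum (f := fun y => if (fun i =>
      Bool.xor (z (Sum.inr (Sum.inr (Sum.inr i)))) (Bool.xor (r (Sum.inl (Sum.inl (Sum.inr i))))
        (sel y (fun j => z (Sum.inr (Sum.inr (Sum.inl j)))) i))) = msg then
      prob (U.dec l x (U.obf l ((punctCode O₁).code l k))) y else 0) (fun y _ => ?_)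
    (Finset.mem_univ (F.fAll (fun p => k (Sum.inl p)) x)))
  · refine le_of_eq (Eq.symm (if_pos ?_))
    funext i
    simp only [hz, Sum.elim_inl, Sum.elim_inr, encC]
    have h : ∀ a b c : Bool, Bool.xor (Bool.xor a (Bool.xor b c)) (Bool.xor b c) = a := by decide
    exact h _ _ _
  · exact ite_nonneg (hn y) le_rfl

end

/-! ### The security game -/

/-- An adversary against a scheme with public keys `κP`, secret keys `κS` and ciphertexts that
consist of the bits `CC` and of `q` qubits. The state `A` holds the two messages and a quantum state;
the channel `Λ` splits a ciphertext, and `ΨB` and `ΨC` are the guesses of the two parties. -/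
structure Adv (L : ℕ → ℕ) (κP κS CC : ℕ → Type) (q : ℕ → ℕ) [∀ l, Fintype (κP l)]
    [∀ l, DecidableEq (κP l)] [∀ l, Fintype (κS l)] [∀ l, DecidableEq (κS l)]
    [∀ l, Fintype (CC l)] [∀ l, DecidableEq (CC l)] where
  α : ℕ → ℕ
  β : ℕ → ℕ
  γ : ℕ → ℕ
  hβ : PolyBdd β
  hγ : PolyBdd γ
  A : ∀ l, Bits (κP l) → Op ((Fin (L l) ⊕ Fin (L l)) ⊕ Fin (α l))
  hA : PS fun l (_ : Unit) => A l
  Λ : ∀ l, Bits (CC l) → Op (Fin (α l) ⊕ Fin (q l)) → Op (Fin (β l) ⊕ Fin (γ l))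
  hΛ : PK fun l (_ : Unit) => Λ l
  ΨB : ∀ l, Bits (κS l) → Op (Fin (β l)) → Op Unit
  hB : PK fun l (_ : Unit) => ΨB l
  ΨC : ∀ l, Bits (κS l) → Op (Fin (γ l)) → Op Unit
  hC : PK fun l (_ : Unit) => ΨC l

namespace Adv

section

variable {L q : ℕ → ℕ} {κP κS CC : ℕ → Type} [∀ l, Fintype (κP l)]
  [∀ l, DecidableEq (κP l)] [∀ l, Fintype (κS l)] [∀ l, DecidableEq (κS l)]
  [∀ l, Fintype (CC l)] [∀ l, DecidableEq (CC l)] (𝒜 : Adv L κP κS CC q)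

/-- The probability that both parties guess `b`, where the secret key and the classical part of the
ciphertext may depend on the messages. -/
def game (l : ℕ) (pk : Bits (κP l)) (sk : Bits (Fin (L l) ⊕ Fin (L l)) → Bits (κS l))
    (cc : Bits (Fin (L l) ⊕ Fin (L l)) → Bits (CC l)) (S : Op (Fin (q l))) (b : Bool) : ℝ :=
  guessSum (fun m => 𝒜.ΨB l (sk m)) (fun m => 𝒜.ΨC l (sk m))
    (attack (𝒜.A l pk) (fun m => 𝒜.Λ l (cc m)) S) b

/-- The contribution of the messages `m`. -/
def term (l : ℕ) (pk : Bits (κP l)) (m : Bits (Fin (L l) ⊕ Fin (L l))) (sk : Bits (κS l))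
    (cc : Bits (CC l)) (S : Op (Fin (q l))) (b : Bool) : ℝ :=
  prob (onRight (𝒜.ΨC l sk) (onLeft (𝒜.ΨB l sk) (𝒜.Λ l cc (tensor (measL m (𝒜.A l pk)) S))))
    fun _ => b

lemma game_eq_sum (l : ℕ) (pk : Bits (κP l)) (sk : Bits (Fin (L l) ⊕ Fin (L l)) → Bits (κS l))
    (cc : Bits (Fin (L l) ⊕ Fin (L l)) → Bits (CC l)) (S : Op (Fin (q l))) (b : Bool) :
    𝒜.game l pk sk cc S b = ∑ m, 𝒜.term l pk m (sk m) (cc m) S b := by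
  simp only [game, guessSum, measL_attack, term]

variable {H χ : ℕ → Type} [∀ l, Fintype (χ l)] [∀ l, DecidableEq (χ l)]
  [PolyCard fun l => Fin (L l)] [PolyCard κP] [PolyCard κS] [PolyCard CC] [PolyCard χ]

lemma attack_pk {pk : ∀ l, H l → Bits (χ l) → Bits (κP l)} (hpk : PC pk)
    {cc : ∀ l, H l → Bits (χ l ⊕ (Fin (L l) ⊕ Fin (L l))) → Bits (CC l)} (hcc : PC cc) :
    PK fun l h z => attack (𝒜.A l (pk l h z)) fun m => 𝒜.Λ l (cc l h (Sum.elim z m)) :=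
  PK.attack ((𝒜.hA.reparam fun _ _ => ()).pre hpk)
    (Λ := fun l h z => 𝒜.Λ l (cc l h z)) ((𝒜.hΛ.reparam fun _ _ => ()).pre hcc)

lemma game_pp {pk : ∀ l, H l → Bits (χ l) → Bits (κP l)} (hpk : PC pk)
    {sk : ∀ l, H l → Bits (χ l ⊕ (Fin (L l) ⊕ Fin (L l))) → Bits (κS l)} (hsk : PC sk)
    {cc : ∀ l, H l → Bits (χ l ⊕ (Fin (L l) ⊕ Fin (L l))) → Bits (CC l)} (hcc : PC cc)
    {S : ∀ l, H l → Bits (χ l) → Op (Fin (q l))} (hS : PS S)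
    {b : ∀ l, H l → Bits (χ l) → Bool} (hb : PB b) :
    PP fun l h z => 𝒜.game l (pk l h z) (fun m => sk l h (Sum.elim z m))
      (fun m => cc l h (Sum.elim z m)) (S l h z) (b l h z) :=
  PP.guessSum (hS.bind (𝒜.attack_pk hpk hcc))
    (ΨB := fun l h z => 𝒜.ΨB l (sk l h z)) ((𝒜.hB.reparam fun _ _ => ()).pre hsk)
    (ΨC := fun l h z => 𝒜.ΨC l (sk l h z)) ((𝒜.hC.reparam fun _ _ => ()).pre hsk) hb

end

end Adv

/-- The sum of two strings. -/
abbrev bxor {ι : Type} (a b : Bits ι) : Bits ι := fun i => Bool.xor (a i) (b i)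

lemma expect_bxor {ι : Type} [Fintype ι] [DecidableEq ι] (a : Bits ι) (g : Bits ι → ℝ) :
    𝔼 v, g (bxor a v) = 𝔼 v, g v :=
  Fintype.expect_equiv ⟨bxor a, bxor a, fun v => by funext i; simp [bxor],
    fun v => by funext i; simp [bxor]⟩ _ _ fun _ => rfl

lemma expect_prod_eq {A B : Type*} [Fintype A] [Fintype B] (g : A → B → ℝ) :
    𝔼 a, 𝔼 b, g a b = 𝔼 p : A × B, g p.1 p.2 := (expect_prod fun p : A × B => g p.1 p.2).symm

section

variable {H χ κ : ℕ → Type} [∀ l, Fintype (χ l)] [∀ l, DecidableEq (χ l)]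
  [∀ l, Fintype (κ l)] [∀ l, DecidableEq (κ l)]

lemma PC.bxor [PolyCard κ] {f g : ∀ l, H l → Bits (χ l) → Bits (κ l)} (hf : PC f) (hg : PC g) :
    PC fun l h z => bxor (f l h z) (g l h z) :=
  PC.pi PolyCard.poly (PB.xor
    (PB.apply (hf.reparam fun l (h : H l × κ l) => h.1) fun l (h : H l × κ l) => h.2)
    (PB.apply (hg.reparam fun l (h : H l × κ l) => h.1) fun l (h : H l × κ l) => h.2))

variable {F : BitPRF} {L : ℕ → ℕ} [PolyCard fun l => Fin (L l)]

lemma PC.sel {y : ∀ l, H l → Bits (χ l) → Bits (Idx L l)} (hy : PC y)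
    {σ : ∀ l, H l → Bits (χ l) → Bits (Fin (L l))} (hσ : PC σ) :
    PC fun l h z => sel (y l h z) (σ l h z) := by
  refine PC.pi PolyCard.poly ?_
  simp only [sel_eq]
  have hy' := hy.reparam fun l (h : H l × Fin (L l)) => h.1
  exact PB.cond (PB.apply (hσ.reparam fun l (h : H l × Fin (L l)) => h.1)
    fun l (h : H l × Fin (L l)) => h.2) (PB.apply hy' fun l (h : H l × Fin (L l)) => (h.2, true))
    (PB.apply hy' fun l (h : H l × Fin (L l)) => (h.2, false))

lemma PC.skOf {W : ℕ → Type} [∀ l, Fintype (W l)] [∀ l, DecidableEq (W l)] [PolyCard W]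
    (s : ∀ l, H l → W l → Bool → Bits (Fin (F.r l))) {v : ∀ l, H l → Bits (χ l) → Bits (W l)}
    (hv : PC v) : PC fun l h z => BitPRF.skOf (F := F) (s l h) (v l h z) := by
  refine hv.pair (PC.pi (κ := fun l => W l × Fin (F.r l)) PolyCard.poly ?_)
  refine (PB.cond (PB.apply (hv.reparam fun l (h : H l × (W l × Fin (F.r l))) => h.1)
    fun l (h : H l × (W l × Fin (F.r l))) => h.2.1)
    (PB.const fun l (h : H l × (W l × Fin (F.r l))) => s l h.1 h.2.1 true h.2.2)
    (PB.const fun l (h : H l × (W l × Fin (F.r l))) => s l h.1 h.2.1 false h.2.2)).congr ?_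
  intro l h z
  cases hh : v l h.1 z h.2.1 <;> simp

end

/-! ### The hybrid games -/

section

variable {F : BitPRF} {L : ℕ → ℕ} [PolyCard fun l => Fin (L l)]
  {O₁ : DataObf (F.prog (I := Idx L))} {O₂ : DataObf (F.lock (W := Wd F L))}
  {U : CodeUPO (punctCode O₁)}
  (𝒜 : Adv L (F.PKey (Wd F L)) (F.SKey (Wd F L)) (CtC O₂) U.q)

/-- The message that is encrypted for the bit `b`. -/
def msg {l : ℕ} (b : Bool) (m : Bits (Fin (L l) ⊕ Fin (L l))) : Bits (Fin (L l)) :=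
  fun i => m (if b then Sum.inr i else Sum.inl i)

/-- The sum of the two messages if `b` is `0`, and zero otherwise. In the encryption of message `b`,
the selecting string `σ` is written as the sum of this and of a uniform string `ρ`. -/
def offset {l : ℕ} (b : Bool) (m : Bits (Fin (L l) ⊕ Fin (L l))) : Bits (Fin (L l)) :=
  if b then fun _ => false else bxor (msg false m) (msg true m)

/-- The string with the bits `ρ i ⊕ β`. -/
def twist {l : ℕ} (ρ : Bits (Fin (L l))) : Bits (Idx L l) := fun p => Bool.xor (ρ p.1) p.2

lemma sel_twist {l : ℕ} (u : Bits (Idx L l)) (ρ : Bits (Fin (L l)))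
    (m : Bits (Fin (L l) ⊕ Fin (L l))) :
    bxor (msg false m) (sel (bxor u (twist ρ)) (bxor (offset false m) ρ)) =
      bxor (msg true m) (sel u (bxor (offset false m) ρ)) := by
  funext i
  have h : ∀ a b c d : Bool, Bool.xor a (Bool.xor d (Bool.xor c (Bool.xor (Bool.xor a b) c))) =
    Bool.xor b d := by decide
  exact h _ _ _ _

/-- The quantum part of a ciphertext, as a function of the obfuscated program. -/
def stateOf (U : CodeUPO (punctCode O₁)) (l : ℕ) (d : Bits (Fin (O₁.t l))) : Op (Fin (U.q l)) :=
  U.obf l d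

lemma stateOf_ps : PS fun l (_ : Unit) => stateOf U l := U.obf_ps

/-- The security game for `msg b`, where `q` is the obfuscated lock with string `y` and the public
key with the seeds `s`. -/
def trial (l : ℕ) (b : Bool) (s : Wd F L l → Bool → Bits (Fin (F.r l))) (v : Bits (Wd F L l))
    (q : Bits (Fin (O₂.t l))) (y : Bits (Wd F L l)) (K : Bits (Idx L l × Fin (F.r l)))
    (ω : Bits (Fin (O₁.r l))) (σ : Bits (Fin (L l))) : ℝ :=
  𝒜.game l (BitPRF.pkOf s) (fun _ => BitPRF.skOf s v)
    (fun m => Sum.elim q (Sum.elim σ (bxor (msg b m) (bxor (fun i => y (Sum.inr i))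
      (sel (F.fAll K fun j => y (Sum.inl j)) σ)))))
    (stateOf U l (O₁.obf l (Sum.elim (F.plainData K) ω))) b

/-- The game in which the masked message is a uniform string `e`, and the string `c` hidden in the
secret key is determined by `e`, the message `msg w m`, and the mask selected from `y`. -/
def view (l : ℕ) (w : Bool) (s : Wd F L l → Bool → Bits (Fin (F.r l))) (t : Bits (Wd F L l))
    (q : Bits (Fin (O₂.t l))) (e ρ : Bits (Fin (L l))) (x : Bits (Fin (F.n l)))
    (y : Bits (Idx L l)) (S : Op (Fin (U.q l))) (b : Bool) : ℝ :=
  𝒜.game l (BitPRF.pkOf s) (fun m => BitPRF.skOf s (bxor t (Sum.elim x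
      (bxor e (bxor (msg w m) (sel y (bxor (offset w m) ρ)))))))
    (fun m => Sum.elim q (Sum.elim (bxor (offset w m) ρ) e)) S b

lemma expect_comm₄ {A B C D : Type*} [Fintype A] [Fintype B] [Fintype C] [Fintype D]
    (f : A → B → C → D → ℝ) :
    𝔼 a, 𝔼 b, 𝔼 c, 𝔼 d, f a b c d = 𝔼 b, 𝔼 d, 𝔼 c, 𝔼 a, f a b c d := by
  simp only [expect_prod_eq]
  exact Fintype.expect_equiv ⟨fun p => (p.2.1, p.2.2.2, p.2.2.1, p.1),
    fun p => (p.2.2.2, p.1, p.2.2.1, p.2.1), fun _ => rfl, fun _ => rfl⟩ _ _ fun _ => rfl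

/-- If the values at `x` are shifted by `twist ρ`, then an encryption of the first message becomes an
encryption of the second one: the bits selected by `ρ ⊕ m₀ ⊕ m₁` change by `m₀ ⊕ m₁`. -/
lemma expect_view_twist (l : ℕ) (s : Wd F L l → Bool → Bits (Fin (F.r l))) (t : Bits (Wd F L l))
    (q : Bits (Fin (O₂.t l))) (e : Bits (Fin (L l))) (x : Bits (Fin (F.n l)))
    (u : Bits (Idx L l)) (S : Op (Fin (U.q l))) (b : Bool) :
    𝔼 ρ, view 𝒜 l false s t q e ρ x (bxor u (twist ρ)) S b =
      𝔼 ρ, view 𝒜 l true s t q e ρ x u S b := by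
  simp only [view, Adv.game_eq_sum, sel_twist]
  rw [Finset.expect_sum_comm, Finset.expect_sum_comm]
  refine Finset.sum_congr rfl fun m _ => ?_
  have h := fun a => expect_bxor a fun τ => 𝒜.term l (BitPRF.pkOf s) m
    (BitPRF.skOf s (bxor t (Sum.elim x (bxor e (bxor (msg true m) (sel u τ))))))
    (Sum.elim q (Sum.elim τ e)) S b
  exact (h _).trans (h _).symm

/-- For fixed messages, `c` is uniform if and only if the masked message is. -/
lemma expect_trial (l : ℕ) (b : Bool) (s : Wd F L l → Bool → Bits (Fin (F.r l)))
    (t : Bits (Wd F L l)) (q : Bits (Fin (O₂.t l))) (x : Bits (Fin (F.n l)))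
    (K : Bits (Idx L l × Fin (F.r l))) (ω : Bits (Fin (O₁.r l))) :
    𝔼 σ, 𝔼 c, trial 𝒜 l b s (bxor t (Sum.elim x c)) q (Sum.elim x c) K ω σ =
      𝔼 ρ, 𝔼 e, view 𝒜 l b s t q e ρ x (F.fAll K x)
        (stateOf U l (O₁.obf l (Sum.elim (F.plainData K) ω))) b := by
  simp only [view, trial, Adv.game_eq_sum, Finset.expect_sum_comm]
  refine Finset.sum_congr rfl fun m _ => ?_
  have h := expect_bxor (offset b m) fun σ => 𝔼 e, 𝒜.term l (BitPRF.pkOf s) m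
    (BitPRF.skOf s (bxor t (Sum.elim x (bxor e (bxor (msg b m) (sel (F.fAll K x) σ))))))
    (Sum.elim q (Sum.elim σ e)) (stateOf U l (O₁.obf l (Sum.elim (F.plainData K) ω))) b
  refine Eq.trans (Finset.expect_congr rfl fun σ _ => ?_) h.symm
  have h' := expect_bxor (bxor (msg b m) (sel (F.fAll K x) σ)) fun c => 𝒜.term l (BitPRF.pkOf s) m
    (BitPRF.skOf s (bxor t (Sum.elim x c)))
    (Sum.elim q (Sum.elim σ (bxor (msg b m) (bxor c (sel (F.fAll K x) σ)))))
    (stateOf U l (O₁.obf l (Sum.elim (F.plainData K) ω))) b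
  refine Eq.trans h'.symm (Finset.expect_congr rfl fun e _ => ?_)
  have e1 : bxor (bxor (msg b m) (sel (F.fAll K x) σ)) e =
      bxor e (bxor (msg b m) (sel (F.fAll K x) σ)) := by
    funext i; exact Bool.xor_comm _ _
  have e2 : bxor (msg b m) (bxor (bxor e (bxor (msg b m) (sel (F.fAll K x) σ)))
      (sel (F.fAll K x) σ)) = e := by
    have h : ∀ a b c : Bool, Bool.xor a (Bool.xor (Bool.xor b (Bool.xor a c)) c) = b := by decide
    funext i; exact h _ _ _
  rw [e1, e2]

lemma msg_pc {H χ : ℕ → Type} (b : ∀ l, H l → Bool) :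
    PC fun l h (z : Bits (χ l ⊕ (Fin (L l) ⊕ Fin (L l)))) => msg (b l h) fun i => z (Sum.inr i) :=
  PC.wires fun l h i => Sum.inr (if b l h then Sum.inr i else Sum.inl i)

lemma offset_pc {H χ : ℕ → Type} (b : Bool) :
    PC fun l (_ : H l) (z : Bits (χ l ⊕ (Fin (L l) ⊕ Fin (L l)))) =>
      offset b fun i => z (Sum.inr i) := by
  cases b
  · exact PC.pi PolyCard.poly (PB.xor
      (PB.apply (msg_pc fun _ _ => false) fun l (h : H l × Fin (L l)) => h.2)
      (PB.apply (msg_pc fun _ _ => true) fun l (h : H l × Fin (L l)) => h.2))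
  · exact PC.const fun l h _ => false

/-- The string in the lock can be masked with `v`. -/
lemma exists_trial_lock : ∃ ν : ℕ → ℝ, Negligible ν ∧ ∀ l b y K ω σ v,
    |(𝔼 s, 𝔼 ω', trial 𝒜 l b s v
        (O₂.obf l (Sum.elim (Sum.elim (BitPRF.pkOf s) (Sum.elim y fun _ => false)) ω')) y K ω σ) -
      𝔼 s, 𝔼 ω', trial 𝒜 l b s v
        (O₂.obf l (Sum.elim (Sum.elim (BitPRF.pkOf s) (Sum.elim (bxor y v) fun _ => true)) ω'))
          y K ω σ| ≤ ν l := by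
  let H : ℕ → Type := fun l => Bool × Bits (Wd F L l) × Bits (Idx L l × Fin (F.r l)) ×
    Bits (Fin (O₁.r l)) × Bits (Fin (L l))
  let mask : ∀ l, H l → Bits (Fin (L l)) := fun l h => bxor (fun i => h.2.1 (Sum.inr i))
    (sel (F.fAll h.2.2.1 fun j => h.2.1 (Sum.inl j)) h.2.2.2.2)
  let χ : ℕ → Type := fun l => F.PKey (Wd F L) l ⊕ (F.SKey (Wd F L) l ⊕ Fin (O₂.t l))
  have hs : PC fun l (h : H l) (z : Bits (χ l ⊕ (Fin (L l) ⊕ Fin (L l)))) =>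
      fun p : F.SKey (Wd F L) l => z (Sum.inl (Sum.inr (Sum.inl p))) :=
    PC.wires fun _ _ p => Sum.inl (Sum.inr (Sum.inl p))
  have hc : PC fun l (h : H l) (z : Bits (χ l ⊕ (Fin (L l) ⊕ Fin (L l)))) =>
      (Sum.elim (fun j => z (Sum.inl (Sum.inr (Sum.inr j)))) (Sum.elim h.2.2.2.2
        (bxor (msg h.1 fun i => z (Sum.inr i)) (mask l h))) : Bits (CtC O₂ l)) :=
    (PC.wires fun _ _ j => Sum.inl (Sum.inr (Sum.inr j))).pair
      ((PC.const fun l (h : H l) => h.2.2.2.2).pair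
        (PC.bxor (msg_pc fun l (h : H l) => h.1) (PC.const mask)))
  have hS : PS fun l (h : H l) (z : Bits (χ l)) =>
      stateOf U l (O₁.obf l (Sum.elim (F.plainData h.2.2.1) h.2.2.2.1)) :=
    (stateOf_ps.reparam fun _ _ => ()).pre (PC.const fun l (h : H l) =>
      O₁.obf l (Sum.elim (F.plainData h.2.2.1) h.2.2.2.1))
  have hp : PC fun l (h : H l) (z : Bits (χ l)) => fun p : F.PKey (Wd F L) l => z (Sum.inl p) :=
    PC.wires fun _ _ p => Sum.inl p
  have hpp := 𝒜.game_pp hp hs hc hS (PB.const fun l (h : H l) => h.1)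
  obtain ⟨ν, hν, h⟩ := BitPRF.lock_secure O₂ H _ hpp
  exact ⟨ν, hν, fun l b y K ω σ v => h l (b, y, K, ω, σ) v y⟩

/-- The data hardwired in a distinguisher. -/
abbrev ViewData (O₂ : DataObf (F.lock (W := Wd F L))) (l : ℕ) : Type :=
  (Wd F L l → Bool → Bits (Fin (F.r l))) × Bits (Wd F L l) ×
    Bits (Fin (O₂.t l)) × Bits (Fin (L l)) × Bits (Fin (L l)) × Bits (Fin (F.n l))

lemma view_pp (w : Bool) :
    PP fun l (h : ViewData O₂ l) (z : Bits (Idx L l ⊕ Fin (O₁.t l))) =>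
      view 𝒜 l w h.1 h.2.1 h.2.2.1 h.2.2.2.1 h.2.2.2.2.1 h.2.2.2.2.2 (fun i => z (Sum.inl i))
        (stateOf U l fun j => z (Sum.inr j)) true := by
  have hτ : PC fun l (h : ViewData O₂ l)
      (z : Bits ((Idx L l ⊕ Fin (O₁.t l)) ⊕ (Fin (L l) ⊕ Fin (L l)))) =>
      bxor (offset w fun i => z (Sum.inr i)) h.2.2.2.2.1 :=
    PC.bxor (offset_pc w) (PC.const fun l (h : ViewData O₂ l) => h.2.2.2.2.1)
  have hs : PC fun l (h : ViewData O₂ l)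
      (z : Bits ((Idx L l ⊕ Fin (O₁.t l)) ⊕ (Fin (L l) ⊕ Fin (L l)))) =>
      BitPRF.skOf h.1 (bxor h.2.1 (Sum.elim h.2.2.2.2.2 (bxor h.2.2.2.1
        (bxor (msg w fun i => z (Sum.inr i)) (sel (fun i => z (Sum.inl (Sum.inl i)))
          (bxor (offset w fun i => z (Sum.inr i)) h.2.2.2.2.1)))))) :=
    PC.skOf (W := Wd F L) (fun l (h : ViewData O₂ l) => h.1)
      (PC.bxor (PC.const fun l (h : ViewData O₂ l) => h.2.1)
        ((PC.const fun l (h : ViewData O₂ l) => h.2.2.2.2.2).pair (PC.bxor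
          (PC.const fun l (h : ViewData O₂ l) => h.2.2.2.1) (PC.bxor (msg_pc fun _ _ => w)
            (PC.sel (PC.wires fun _ _ i => Sum.inl (Sum.inl i)) hτ)))))
  have hc : PC fun l (h : ViewData O₂ l)
      (z : Bits ((Idx L l ⊕ Fin (O₁.t l)) ⊕ (Fin (L l) ⊕ Fin (L l)))) =>
      (Sum.elim h.2.2.1 (Sum.elim
        (bxor (offset w fun i => z (Sum.inr i)) h.2.2.2.2.1) h.2.2.2.1) : Bits (CtC O₂ l)) :=
    (PC.const fun l (h : ViewData O₂ l) => h.2.2.1).pair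
      (hτ.pair (PC.const fun l (h : ViewData O₂ l) => h.2.2.2.1))
  have hS : PS fun l (h : ViewData O₂ l) (z : Bits (Idx L l ⊕ Fin (O₁.t l))) =>
      stateOf U l fun j => z (Sum.inr j) :=
    (stateOf_ps.reparam fun _ _ => ()).pre (PC.wires fun _ _ j => Sum.inr j)
  exact 𝒜.game_pp (PC.const fun l (h : ViewData O₂ l) => BitPRF.pkOf h.1) hs hc hS
    (PB.const fun _ _ => true)

/-- The obfuscated program that maps `x` to `F_K(x) ⊕ twist ρ` in an encryption of the first message
can be replaced by the program for the functions themselves in an encryption of the second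
message. -/
lemma exists_view_prog : ∃ ν : ℕ → ℝ, Negligible ν ∧ ∀ l s t q e x,
    |(𝔼 ρ, 𝔼 K, 𝔼 ω, view 𝒜 l false s t q e ρ x (F.fAll K x) (stateOf U l (O₁.obf l (Sum.elim
        (F.pointData K x (bxor (F.fAll K x) (twist ρ))) ω))) true) -
      𝔼 ρ, 𝔼 K, 𝔼 ω, view 𝒜 l true s t q e ρ x (F.fAll K x) (stateOf U l (O₁.obf l (Sum.elim
        (F.plainData K) ω))) true| ≤ ν l := by
  obtain ⟨ν₁, hν₁, h₁⟩ := BitPRF.prog_secure F O₁ _ _ (view_pp 𝒜 false)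
  obtain ⟨ν₂, hν₂, h₂⟩ := BitPRF.prog_secure F O₁ _ _ (view_pp 𝒜 true)
  obtain ⟨ν₃, hν₃, -, h₃⟩ := O₁.secure (fun l => ViewData O₂ l × Bits (Idx L l)) _
    (PP.pre ((view_pp 𝒜 true).reparam fun l (h : ViewData O₂ l × Bits (Idx L l)) => h.1)
      ((PC.const fun l (h : ViewData O₂ l × Bits (Idx L l)) => h.2).pair .id))
  refine ⟨fun l => ν₁ l + ν₂ l + ν₃ l, (hν₁.add hν₂).add hν₃, fun l s t q e x => ?_⟩
  -- `F_K(x)` becomes uniform, the value is shifted, and `F_K(x)` is restored; then the value at `x` in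
  -- the program is the right one
  have e1 := abs_expect_sub_le fun ρ => h₁ l (s, t, q, e, ρ, x) x (twist ρ)
  have e2 := abs_expect_sub_le fun ρ => h₂ l (s, t, q, e, ρ, x) x fun _ => false
  have e3 := abs_expect_sub_le fun ρ => abs_expect_sub_le fun K => h₃ l
    ((s, t, q, e, ρ, x), F.fAll K x)
    (F.pointData K x fun i => Bool.xor (F.fAll K x i) false) (F.plainData K) fun z => by
      funext i
      rw [BitPRF.pointData, BitPRF.plainData, BitPRF.prog_progData, BitPRF.prog_progData]
      by_cases hz : z = x <;> simp [hz, BitPRF.fAll]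
  have e4 : (𝔼 ρ, 𝔼 K, 𝔼 u, 𝔼 ω, view 𝒜 l false s t q e ρ x u (stateOf U l (O₁.obf l (Sum.elim
        (F.pointData K x (bxor u (twist ρ))) ω))) true) =
      𝔼 ρ, 𝔼 K, 𝔼 u, 𝔼 ω, view 𝒜 l true s t q e ρ x u (stateOf U l (O₁.obf l (Sum.elim
        (F.pointData K x (bxor u fun _ => false)) ω))) true := by
    refine (expect_comm₄ _).trans (Eq.trans ?_ (expect_comm₄ _).symm)
    refine Finset.expect_congr rfl fun K _ => Finset.expect_congr rfl fun ω _ => ?_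
    have hu : ∀ u : Bits (Idx L l), bxor u (fun _ => false) = u := fun u => by funext; simp [bxor]
    have ht : ∀ ρ (u : Bits (Idx L l)), bxor (twist ρ) u = bxor u (twist ρ) := fun ρ u => by
      funext; exact Bool.xor_comm _ _
    have ht' : ∀ ρ (u : Bits (Idx L l)), bxor (bxor u (twist ρ)) (twist ρ) = u := fun ρ u => by
      funext; simp [bxor]
    simp only [hu, ← expect_view_twist]
    rw [expect_comm, expect_comm (fun u ρ => view 𝒜 l false s t q e ρ x (bxor u (twist ρ)) _ true)]
    refine Finset.expect_congr rfl fun ρ _ => ?_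
    have h := expect_bxor (twist ρ) fun u => view 𝒜 l false s t q e ρ x (bxor u (twist ρ))
      (stateOf U l (O₁.obf l (Sum.elim (F.pointData K x u) ω))) true
    simp only [ht, ht'] at h
    exact h
  have h : ∀ {a b c d e x y z : ℝ}, |a - b| ≤ x → |d - c| ≤ y → |d - e| ≤ z → b = c →
      |a - e| ≤ x + y + z := fun {a b c d e x y z} h₁ h₂ h₃ h₄ => by
    rw [abs_le] at *
    constructor <;> linarith [h₁.1, h₁.2, h₂.1, h₂.2, h₃.1, h₃.2]
  exact h e1 e2 e3 e4

/-- The reduction to unclonable obfuscation: the two parties, who receive `x`, compute the secret key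
from it, and the rest of the ciphertext does not depend on `x`. -/
lemma exists_view_upo : ∃ ν : ℕ → ℝ, Negligible ν ∧ ∀ l s t q e ρ K ω,
    𝔼 x, 𝔼 b : Bool, view 𝒜 l false s t q e ρ x (F.fAll K x) (stateOf U l (O₁.obf l (Sum.elim
      (if b then F.pointData K x (bxor (F.fAll K x) (twist ρ)) else F.plainData K) ω))) b ≤
        1 / 2 + ν l := by
  let H : ℕ → Type := fun l => (Wd F L l → Bool → Bits (Fin (F.r l))) × Bits (Wd F L l) ×
    Bits (Fin (O₂.t l)) × Bits (Fin (L l)) × Bits (Fin (L l)) ×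
      Bits (Idx L l × Fin (F.r l)) × Bits (Fin (O₁.r l))
  have hβ : PolyCard fun l => Fin (𝒜.β l) := .fin 𝒜.hβ
  have hγ : PolyCard fun l => Fin (𝒜.γ l) := .fin 𝒜.hγ
  -- the values at a point that is not hardwired
  have hf : PC fun l (h : H l) (x : Bits (Fin (F.n l))) => F.fAll (I := Idx L) h.2.2.2.2.2.1 x :=
    (F.fAll_pc.reparam fun _ _ => ()).comp ((PC.const fun l (h : H l) => h.2.2.2.2.2.1).pair .id)
  have hy : PC fun l (h : H l) (x : Bits (Fin (F.n l))) =>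
      bxor (F.fAll (I := Idx L) h.2.2.2.2.2.1 x) (twist h.2.2.2.2.1) :=
    PC.bxor hf (PC.const fun l (h : H l) => twist h.2.2.2.2.1)
  have hc : PC fun l (h : H l) (z : Bits (Empty ⊕ (Fin (L l) ⊕ Fin (L l)))) =>
      (Sum.elim h.2.2.1 (Sum.elim (bxor (offset false fun i => z (Sum.inr i)) h.2.2.2.2.1)
        h.2.2.2.1) : Bits (CtC O₂ l)) :=
    (PC.const fun l (h : H l) => h.2.2.1).pair
      ((PC.bxor (offset_pc false) (PC.const fun l (h : H l) => h.2.2.2.2.1)).pair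
        (PC.const fun l (h : H l) => h.2.2.2.1))
  have hs : PC fun l (h : H l) (z : Bits (Fin (F.n l) ⊕ (Fin (L l) ⊕ Fin (L l)))) =>
      BitPRF.skOf h.1 (bxor h.2.1 (Sum.elim (fun i => z (Sum.inl i)) (bxor h.2.2.2.1
        (bxor (msg false fun i => z (Sum.inr i)) (sel (F.fAll h.2.2.2.2.2.1 fun i => z (Sum.inl i))
          (bxor (offset false fun i => z (Sum.inr i)) h.2.2.2.2.1)))))) :=
    PC.skOf (W := Wd F L) (fun l (h : H l) => h.1)
      (PC.bxor (PC.const fun l (h : H l) => h.2.1)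
        ((PC.wires fun _ _ i => Sum.inl i).pair (PC.bxor
          (PC.const fun l (h : H l) => h.2.2.2.1) (PC.bxor (msg_pc fun _ _ => false)
            (PC.sel (hf.comp (PC.wires fun _ _ i => Sum.inl i))
              (PC.bxor (offset_pc false) (PC.const fun l (h : H l) => h.2.2.2.2.1)))))))
  obtain ⟨ν, hν, h⟩ := U.secure H _ _ _
    (fun l h => Sum.elim h.2.2.2.2.2.1 h.2.2.2.2.2.2) _ hy
    (fun l h => attack (𝒜.A l (BitPRF.pkOf h.1)) fun m => 𝒜.Λ l (Sum.elim h.2.2.1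
      (Sum.elim (bxor (offset false m) h.2.2.2.2.1) h.2.2.2.1)))
    (𝒜.attack_pk (χ := fun _ => Empty) (PC.const fun l (h : H l) => BitPRF.pkOf h.1) hc)
    _ ((𝒜.hB.reparam fun _ _ => ()).pre hs) _ ((𝒜.hC.reparam fun _ _ => ()).pre hs)
  refine ⟨ν, hν, fun l s t q e ρ K ω => ?_⟩
  refine (le_of_eq ?_).trans (h l (s, t, q, e, ρ, K, ω))
  refine Finset.expect_congr rfl fun x _ => Finset.expect_congr rfl fun b _ => ?_
  cases b <;> rfl

end

/-! ### Security of the encryption scheme -/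

section

variable {A B C D E K T S : Type*} [Fintype A] [Fintype B] [Fintype C] [Fintype D] [Fintype E]
  [Fintype K] [Fintype T] [Fintype S]

lemma expect_le_of_forall_le [Nonempty A] {f : A → ℝ} {c : ℝ} (h : ∀ a, f a ≤ c) : 𝔼 a, f a ≤ c :=
  Finset.expect_le Finset.univ_nonempty fun a _ => h a

lemma expect_comm₇' (f : A → B → C → D → E → K → T → ℝ) :
    𝔼 a, 𝔼 b, 𝔼 c, 𝔼 d, 𝔼 e, 𝔼 k, 𝔼 t, f a b c d e k t =
      𝔼 c, 𝔼 d, 𝔼 e, 𝔼 k, 𝔼 a, 𝔼 b, 𝔼 t, f a b c d e k t := by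
  simp only [expect_prod_eq]
  exact Fintype.expect_equiv ⟨fun p => (p.2.2.1, p.2.2.2.1, p.2.2.2.2.1, p.2.2.2.2.2.1, p.1, p.2.1,
    p.2.2.2.2.2.2), fun p => (p.2.2.2.2.1, p.2.2.2.2.2.1, p.1, p.2.1, p.2.2.1, p.2.2.2.1,
    p.2.2.2.2.2.2), fun _ => rfl, fun _ => rfl⟩ _ _ fun _ => rfl

/-- The parts of the random bits of key generation and encryption are independent. -/
lemma expect_split [DecidableEq A] [DecidableEq B] [DecidableEq C] [DecidableEq D] [DecidableEq E]
    [DecidableEq S] [DecidableEq T]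
    (G : (A ⊕ B → Bool) → ((C ⊕ ((D ⊕ E) ⊕ S)) ⊕ T → Bool) → ℝ) :
    𝔼 g, 𝔼 r, G g r = 𝔼 y, 𝔼 k, 𝔼 ω, 𝔼 σ, 𝔼 v, 𝔼 s, 𝔼 ω', G (Sum.elim v s)
      (Sum.elim (Sum.elim y (Sum.elim (Sum.elim k ω) σ)) ω') := by
  simp only [expect_sum]
  exact expect_comm₇' _

lemma expect_comm₇ (f : A → B → C → D → E → K → T → ℝ) :
    𝔼 a, 𝔼 b, 𝔼 c, 𝔼 d, 𝔼 e, 𝔼 k, 𝔼 t, f a b c d e k t =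
      𝔼 k, 𝔼 t, 𝔼 b, 𝔼 c, 𝔼 d, 𝔼 a, 𝔼 e, f a b c d e k t := by
  simp only [expect_prod_eq]
  exact Fintype.expect_equiv ⟨fun p => (p.2.2.2.2.2.1, p.2.2.2.2.2.2, p.2.1, p.2.2.1, p.2.2.2.1,
    p.1, p.2.2.2.2.1), fun p => (p.2.2.2.2.2.1, p.2.2.1, p.2.2.2.1, p.2.2.2.2.1, p.2.2.2.2.2.2,
    p.1, p.2.1), fun _ => rfl, fun _ => rfl⟩ _ _ fun _ => rfl

lemma expect_comm₆ (f : A → B → C → D → E → T → ℝ) :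
    𝔼 a, 𝔼 b, 𝔼 c, 𝔼 d, 𝔼 e, 𝔼 t, f a b c d e t =
      𝔼 t, 𝔼 d, 𝔼 a, 𝔼 b, 𝔼 c, 𝔼 e, f a b c d e t := by
  simp only [expect_prod_eq]
  exact Fintype.expect_equiv ⟨fun p => (p.2.2.2.2.2, p.2.2.2.1, p.1, p.2.1, p.2.2.1, p.2.2.2.2.1),
    fun p => (p.2.2.1, p.2.2.2.1, p.2.2.2.2.1, p.2.1, p.2.2.2.2.2, p.1),
    fun _ => rfl, fun _ => rfl⟩ _ _ fun _ => rfl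

lemma expect_comm₅ (f : A → B → C → D → E → ℝ) :
    𝔼 a, 𝔼 b, 𝔼 c, 𝔼 d, 𝔼 e, f a b c d e = 𝔼 e, 𝔼 a, 𝔼 d, 𝔼 b, 𝔼 c, f a b c d e := by
  simp only [expect_prod_eq]
  exact Fintype.expect_equiv ⟨fun p => (p.2.2.2.2, p.1, p.2.2.2.1, p.2.1, p.2.2.1),
    fun p => (p.2.1, p.2.2.2.1, p.2.2.2.2, p.2.2.1, p.1), fun _ => rfl, fun _ => rfl⟩ _ _
      fun _ => rfl

lemma expect_comm₉ {X : Type*} [Fintype X] (f : A → B → C → D → E → K → T → S → X → ℝ) :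
    𝔼 a, 𝔼 b, 𝔼 c, 𝔼 d, 𝔼 e, 𝔼 k, 𝔼 t, 𝔼 s, 𝔼 x, f a b c d e k t s x =
      𝔼 b, 𝔼 c, 𝔼 d, 𝔼 e, 𝔼 t, 𝔼 s, 𝔼 x, 𝔼 k, 𝔼 a, f a b c d e k t s x := by
  simp only [expect_prod_eq]
  exact Fintype.expect_equiv ⟨fun p => (p.2.1, p.2.2.1, p.2.2.2.1, p.2.2.2.2.1,
    p.2.2.2.2.2.2.1, p.2.2.2.2.2.2.2.1, p.2.2.2.2.2.2.2.2, p.2.2.2.2.2.1, p.1),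
    fun p => (p.2.2.2.2.2.2.2.2, p.1, p.2.1, p.2.2.1, p.2.2.2.1, p.2.2.2.2.2.2.2.1, p.2.2.2.2.1,
      p.2.2.2.2.2.1, p.2.2.2.2.2.2.1), fun _ => rfl, fun _ => rfl⟩ _ _ fun _ => rfl

end

section

variable {F : BitPRF} {L : ℕ → ℕ} [PolyCard fun l => Fin (L l)]
  {O₁ : DataObf (F.prog (I := Idx L))} {O₂ : DataObf (F.lock (W := Wd F L))}
  {U : CodeUPO (punctCode O₁)}
  (𝒜 : Adv L (F.PKey (Wd F L)) (F.SKey (Wd F L)) (CtC O₂) U.q)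

/-- The probability that the guesses are right if the message `msg b` is encrypted. -/
lemma expect_game (l : ℕ) (b : Bool) :
    𝔼 g : Bits (GenR F L l), 𝔼 r : Bits (EncR O₁ O₂ l),
      𝒜.game l (BitPRF.pkOf (seeds g)) (fun _ => BitPRF.skOf (seeds g) fun w => g (Sum.inl w))
        (fun m => encC O₁ O₂ l (Sum.elim (Sum.elim (BitPRF.pkOf (seeds g)) (msg b m)) r))
        (encQ O₁ O₂ U l r) b =
      𝔼 y, 𝔼 K, 𝔼 ω, 𝔼 σ, 𝔼 v, 𝔼 s, 𝔼 ω', trial 𝒜 l b s v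
        (O₂.obf l (Sum.elim (Sum.elim (BitPRF.pkOf s) (Sum.elim y fun _ => false)) ω')) y K ω σ := by
  refine (expect_split _).trans ?_
  refine Finset.expect_congr rfl fun y _ => Finset.expect_congr rfl fun K _ =>
    Finset.expect_congr rfl fun ω _ => Finset.expect_congr rfl fun σ _ =>
      Finset.expect_congr rfl fun v _ => ?_
  exact Fintype.expect_equiv ((Equiv.curry (Wd F L l × Bool) (Fin (F.r l)) Bool).trans
    (Equiv.curry (Wd F L l) Bool (Bits (Fin (F.r l))))) _ _ fun s => rfl

/-- If the lock hides `y ⊕ v`, then the masked message can be taken to be uniform. -/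
lemma expect_lossy (l : ℕ) (b : Bool) :
    𝔼 y, 𝔼 K, 𝔼 ω, 𝔼 σ, 𝔼 v, 𝔼 s, 𝔼 ω', trial 𝒜 l b s v
      (O₂.obf l (Sum.elim (Sum.elim (BitPRF.pkOf s) (Sum.elim (bxor y v) fun _ => true)) ω'))
        y K ω σ =
    𝔼 s, 𝔼 ω', 𝔼 t, 𝔼 e, 𝔼 x, 𝔼 ρ, 𝔼 K, 𝔼 ω, view 𝒜 l b s t
      (O₂.obf l (Sum.elim (Sum.elim (BitPRF.pkOf s) (Sum.elim t fun _ => true)) ω')) e ρ x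
        (F.fAll K x) (stateOf U l (O₁.obf l (Sum.elim (F.plainData K) ω))) b := by
  refine (expect_comm₇ _).trans ?_
  refine Finset.expect_congr rfl fun s _ => Finset.expect_congr rfl fun ω' _ => ?_
  have h1 : ∀ y t : Bits (Wd F L l), bxor y (bxor y t) = t := fun y t => by funext; simp [bxor]
  have h2 : ∀ y t : Bits (Wd F L l), bxor y t = bxor t y := fun y t => by
    funext; exact Bool.xor_comm _ _
  have h3 : ∀ K ω σ, 𝔼 y, 𝔼 v, trial 𝒜 l b s v
      (O₂.obf l (Sum.elim (Sum.elim (BitPRF.pkOf s) (Sum.elim (bxor y v) fun _ => true)) ω'))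
        y K ω σ = 𝔼 x, 𝔼 c, 𝔼 t, trial 𝒜 l b s (bxor t (Sum.elim x c))
      (O₂.obf l (Sum.elim (Sum.elim (BitPRF.pkOf s) (Sum.elim t fun _ => true)) ω'))
        (Sum.elim x c) K ω σ := by
    intro K ω σ
    refine Eq.trans ?_ (expect_sum fun y : Bits (Wd F L l) => 𝔼 t, trial 𝒜 l b s (bxor t y)
      (O₂.obf l (Sum.elim (Sum.elim (BitPRF.pkOf s) (Sum.elim t fun _ => true)) ω')) y K ω σ)
    refine Finset.expect_congr rfl fun y _ => ?_
    refine (expect_bxor y _).symm.trans (Finset.expect_congr rfl fun t _ => ?_)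
    rw [h1, h2]
  simp only [h3]
  refine (expect_comm₆ _).trans ?_
  refine Finset.expect_congr rfl fun t _ => ?_
  simp only [expect_trial]
  exact expect_comm₅ _

/-- The security of the encryption scheme: the success probabilities for the two messages are
those of the two worlds of the game for unclonable obfuscation, up to negligible errors. -/
lemma exists_game_le : ∃ ν : ℕ → ℝ, Negligible ν ∧ ∀ l,
    𝔼 g : Bits (GenR F L l), 𝔼 r : Bits (EncR O₁ O₂ l), 𝔼 b : Bool,
      𝒜.game l (BitPRF.pkOf (seeds g)) (fun _ => BitPRF.skOf (seeds g) fun w => g (Sum.inl w))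
        (fun m => encC O₁ O₂ l (Sum.elim (Sum.elim (BitPRF.pkOf (seeds g)) (msg b m)) r))
        (encQ O₁ O₂ U l r) b ≤ 1 / 2 + ν l := by
  obtain ⟨ν₁, hν₁, h₁⟩ := exists_trial_lock 𝒜
  obtain ⟨ν₂, hν₂, h₂⟩ := exists_view_prog 𝒜
  obtain ⟨ν₃, hν₃, h₃⟩ := exists_view_upo 𝒜
  refine ⟨fun l => ν₁ l + ν₂ l + ν₃ l, (hν₁.add hν₂).add hν₃, fun l => ?_⟩
  -- the averages with the program for the functions themselves, with guess `0` and `1`, and with the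
  -- program with a replaced value
  set V₀ := 𝔼 s, 𝔼 ω', 𝔼 t, 𝔼 e, 𝔼 x, 𝔼 ρ, 𝔼 K, 𝔼 ω, view 𝒜 l false s t
    (O₂.obf l (Sum.elim (Sum.elim (BitPRF.pkOf s) (Sum.elim t fun _ => true)) ω')) e ρ x
      (F.fAll K x) (stateOf U l (O₁.obf l (Sum.elim (F.plainData K) ω))) false with hV₀
  set V₁ := 𝔼 s, 𝔼 ω', 𝔼 t, 𝔼 e, 𝔼 x, 𝔼 ρ, 𝔼 K, 𝔼 ω, view 𝒜 l true s t
    (O₂.obf l (Sum.elim (Sum.elim (BitPRF.pkOf s) (Sum.elim t fun _ => true)) ω')) e ρ x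
      (F.fAll K x) (stateOf U l (O₁.obf l (Sum.elim (F.plainData K) ω))) true with hV₁
  set V₂ := 𝔼 s, 𝔼 ω', 𝔼 t, 𝔼 e, 𝔼 x, 𝔼 ρ, 𝔼 K, 𝔼 ω, view 𝒜 l false s t
    (O₂.obf l (Sum.elim (Sum.elim (BitPRF.pkOf s) (Sum.elim t fun _ => true)) ω')) e ρ x
      (F.fAll K x) (stateOf U l (O₁.obf l (Sum.elim
        (F.pointData K x (bxor (F.fAll K x) (twist ρ))) ω))) true with hV₂
  have e1 : ∀ b, |(𝔼 g : Bits (GenR F L l), 𝔼 r : Bits (EncR O₁ O₂ l),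
      𝒜.game l (BitPRF.pkOf (seeds g)) (fun _ => BitPRF.skOf (seeds g) fun w => g (Sum.inl w))
        (fun m => encC O₁ O₂ l (Sum.elim (Sum.elim (BitPRF.pkOf (seeds g)) (msg b m)) r))
        (encQ O₁ O₂ U l r) b) - if b then V₁ else V₀| ≤ ν₁ l := by
    intro b
    have h : |_ - _| ≤ ν₁ l := abs_expect_sub_le fun y => abs_expect_sub_le fun K =>
      abs_expect_sub_le fun ω => abs_expect_sub_le fun σ => abs_expect_sub_le fun v =>
        h₁ l b y K ω σ v
    rw [expect_lossy] at h
    rw [expect_game]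
    cases b <;> exact h
  have e2 : |V₂ - V₁| ≤ ν₂ l := abs_expect_sub_le fun s => abs_expect_sub_le fun ω' =>
    abs_expect_sub_le fun t => abs_expect_sub_le fun e => abs_expect_sub_le fun x =>
      h₂ l s t _ e x
  have e3 : (V₂ + V₀) / 2 ≤ 1 / 2 + ν₃ l := by
    have h : 𝔼 b : Bool, 𝔼 s, 𝔼 ω', 𝔼 t, 𝔼 e, 𝔼 x, 𝔼 ρ, 𝔼 K, 𝔼 ω, view 𝒜 l false s t
        (O₂.obf l (Sum.elim (Sum.elim (BitPRF.pkOf s) (Sum.elim t fun _ => true)) ω')) e ρ x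
          (F.fAll K x) (stateOf U l (O₁.obf l (Sum.elim (if b then
            F.pointData K x (bxor (F.fAll K x) (twist ρ)) else F.plainData K) ω))) b ≤
        1 / 2 + ν₃ l := by
      rw [expect_comm₉]
      exact expect_le_of_forall_le fun s => expect_le_of_forall_le fun ω' =>
        expect_le_of_forall_le fun t => expect_le_of_forall_le fun e =>
          expect_le_of_forall_le fun ρ => expect_le_of_forall_le fun K =>
            expect_le_of_forall_le fun ω => h₃ l s t _ e ρ K ω
    rw [Fintype.expect_eq_sum_div_card, Fintype.sum_bool, Fintype.card_bool] at h
    exact h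
  have e4 : ∀ G : Bits (GenR F L l) → Bits (EncR O₁ O₂ l) → Bool → ℝ,
      𝔼 g, 𝔼 r, 𝔼 b, G g r b = ((𝔼 g, 𝔼 r, G g r true) + 𝔼 g, 𝔼 r, G g r false) / 2 := by
    intro G
    have h : 𝔼 g, 𝔼 r, 𝔼 b, G g r b = 𝔼 b, 𝔼 g, 𝔼 r, G g r b := by
      rw [expect_comm fun b g => 𝔼 r, G g r b]
      exact Finset.expect_congr rfl fun g _ => expect_comm fun r b => G g r b
    rw [h, Fintype.expect_eq_sum_div_card, Fintype.sum_bool, Fintype.card_bool]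
    rfl
  rw [e4]
  have h0 := abs_le.1 (e1 false)
  have h1 := abs_le.1 (e1 true)
  have h2 := abs_le.1 e2
  simp only [if_true, Bool.false_eq_true, if_false] at h0 h1
  linarith [h0.2, h1.2, h2.1]

end

/-! ### The scheme is correct and secure -/

lemma exists_pkue_of_codeUPO {F : BitPRF} {L : ℕ → ℕ} (hL : PolyBdd L)
    [PolyCard fun l => Fin (L l)] (O₁ : DataObf (F.prog (I := Idx L)))
    (O₂ : DataObf (F.lock (W := Wd F L))) (U : CodeUPO (punctCode O₁)) :
    ∃ E : PKUE L, E.Correct ∧ E.Secure := by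
  have hs : PC fun l (_ : Unit) (g : Bits (GenR F L l)) => BitPRF.pkOf (F := F) (seeds g) := by
    refine PC.pi PolyCard.poly ?_
    exact PB.apply (F.G_pc.comp (PC.wires fun l (h : Unit × F.PKey (Wd F L) l) j =>
      Sum.inr ((h.2.1.1, h.2.1.2), j))) fun l (h : Unit × F.PKey (Wd F L) l) => h.2.2
  have hk : PC fun l (_ : Unit) (g : Bits (GenR F L l)) =>
      BitPRF.skOf (F := F) (seeds g) fun w => g (Sum.inl w) := by
    refine (PC.wires fun _ _ w => Sum.inl w).pair (PC.pi (κ := fun l => Wd F L l × Fin (F.r l))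
      PolyCard.poly ?_)
    refine (PB.cond (PB.var fun l (h : Unit × (Wd F L l × Fin (F.r l))) => Sum.inl h.2.1)
      (PB.var fun l (h : Unit × (Wd F L l × Fin (F.r l))) => Sum.inr ((h.2.1, true), h.2.2))
      (PB.var fun l (h : Unit × (Wd F L l × Fin (F.r l))) =>
        Sum.inr ((h.2.1, false), h.2.2))).congr fun l h g => ?_
    cases hh : g (Sum.inl h.2.1) <;> simp [hh, seeds]
  have hct : PolyCard fun l => Fin ((punctCode O₁).t l) := .fin (punctCode O₁).t_poly
  have hQ : PS fun l (_ : Unit) => encQ O₁ O₂ U l :=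
    U.obf_ps.pre ((punctCode O₁).code_pc.comp
      (PC.wires fun l _ i => Sum.inl (Sum.inr (Sum.inl i))))
  refine exists_pkue hL U.q_poly _ hs _ hk _ (encC_pc O₁ O₂) _ hQ _ (decr_pk O₁ O₂ U) ?_ ?_
  · obtain ⟨δ, hδ, h⟩ := U.correct
    exact ⟨δ, hδ, fun l g r m => decr_correct O₁ O₂ U g r m _ (h l)⟩
  · intro α β γ hα hβ hγ A hA Λ hΛ ΨB hB ΨC hC
    exact exists_game_le (U := U) (O₂ := O₂) ⟨α, β, γ, hβ, hγ, A, hA, Λ, hΛ, ΨB, hB, ΨC, hC⟩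

lemma exists_correct_secure_pkue (hObf : ExistsIndObf) (hPRF : ExistsPunctPRF)
    (hUPO : ExistsIdenticalGenUPO) {L : ℕ → ℕ} (hL : PolyBdd L) :
    ∃ E : PKUE L, E.Correct ∧ E.Secure := by
  obtain ⟨F⟩ := nonempty_bitPRF hPRF
  have hc := PolyCard.fin hL
  obtain ⟨O₁⟩ := nonempty_dataObf hObf (F.prog_pc (I := Idx L))
  obtain ⟨O₂⟩ := nonempty_dataObf hObf (BitPRF.lock_pc F (W := Wd F L))
  obtain ⟨U⟩ := nonempty_codeUPO hUPO (punctCode O₁) F.n_poly F.n_large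
  exact exists_pkue_of_codeUPO hL O₁ O₂ U

end UnclonableCrypto

end

theorem mainTheorem9
    (hObf : UnclonableCrypto.ExistsIndObf)
    (hPRF : UnclonableCrypto.ExistsPunctPRF)
    (hUPO : UnclonableCrypto.ExistsIdenticalGenUPO)
    (len : ℕ → ℕ) (hlen : UnclonableCrypto.PolyBdd len) :
    ∃ E : UnclonableCrypto.PKUE len, E.Correct ∧ E.Secure :=
  UnclonableCrypto.exists_correct_secure_pkue hObf hPRF hUPO hlen
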